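/- **Notation.** Let $\mathbb N=\{0,1,2,\dots\}$. A basic sequence is a sequence $Q=\{q_n\}_{n\ge1}$ of integers $q_n\ge2$; it is infinite in limit if $q_n\to\infty$. The $Q$-Cantor series expansion of a real $x$ is the unique expansion $x=E_0(x)+\sum_{n\ge1}\frac{E_n(x)}{q_1\cdots q_n}$ with $E_0(x)=\lfloor x\rfloor$, $E_n(x)\in\{0,\dots,q_n-1\}$ for $n\ge1$ and $E_n(x)\ne q_n-1$ infinitely often. Put $T_{Q,n}(x)=q_1\cdots q_n x\pmod 1$. An asymptotic distribution function (adf) is a non-decreasing $f:[0,1]\to[0,1]$ with $f(0)=0$, $f(1)=1$. A sequence $\omega=\{x_n\}$ in $[0,1)$ has upper (lower) adf $f$ if for all $\gamma\in[0,1]$ the $\limsup$ ($\liminf$), as $n\to\infty$, of the proportion of the first $n$ terms of $\omega$ that lie in $[0,\gamma)$ equals $f(\gamma)$. A linear family of adfs is a family $\{f_{m,r}\}_{m\ge1,\,0\le r<m}$ of adfs with $f_{m,r}=\frac1d\sum_{i=0}^{d-1}f_{md,mi+r}$ for all $m,r$ and all $d\ge1$. For $p,q\in\mathbb Z[X]$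 and $s\le n$ let $$d_{p,q,s,n}=\frac{\#\big(p(\mathbb N)\cap q(\mathbb N)\cap\{s,\dots,n\}\big)}{\#\big(q(\mathbb N)\cap\{s,\dots,n\}\big)}$$ (read as $0$ if the denominator is $0$), and write $q\lesssim p$ if $\limsup_{n\to\infty}d_{p,q,s,n}>0$ for some $s\in\mathbb N$. A set $P\subseteq\mathbb Z[X]$ of polynomials, each of them eventually strictly increasing on $\mathbb N$, is sparsely intersecting if for any two distinct $p,q\in P$ at least one of $p\lesssim q$, $q\lesssim p$ fails. **Computability.** A real number is computable if for some base $b\ge2$ its base $b$ digits after the point are given by a total recursive function. A family of reals $x_s$, indexed by tuples $s$ of natural numbers in some index set, is a computable sequence if there is one total recursive integer-valued function $F$ with $\frac{F(s,k)-1}{k}<x_s<\frac{F(s,k)+1}{k}$ for all indices $s$ and all $k\ge1$. $Q$ is computably growing if it is infinite in limit and $n\mapsto\min\{i\ge1:q_j\ge n\ \forall j\ge i\}$ is recursive. A sparsely intersecting set $P$ is explicit if $P=\{p_i:i\in\mathbb N\}$ for a recursive enumeration of polynomials by their coefficients (repetitions allowed) and there is a recursive function $N$ such that, whenever $p_i\ne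 p_j$, $k\ge1$ and $n-s>N(i,j,s,k)$, one has $d_{p_i,p_j,s,n}<\frac1k$ or $d_{p_j,p_i,s,n}<\frac1k$. For such $P$, a set of linear families $\{f_{p,m,r}\}$, $p\in P$, is explicit if: 1. the values $f_{p_i,m,r}(a)$, indexed by $i,m,r$ and the rationals $a\in[0,1]$, form a computable sequence, and $\inf\{x\in[0,1]:f_{p,m,r}(x)=a\}$ is a computable real for all $p,m,r$ and all rational $a\in[0,1]$ for which the set is non-empty; 2. there is a computable sequence of points $t_{i,m,r,n}\in[0,1]$ such that $\{f_{p_i,m,r}(t_{i,m,r,n})\}$ is a computable sequence and every discontinuity of $f_{p_i,m,r}$ is one of the $t_{i,m,r,n}$, $n\in\mathbb N$. **Theorem.** Let $Q$ be a basic sequence that is infinite in limit, $P$ a sparsely intersecting set of polynomials, each eventually strictly increasing on $\mathbb N$, and for each $p\in P$ let $\{\overline f_{p,m,r}\}$ and $\{\underline f_{p,m,r}\}$ be linear families of adfs with $\underline f_{p,m,r}\le\overline f_{p,m,r}$ on $[0,1]$ for all $m,r$; let $F$ denote this collection. Let $\Phi_{Q,P,F}$ be the set of $x\in[0,1)$ such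 that for all $p\in P$, $m\ge1$ and $0\le r<m$ the sequence $\{T_{Q,p(mn+r)}(x)\}_{n=0}^\infty$ has upper adf $\overline f_{p,m,r}$ and lower adf $\underline f_{p,m,r}$ (a negative index, which occurs at most finitely often, is replaced by $0$). Then $$\dim_H\Phi_{Q,P,F}=1.$$ Furthermore, if $Q$ is computable and computably growing, $P$ is explicit, and both $\{\overline f_{p,m,r}\}$ and $\{\underline f_{p,m,r}\}$ are explicit with respect to the same enumeration of $P$, then there are computable sequences of natural numbers $\{\alpha(n)\}$, $\{\beta(n)\}$ such that the set $\Phi'_{Q,P,F}=\{x\in[0,1):\alpha(n)\le E_n(x)\le\beta(n)\text{ for all }n\ge1\}$ satisfies $\Phi'_{Q,P,F}\subseteq\Phi_{Q,P,F}$ and $\dim_H\Phi'_{Q,P,F}=1$. -/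

import Mathlib

open Filter Set Polynomial

namespace CantorSeries

/-- A basic sequence `q 1, q 2, …` of integers at least `2`; the value `q 0` is never used. -/
def IsBasicSequence (q : ℕ → ℕ) : Prop :=
  ∀ n, 1 ≤ n → 2 ≤ q n

/-- The basic sequence tends to infinity. -/
def InfiniteInLimit (q : ℕ → ℕ) : Prop :=
  Tendsto q atTop atTop

/-- `q 1 * q 2 * ⋯ * q n`. -/
noncomputable def base (q : ℕ → ℕ) (n : ℕ) : ℝ :=
  ∏ i ∈ Finset.Icc 1 n, (q i : ℝ)

/-- `T q n x = q n ⋯ q 1 x (mod 1)`. -/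
noncomputable def T (q : ℕ → ℕ) (n : ℕ) (x : ℝ) : ℝ :=
  Int.fract (base q n * x)

/-- `E` is the Cantor series expansion of `x` with respect to the basic sequence `q`. -/
structure IsExpansion (q : ℕ → ℕ) (x : ℝ) (E : ℕ → ℤ) : Prop where
  zero : E 0 = ⌊x⌋
  digit : ∀ n, 1 ≤ n → 0 ≤ E n ∧ E n ≤ (q n : ℤ) - 1
  frequently : ∃ᶠ n in atTop, E n ≠ (q n : ℤ) - 1
  hasSum : HasSum (fun n : ℕ => (E (n + 1) : ℝ) / base q (n + 1)) (x - E 0)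

/-! ### Asymptotic distribution functions -/

/-- A non-decreasing `f : [0,1] → [0,1]` with `f 0 = 0` and `f 1 = 1`. Only the values of `f` on
`[0,1]` matter, here and in all that follows. -/
def IsAdf (f : ℝ → ℝ) : Prop :=
  MonotoneOn f (Icc 0 1) ∧ f 0 = 0 ∧ f 1 = 1

/-- The proportion of the first `n` terms of `ω` that lie in `[0, γ)`. -/
noncomputable def freq (ω : ℕ → ℝ) (γ : ℝ) (n : ℕ) : ℝ :=
  ({i : ℕ | i < n ∧ ω i ∈ Ico 0 γ}.ncard : ℝ) / n

def HasUpperAdf (ω : ℕ → ℝ) (f : ℝ → ℝ) : Prop :=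
  ∀ γ ∈ Icc (0 : ℝ) 1, limsup (freq ω γ) atTop = f γ

def HasLowerAdf (ω : ℕ → ℝ) (f : ℝ → ℝ) : Prop :=
  ∀ γ ∈ Icc (0 : ℝ) 1, liminf (freq ω γ) atTop = f γ

/-- `f m r`, for `m ≥ 1` and `0 ≤ r < m`, is a linear family of asymptotic distribution
functions. -/
structure IsLinearFamily (f : ℕ → ℕ → ℝ → ℝ) : Prop where
  isAdf : ∀ m r : ℕ, r < m → IsAdf (f m r)
  linear : ∀ m r d : ℕ, r < m → 1 ≤ d → ∀ x ∈ Icc (0 : ℝ) 1,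
    f m r x = (1 / (d : ℝ)) * ∑ i ∈ Finset.range d, f (m * d) (m * i + r) x

/-! ### Sparsely intersecting polynomials -/

/-- `n ↦ p n` is eventually (strictly) increasing on the natural numbers. -/
def EventuallyIncreasing (p : ℤ[X]) : Prop :=
  ∃ N : ℕ, StrictMonoOn (fun n : ℕ => p.eval (n : ℤ)) (Ici N)

/-- The set of values of `p` on the natural numbers. -/
def values (p : ℤ[X]) : Set ℤ :=
  range fun n : ℕ => p.eval (n : ℤ)

/-- The proportion, among the values of `q` in `{s, s + 1, …, n}`, of those that are also values
of `p`. -/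
noncomputable def overlap (p q : ℤ[X]) (s n : ℕ) : ℝ :=
  ((values p ∩ values q ∩ Icc (s : ℤ) n).ncard : ℝ) / ((values q ∩ Icc (s : ℤ) n).ncard : ℝ)

/-- `q ≲ p`: the values of `p` have positive upper density among the values of `q`. -/
def Lesssim (q p : ℤ[X]) : Prop :=
  ∃ s : ℕ, 0 < limsup (fun n : ℕ => overlap p q s n) atTop

/-- For any two distinct members `p`, `q` at least one of `p ≲ q` and `q ≲ p` fails. -/
def SparselyIntersecting (P : Set ℤ[X]) : Prop :=
  ∀ p ∈ P, ∀ q ∈ P, p ≠ q → ¬ Lesssim p q ∨ ¬ Lesssim q p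

/-- The set of `x ∈ [0,1)` such that, for all `p ∈ P` and `0 ≤ r < m`, the sequence
`n ↦ T q (p (m n + r)) x` has upper and lower asymptotic distribution functions `upper p m r` and
`lower p m r`. (Members of `P` are eventually increasing, so at most finitely many of the indices
`p (m n + r)` are negative; these are replaced by `0`.) -/
def Phi (q : ℕ → ℕ) (P : Set ℤ[X]) (upper lower : ℤ[X] → ℕ → ℕ → ℝ → ℝ) : Set ℝ :=
  {x | x ∈ Ico (0 : ℝ) 1 ∧ ∀ p ∈ P, ∀ m r : ℕ, r < m →
    HasUpperAdf (fun n : ℕ => T q (p.eval ((m * n + r : ℕ) : ℤ)).toNat x) (upper p m r) ∧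
    HasLowerAdf (fun n : ℕ => T q (p.eval ((m * n + r : ℕ) : ℤ)).toNat x) (lower p m r)}

/-! ### Computability -/

/-- The base `b` digits of `x` after the point are computable, for some `b ≥ 2`. -/
def IsComputableReal (x : ℝ) : Prop :=
  ∃ b : ℕ, 2 ≤ b ∧ ∃ f : ℕ → ℕ, Computable f ∧ ∀ n : ℕ, (f n : ℤ) = ⌊(b : ℝ) ^ (n + 1) * x⌋ % b

/-- The reals `x s`, for `s` in the set `S` of indices, form a computable (multi-)sequence: one
recursive function approximates them all. -/
def ComputableSeqOn {σ : Type} [Primcodable σ] (S : Set σ) (x : σ → ℝ) : Prop :=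
  ∃ F : σ × ℕ → ℤ, Computable F ∧ ∀ s ∈ S, ∀ k : ℕ, 1 ≤ k →
    ((F (s, k) : ℝ) - 1) / k < x s ∧ x s < ((F (s, k) : ℝ) + 1) / k

/-- `n ↦ inf {i : q j ≥ n for all j ≥ i}` is computable (and `q` tends to infinity). -/
def ComputablyGrowing (q : ℕ → ℕ) : Prop :=
  InfiniteInLimit q ∧ Computable fun n : ℕ => sInf {i : ℕ | 1 ≤ i ∧ ∀ j, i ≤ j → n ≤ q j}

/-- The polynomial with coefficients `a₀, a₁, …`, given as a list. -/
noncomputable def polyOfList (c : List ℤ) : ℤ[X] :=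
  c.foldr (fun a p => C a + X * p) 0

/-- `c` is a computable enumeration (possibly with repetitions) of `P`, polynomials being given by
their lists of coefficients. -/
def ComputablyEnumerates (c : ℕ → List ℤ) (P : Set ℤ[X]) : Prop :=
  Computable c ∧ P = range fun i => polyOfList (c i)

/-- The enumerated set of polynomials is explicitly sparsely intersecting. -/
def ExplicitlySparse (c : ℕ → List ℤ) : Prop :=
  ∃ N : ℕ × ℕ × ℕ × ℕ → ℕ, Computable N ∧
    ∀ i j : ℕ, polyOfList (c i) ≠ polyOfList (c j) → ∀ s k : ℕ, 1 ≤ k →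
      ∀ n : ℕ, s + N (i, j, s, k) < n →
        overlap (polyOfList (c i)) (polyOfList (c j)) s n < 1 / k ∨
        overlap (polyOfList (c j)) (polyOfList (c i)) s n < 1 / k

/-- The families `f (p i)`, for `p i` the polynomials enumerated by `c`, are explicit: values at
rationals are computable (uniformly); the level infima are computable; and the discontinuities of
the functions are among the terms of a computable sequence of points at which the values are
computable. -/
structure ExplicitFamilies (c : ℕ → List ℤ) (f : ℤ[X] → ℕ → ℕ → ℝ → ℝ) : Prop where
  /-- The indices are `(i, m, r, a, b)` with `0 ≤ r < m` and `a / b` a rational in `[0,1]`. -/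
  values_rat : ComputableSeqOn
    {s : ℕ × ℕ × ℕ × ℕ × ℕ | s.2.2.1 < s.2.1 ∧ 1 ≤ s.2.2.2.2 ∧ s.2.2.2.1 ≤ s.2.2.2.2}
    (fun s => f (polyOfList (c s.1)) s.2.1 s.2.2.1 ((s.2.2.2.1 : ℝ) / (s.2.2.2.2 : ℝ)))
  level_inf : ∀ i m r : ℕ, r < m → ∀ a : ℚ, 0 ≤ a → a ≤ 1 →
    IsComputableReal (sInf {x : ℝ | x ∈ Icc (0 : ℝ) 1 ∧ f (polyOfList (c i)) m r x = (a : ℝ)})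
  /-- The indices of `t` are `(i, m, r, n)` with `0 ≤ r < m`. -/
  discontinuities : ∃ t : ℕ × ℕ × ℕ × ℕ → ℝ,
    (∀ s, t s ∈ Icc (0 : ℝ) 1) ∧
    ComputableSeqOn {s | s.2.2.1 < s.2.1} t ∧
    ComputableSeqOn {s | s.2.2.1 < s.2.1}
      (fun s => f (polyOfList (c s.1)) s.2.1 s.2.2.1 (t s)) ∧
    ∀ i m r : ℕ, r < m → ∀ x ∈ Icc (0 : ℝ) 1,
      ¬ ContinuousWithinAt (f (polyOfList (c i)) m r) (Icc 0 1) x → ∃ n, t (i, m, r, n) = x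

/-- The set of `x ∈ [0,1)` all of whose digits satisfy `α n ≤ E n ≤ β n`, `n ≥ 1`. -/
def digitSet (q α β : ℕ → ℕ) : Set ℝ :=
  {x | x ∈ Ico (0 : ℝ) 1 ∧ ∃ E : ℕ → ℤ, IsExpansion q x E ∧
    ∀ n, 1 ≤ n → (α n : ℤ) ≤ E n ∧ E n ≤ (β n : ℤ)}

end CantorSeries

/-! ### Closure properties of computable functions -/

attribute [fun_prop] Computable ComputablePred Computable.const Computable.comp Computable.pair

namespace CantorSeries

section Computability

variable {α β γ : Type*} [Primcodable α] [Primcodable β] [Primcodable γ]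

/-! If all digits satisfy E_n ≤ q_n - 2, then T_{Q,v}(x) lies between E/q and (E+1)/q, where E is
the digit of index v+1 and q = q_{v+1}. Confining this digit to a suitable block of about q/h values
therefore steers T_{Q,v}(x) into a prescribed interval [a/h, (a+1)/h], and divides the number of
admissible digits by at most 4h. The bounds `lo` and `hi` do this for all polynomials at once, with
h growing slowly. Every point obeying them lies in Φ, and the set of these points has dimension 1.

Conflicts. A value v shared by several polynomials must be given to one of them. A later polynomial
j takes it from an earlier i only if, up to v, j has fewer values than i and their common values
make up at most 2^(-j) of those of i. With this rule sparse intersection makes the values that i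
loses to any single j negligible among the values of i, and the factors 2^(-j) control all
sufficiently late j together. So each polynomial, at its first index, keeps its values at all
arguments outside a set of density zero (`Oracle.ncard_lost_le`, `Represents.exists_exceptional`).

Distribution. At stage k the polynomial i follows a periodic pattern of intervals. For M = k! the
positions congruent to t modulo M receive quantiles of f_{M,t}; linearity then yields the right
distribution for every modulus m ≤ k (`IsLinearFamily.exists_points`). Only finitely many control
points matter at one stage, and the quantiles can be separated strictly from them, so a test on
integer approximations recognises a good pattern and the search for one ends
(`Approximates.exists_isPattern`). The control points are the rationals together with a sequence
containing all discontinuities, which suffices for monotone functions (`Determines`). Even stages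
aim at the upper function, odd stages at the lower one. Stage lengths grow so fast that a completed
stage outweighs all earlier ones, while the period of the next pattern is already negligible when
that pattern starts. This gives both the bounds on all frequencies and their attainment along ends
of stages (`eventually_le_count`, `frequently_le_count`, `Follows.hasUpperAdf_hasLowerAdf`).

Dimension. Writing y in [0,1) in the mixed radix of the numbers of admissible digits, and using its
digits to choose admissible ones, embeds [0,1) into the set. The inverse is Hölder of every exponent
s < 1 (`sub_le_rpow_embed_sub`), because the lost factors multiply to less than any power of q_1⋯q_n
(`exists_base_div_blocks_le`).

Effectivity. The construction consists of bounded operations and terminating searches on the integer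
data of an `Oracle`. Both halves of the theorem use it: the first with arbitrary approximations, the
second with computable ones (`mkOracle_spec`). -/

@[fun_prop]
theorem computable_id : Computable (fun a : α => a) := Computable.id

@[fun_prop]
theorem computable_fst {f : α → β × γ} (hf : Computable f) : Computable fun a => (f a).1 :=
  Computable.fst.comp hf

@[fun_prop]
theorem computable_snd {f : α → β × γ} (hf : Computable f) : Computable fun a => (f a).2 :=
  Computable.snd.comp hf

@[fun_prop]
theorem computable_add {f g : α → ℕ} (hf : Computable f) (hg : Computable g) :
    Computable fun a => f a + g a :=
  Primrec.nat_add.to_comp.comp hf hg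

@[fun_prop]
theorem computable_sub {f g : α → ℕ} (hf : Computable f) (hg : Computable g) :
    Computable fun a => f a - g a :=
  Primrec.nat_sub.to_comp.comp hf hg

@[fun_prop]
theorem computable_mul {f g : α → ℕ} (hf : Computable f) (hg : Computable g) :
    Computable fun a => f a * g a :=
  Primrec.nat_mul.to_comp.comp hf hg

@[fun_prop]
theorem computable_div {f g : α → ℕ} (hf : Computable f) (hg : Computable g) :
    Computable fun a => f a / g a :=
  Primrec.nat_div.to_comp.comp hf hg

@[fun_prop]
theorem computable_mod {f g : α → ℕ} (hf : Computable f) (hg : Computable g) :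
    Computable fun a => f a % g a :=
  Primrec.nat_mod.to_comp.comp hf hg

@[fun_prop]
theorem computable_pow {f g : α → ℕ} (hf : Computable f) (hg : Computable g) :
    Computable fun a => f a ^ g a :=
  ((Primrec₂.unpaired'.1 Nat.Primrec.pow).to_comp).comp hf hg

@[fun_prop]
theorem computable_length {f : α → List β} (hf : Computable f) :
    Computable fun a => (f a).length :=
  Computable.list_length.comp hf

@[fun_prop]
theorem computable_getD {f : α → List β} {g : α → ℕ} (d : β) (hf : Computable f)
    (hg : Computable g) : Computable fun a => (f a).getD (g a) d :=
  (Primrec.list_getD d).to_comp.comp hf hg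

@[fun_prop]
theorem computable_ofNat {δ : Type*} [Denumerable δ] {f : α → ℕ} (hf : Computable f) :
    Computable fun a => Denumerable.ofNat δ (f a) :=
  (Computable.ofNat δ).comp hf

@[fun_prop]
theorem computable_toNat {f : α → ℤ} (hf : Computable f) : Computable fun a => (f a).toNat := by
  have h : Computable fun z : ℤ => z.toNat := by
    have h1 : Computable fun n : ℕ => if n % 2 < 1 then n / 2 else 0 := by
      refine (((Primrec.nat_lt.decide.to_comp.comp (computable_mod computable_id
        (Computable.const 2)) (Computable.const 1)).cond (computable_div computable_id
        (Computable.const 2)) (Computable.const 0))).of_eq fun n => ?_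
      by_cases h : n % 2 < 1 <;> simp [h]
    refine (h1.comp (Computable.encode (α := ℤ))).of_eq fun z => ?_
    cases z with
    | ofNat n =>
      have : Encodable.encode (Int.ofNat n) = 2 * n := rfl
      rw [this]; simp
    | negSucc n =>
      have : Encodable.encode (Int.negSucc n) = 2 * n + 1 := rfl
      rw [this, if_neg (by omega)]; simp
  exact h.comp hf

@[fun_prop]
theorem computablePred_lt {f g : α → ℕ} (hf : Computable f) (hg : Computable g) :
    ComputablePred fun a => f a < g a :=
  ⟨inferInstance, Primrec.nat_lt.decide.to_comp.comp hf hg⟩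

@[fun_prop]
theorem computablePred_le {f g : α → ℕ} (hf : Computable f) (hg : Computable g) :
    ComputablePred fun a => f a ≤ g a :=
  ⟨inferInstance, Primrec.nat_le.decide.to_comp.comp hf hg⟩

@[fun_prop]
theorem computablePred_eq {f g : α → ℕ} (hf : Computable f) (hg : Computable g) :
    ComputablePred fun a => f a = g a :=
  ⟨inferInstance, (Primrec.eq (α := ℕ)).decide.to_comp.comp hf hg⟩

@[fun_prop]
theorem computablePred_and {p r : α → Prop} (hp : ComputablePred p) (hr : ComputablePred r) :
    ComputablePred fun a => p a ∧ r a := by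
  classical
  exact ⟨inferInstance, (Primrec.and.to_comp.comp hp.decide hr.decide).of_eq fun a => by simp⟩

@[fun_prop]
theorem computablePred_or {p r : α → Prop} (hp : ComputablePred p) (hr : ComputablePred r) :
    ComputablePred fun a => p a ∨ r a := by
  classical
  exact ⟨inferInstance, (Primrec.or.to_comp.comp hp.decide hr.decide).of_eq fun a => by simp⟩

attribute [fun_prop] ComputablePred.not

@[fun_prop]
theorem computable_ite {c : α → Prop} [DecidablePred c] {f g : α → β} (hc : ComputablePred c)
    (hf : Computable f) (hg : Computable g) : Computable fun a => if c a then f a else g a := by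
  simpa [Bool.cond_decide] using hc.decide.cond hf hg

@[fun_prop]
theorem computable_natRec {f : α → ℕ} {g : α → β} {h : α → ℕ → β → β} (hf : Computable f)
    (hg : Computable g) (hh : Computable fun p : α × ℕ × β => h p.1 p.2.1 p.2.2) :
    Computable fun a => (Nat.rec (g a) (fun n b => h a n b) (f a) : β) :=
  Computable.nat_rec hf hg (h := fun a p => h a p.1 p.2) hh

@[fun_prop]
theorem computable_sum {b : α → ℕ} {g : α → ℕ → ℕ} (hb : Computable b)
    (hg : Computable fun p : α × ℕ => g p.1 p.2) :
    Computable fun a => ∑ i ∈ Finset.range (b a), g a i := by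
  have h : Computable fun a => (Nat.rec 0 (fun n s => s + g a n) (b a) : ℕ) := by
    refine computable_natRec (h := fun a n s => s + g a n) hb (Computable.const 0) ?_
    have : Computable fun p : α × ℕ × ℕ => g p.1 p.2.1 :=
      hg.comp (g := fun p : α × ℕ × ℕ => (p.1, p.2.1)) (by fun_prop)
    fun_prop
  refine h.of_eq fun a => ?_
  induction b a with
  | zero => simp
  | succ n ih => rw [Finset.sum_range_succ, ← ih]

/-- Bounded universal quantification. -/
def ForallLt (b : ℕ) (p : ℕ → Prop) : Prop := ∀ i < b, p i

/-- Bounded existential quantification. -/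
def ExistsLt (b : ℕ) (p : ℕ → Prop) : Prop := ∃ i < b, p i

/-- The least natural number with a property. -/
noncomputable def least (p : ℕ → Prop) : ℕ := sInf {n | p n}

theorem least_spec {p : ℕ → Prop} (h : ∃ n, p n) : p (least p) := Nat.sInf_mem h

theorem least_le {p : ℕ → Prop} {n : ℕ} (h : p n) : least p ≤ n := Nat.sInf_le h

theorem not_of_lt_least {p : ℕ → Prop} {n : ℕ} (h : n < least p) : ¬ p n :=
  fun hn => absurd (least_le hn) (by omega)

@[fun_prop]
theorem computablePred_forallLt {b : α → ℕ} {p : α → ℕ → Prop} (hb : Computable b)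
    (hp : ComputablePred fun x : α × ℕ => p x.1 x.2) :
    ComputablePred fun a => ForallLt (b a) (p a) := by
  classical
  -- Bounded quantification amounts to the number of counterexamples being zero.
  have h : ComputablePred fun a => ∑ i ∈ Finset.range (b a), (if p a i then 0 else 1) < 1 := by
    have : Computable fun x : α × ℕ => if p x.1 x.2 then 0 else 1 := by fun_prop
    fun_prop
  refine h.of_eq fun a => ?_
  simp [ForallLt]

@[fun_prop]
theorem computablePred_existsLt {b : α → ℕ} {p : α → ℕ → Prop} (hb : Computable b)
    (hp : ComputablePred fun x : α × ℕ => p x.1 x.2) :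
    ComputablePred fun a => ExistsLt (b a) (p a) := by
  have h : ComputablePred fun a => ¬ ForallLt (b a) (fun i => ¬ p a i) := by fun_prop
  refine h.of_eq fun a => ?_
  simp [ForallLt, ExistsLt]

theorem computable_least {p : α → ℕ → Prop} (hp : ComputablePred fun x : α × ℕ => p x.1 x.2)
    (h : ∀ a, ∃ n, p a n) : Computable fun a => least (p a) := by
  classical
  exact (Computable.find hp h).of_eq fun a => (Nat.sInf_def (h a)).symm

end Computability

end CantorSeries

namespace CantorSeries

/-! ### The digit construction -/

/-- The integer data from which the digit bounds are computed: the basic sequence, a modulus of its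
growth, the `i`-th polynomial as a difference of two natural numbers, and approximations to the
points `pt` and to the values `val` there; their index is `((σ, i, m, r, j), k)`, where `σ = 0`
refers to the upper and `σ = 1` to the lower distribution functions. -/
structure Oracle where
  q : ℕ → ℕ
  growth : ℕ → ℕ
  pos : ℕ × ℕ → ℕ
  neg : ℕ × ℕ → ℕ
  pt : (ℕ × ℕ × ℕ × ℕ × ℕ) × ℕ → ℕ
  val : (ℕ × ℕ × ℕ × ℕ × ℕ) × ℕ → ℕ

structure Oracle.IsComputable (o : Oracle) : Prop where
  q : Computable o.q
  growth : Computable o.growth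
  pos : Computable o.pos
  neg : Computable o.neg
  pt : Computable o.pt
  val : Computable o.val

attribute [fun_prop] Oracle.IsComputable.q Oracle.IsComputable.growth Oracle.IsComputable.pos
  Oracle.IsComputable.neg Oracle.IsComputable.pt Oracle.IsComputable.val

namespace Oracle

variable (o : Oracle)

/-- The `i`-th polynomial takes the value `v` at `n`. -/
def Takes (i n v : ℕ) : Prop := o.pos (i, n) = v + o.neg (i, n)

/-- `v` is a value of the `i`-th polynomial, at an argument that is at most `2 * v`. -/
def Hits (i v : ℕ) : Prop := ExistsLt (2 * v + 1) fun n => o.Takes i n v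

open Classical in
noncomputable def cnt (i v : ℕ) : ℕ := ∑ w ∈ Finset.range (v + 1), if o.Hits i w then 1 else 0

open Classical in
noncomputable def cnt₂ (i j v : ℕ) : ℕ :=
  ∑ w ∈ Finset.range (v + 1), if o.Hits i w ∧ o.Hits j w then 1 else 0

/-- The later polynomial `j` takes precedence over the earlier polynomial `i` at `v`. -/
def Overtakes (i j v : ℕ) : Prop :=
  o.cnt j v < o.cnt i v ∧ 2 ^ j * o.cnt₂ i j v ≤ o.cnt i v

/-- At `v`, the polynomial `i` takes precedence over the polynomial `j`. -/
def Beats (i j v : ℕ) : Prop :=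
  (i < j ∧ ¬ o.Overtakes i j v) ∨ (j < i ∧ o.Overtakes j i v)

/-- Only rivals j ≤ v are compared, which keeps the condition decidable. Every fixed rival is taken
into account from v = j on. -/
def Owns (i v : ℕ) : Prop :=
  o.Hits i v ∧ ForallLt (v + 1) fun j => j = i ∨ ¬ o.Hits j v ∨ o.Beats i j v

/-- The polynomial that owns `v`, a number greater than `v` if there is none. -/
noncomputable def owner (v : ℕ) : ℕ := least fun i => v < i ∨ o.Owns i v

/-- The argument at which the `i`-th polynomial takes the value `v`. -/
noncomputable def time (i v : ℕ) : ℕ := least fun n => 2 * v < n ∨ o.Takes i n v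

/-- The number of positions `n`, congruent to `r` modulo `m`, whose interval in the pattern lies to
the left of all points within `1 / c.1` of `S / c.1`. -/
def leftCount (c : ℕ × List ℕ) (m r S : ℕ) : ℕ :=
  ∑ n ∈ Finset.range c.2.length, if n % m = r ∧ c.2.getD n 0 + 2 ≤ S then 1 else 0

def rightCount (c : ℕ × List ℕ) (m r S : ℕ) : ℕ :=
  ∑ n ∈ Finset.range c.2.length, if n % m = r ∧ S + 1 ≤ c.2.getD n 0 then 1 else 0

/-- The pattern `c`, read as the periodic sequence of the intervals `[a / c.1, (a + 1) / c.1]` with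
`a` in the list `c.2`, is verified to have approximately the right distribution at the points
`pt`, along all progressions with small modulus. -/
def IsPattern (k i : ℕ) (c : ℕ × List ℕ) : Prop :=
  4 ≤ c.1 ∧ 0 < c.2.length ∧ (ForallLt c.2.length fun n => c.2.getD n 0 < c.1) ∧
  ForallLt k fun m => c.2.length % (m + 1) = 0 ∧ ForallLt (m + 1) fun r => ForallLt k fun j =>
    o.val ((k % 2, i, m + 1, r, j), k) * c.2.length ≤
      k * (m + 1) * leftCount c (m + 1) r (o.pt ((k % 2, i, m + 1, r, j), c.1)) +
        2 * c.2.length ∧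
    k * c.2.length ≤
      k * (m + 1) * rightCount c (m + 1) r (o.pt ((k % 2, i, m + 1, r, j), c.1)) +
        (o.val ((k % 2, i, m + 1, r, j), k) + 2) * c.2.length

noncomputable def pattern (k i : ℕ) : ℕ × List ℕ :=
  Denumerable.ofNat (ℕ × List ℕ)
    (least fun z => o.IsPattern k i (Denumerable.ofNat (ℕ × List ℕ) z))

/-- Collects what must be small compared with the time at which stage k begins: the period of each
pattern bounds the error from an incomplete period, while the denominator h and the index beyond
which q is at least 2^h decide where the pattern may be imposed. -/
noncomputable def cost (k : ℕ) : ℕ :=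
  ∑ i ∈ Finset.range (k + 1),
    ((o.pattern k i).2.length + (o.pattern k i).1 + o.growth (2 ^ (o.pattern k i).1))

/-- The factor k + 1 makes the earlier stages and the costs of the ending and of the coming stage a
fraction at most 1/(k+1) of the elapsed time. -/
noncomputable def start (k : ℕ) : ℕ :=
  Nat.rec 0 (fun k s => (k + 1) * (s + o.cost k + o.cost (k + 1) + 1)) k

noncomputable def stage (n : ℕ) : ℕ := least fun k => n < o.start (k + 1)

/-- The pattern in force at `v`. -/
noncomputable def current (v : ℕ) : ℕ × List ℕ :=
  o.pattern (o.stage (o.time (o.owner v) v)) (o.owner v)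

noncomputable def target (v : ℕ) : ℕ :=
  (o.current v).2.getD (o.time (o.owner v) v % (o.current v).2.length) 0

/-- The first condition excludes values without an owner. The other two bound the denominator by
log₂ q(v+1) and by v; the estimate of the dimension needs both. -/
def Restricted (v : ℕ) : Prop :=
  o.owner v ≤ v ∧ 2 ^ (o.current v).1 ≤ o.q (v + 1) ∧ (o.current v).1 ≤ v

open Classical in
/-- The lower bound for the digit with index `v + 1`. -/
noncomputable def lo (v : ℕ) : ℕ :=
  if o.Restricted v then o.target v * o.q (v + 1) / (o.current v).1 + 1 else 0

open Classical in
/-- The upper bound for the digit with index `v + 1`. -/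
noncomputable def hi (v : ℕ) : ℕ :=
  if o.Restricted v then (o.target v + 1) * o.q (v + 1) / (o.current v).1 - 2
  else o.q (v + 1) - 2

/-! ### Computability of the digit bounds -/

section Computability

variable {o} {α : Type*} [Primcodable α]

@[fun_prop]
theorem computablePred_takes (ho : o.IsComputable) {f g h : α → ℕ} (hf : Computable f)
    (hg : Computable g) (hh : Computable h) : ComputablePred fun a => o.Takes (f a) (g a) (h a) := by
  unfold Takes; fun_prop (disch := assumption)

@[fun_prop]
theorem computablePred_hits (ho : o.IsComputable) {f g : α → ℕ} (hf : Computable f)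
    (hg : Computable g) : ComputablePred fun a => o.Hits (f a) (g a) := by
  unfold Hits; fun_prop (disch := assumption)

@[fun_prop]
theorem computable_cnt (ho : o.IsComputable) {f g : α → ℕ} (hf : Computable f)
    (hg : Computable g) : Computable fun a => o.cnt (f a) (g a) := by
  unfold cnt; fun_prop (disch := assumption)

@[fun_prop]
theorem computable_cnt₂ (ho : o.IsComputable) {f g h : α → ℕ} (hf : Computable f)
    (hg : Computable g) (hh : Computable h) : Computable fun a => o.cnt₂ (f a) (g a) (h a) := by
  unfold cnt₂; fun_prop (disch := assumption)

@[fun_prop]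
theorem computablePred_beats (ho : o.IsComputable) {f g h : α → ℕ} (hf : Computable f)
    (hg : Computable g) (hh : Computable h) : ComputablePred fun a => o.Beats (f a) (g a) (h a) := by
  unfold Beats Overtakes; fun_prop (disch := assumption)

@[fun_prop]
theorem computablePred_owns (ho : o.IsComputable) {f g : α → ℕ} (hf : Computable f)
    (hg : Computable g) : ComputablePred fun a => o.Owns (f a) (g a) := by
  unfold Owns; fun_prop (disch := assumption)

@[fun_prop]
theorem computable_owner (ho : o.IsComputable) {f : α → ℕ} (hf : Computable f) :
    Computable fun a => o.owner (f a) := by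
  unfold owner
  exact computable_least (by fun_prop (disch := assumption)) fun a => ⟨f a + 1, .inl (by omega)⟩

@[fun_prop]
theorem computable_time (ho : o.IsComputable) {f g : α → ℕ} (hf : Computable f)
    (hg : Computable g) : Computable fun a => o.time (f a) (g a) := by
  unfold time
  exact computable_least (by fun_prop (disch := assumption))
    fun a => ⟨2 * g a + 1, .inl (by omega)⟩

@[fun_prop]
theorem computable_leftCount {f : α → ℕ × List ℕ} {g h k : α → ℕ} (hf : Computable f)
    (hg : Computable g) (hh : Computable h) (hk : Computable k) :
    Computable fun a => leftCount (f a) (g a) (h a) (k a) := by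
  unfold leftCount; fun_prop

@[fun_prop]
theorem computable_rightCount {f : α → ℕ × List ℕ} {g h k : α → ℕ} (hf : Computable f)
    (hg : Computable g) (hh : Computable h) (hk : Computable k) :
    Computable fun a => rightCount (f a) (g a) (h a) (k a) := by
  unfold rightCount; fun_prop

@[fun_prop]
theorem computablePred_isPattern (ho : o.IsComputable) {f g : α → ℕ} {h : α → ℕ × List ℕ}
    (hf : Computable f) (hg : Computable g) (hh : Computable h) :
    ComputablePred fun a => o.IsPattern (f a) (g a) (h a) := by
  unfold IsPattern; fun_prop (disch := assumption)

-- The search through all codes is total because a pattern exists for every k and i.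
@[fun_prop]
theorem computable_pattern (ho : o.IsComputable) (hex : ∀ k i, ∃ c, o.IsPattern k i c)
    {f g : α → ℕ} (hf : Computable f) (hg : Computable g) :
    Computable fun a => o.pattern (f a) (g a) := by
  unfold pattern
  refine (Computable.ofNat _).comp (computable_least (by fun_prop (disch := assumption))
    fun a => ?_)
  obtain ⟨c, hc⟩ := hex (f a) (g a)
  exact ⟨Encodable.encode c, by rwa [Denumerable.ofNat_encode]⟩

@[fun_prop]
theorem computable_cost (ho : o.IsComputable) (hex : ∀ k i, ∃ c, o.IsPattern k i c)
    {f : α → ℕ} (hf : Computable f) : Computable fun a => o.cost (f a) := by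
  unfold cost; fun_prop (disch := assumption)

@[fun_prop]
theorem computable_start (ho : o.IsComputable) (hex : ∀ k i, ∃ c, o.IsPattern k i c)
    {f : α → ℕ} (hf : Computable f) : Computable fun a => o.start (f a) := by
  unfold start; fun_prop (disch := assumption)

theorem start_succ (k : ℕ) :
    o.start (k + 1) = (k + 1) * (o.start k + o.cost k + o.cost (k + 1) + 1) := rfl

theorem start_lt_start_succ (k : ℕ) : o.start k < o.start (k + 1) := by
  rw [start_succ]
  nlinarith [Nat.zero_le (k * (o.start k + o.cost k + o.cost (k + 1) + 1))]

theorem start_strictMono : StrictMono o.start := strictMono_nat_of_lt_succ start_lt_start_succ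

theorem lt_start_succ (n : ℕ) : n < o.start (n + 1) := start_strictMono.le_apply

@[fun_prop]
theorem computable_stage (ho : o.IsComputable) (hex : ∀ k i, ∃ c, o.IsPattern k i c)
    {f : α → ℕ} (hf : Computable f) : Computable fun a => o.stage (f a) := by
  unfold stage
  exact computable_least (by fun_prop (disch := assumption)) fun a => ⟨f a, lt_start_succ _⟩

@[fun_prop]
theorem computable_current (ho : o.IsComputable) (hex : ∀ k i, ∃ c, o.IsPattern k i c)
    {f : α → ℕ} (hf : Computable f) : Computable fun a => o.current (f a) := by
  unfold current; fun_prop (disch := assumption)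

@[fun_prop]
theorem computable_target (ho : o.IsComputable) (hex : ∀ k i, ∃ c, o.IsPattern k i c)
    {f : α → ℕ} (hf : Computable f) : Computable fun a => o.target (f a) := by
  unfold target; fun_prop (disch := assumption)

@[fun_prop]
theorem computablePred_restricted (ho : o.IsComputable) (hex : ∀ k i, ∃ c, o.IsPattern k i c)
    {f : α → ℕ} (hf : Computable f) : ComputablePred fun a => o.Restricted (f a) := by
  unfold Restricted; fun_prop (disch := assumption)

theorem computable_lo (ho : o.IsComputable) (hex : ∀ k i, ∃ c, o.IsPattern k i c) :
    Computable o.lo := by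
  unfold lo; fun_prop (disch := assumption)

theorem computable_hi (ho : o.IsComputable) (hex : ∀ k i, ∃ c, o.IsPattern k i c) :
    Computable o.hi := by
  unfold hi; fun_prop (disch := assumption)

end Computability

end Oracle

end CantorSeries

namespace CantorSeries

/-! ### Cantor series and restricted digits -/

theorem base_zero (q : ℕ → ℕ) : base q 0 = 1 := by simp [base]

theorem base_succ (q : ℕ → ℕ) (n : ℕ) : base q (n + 1) = base q n * q (n + 1) := by
  rw [base, Finset.prod_Icc_succ_top (by omega), base]

theorem two_pow_le_base {q : ℕ → ℕ} (hq : IsBasicSequence q) (n : ℕ) : (2 : ℝ) ^ n ≤ base q n := by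
  induction n with
  | zero => simp [base_zero]
  | succ n ih =>
    rw [base_succ, pow_succ]
    have : (2 : ℝ) ≤ q (n + 1) := by exact_mod_cast hq (n + 1) (by omega)
    have : (0 : ℝ) ≤ base q n := le_trans (by positivity) ih
    gcongr

theorem base_pos {q : ℕ → ℕ} (hq : IsBasicSequence q) (n : ℕ) : 0 < base q n :=
  lt_of_lt_of_le (by positivity) (two_pow_le_base hq n)

theorem one_le_base {q : ℕ → ℕ} (hq : IsBasicSequence q) (n : ℕ) : 1 ≤ base q n :=
  (one_le_pow₀ (by norm_num)).trans (two_pow_le_base hq n)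

/-- The integer whose quotient by `base q n` is the `n`-th partial sum of the series with digits
`e 0, e 1, …`. -/
def partialInt (q : ℕ → ℕ) (e : ℕ → ℤ) : ℕ → ℤ
  | 0 => 0
  | n + 1 => partialInt q e n * q (n + 1) + e n

/-! ### Partial sums and tails of Cantor series -/

section Series

variable {q : ℕ → ℕ} {e : ℕ → ℤ}

theorem sum_digits (hq : IsBasicSequence q) (n : ℕ) :
    ∑ k ∈ Finset.range n, (e k : ℝ) / base q (k + 1) = partialInt q e n / base q n := by
  induction n with
  | zero => simp [partialInt]
  | succ n ih =>
    have h1 := base_pos hq n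
    have h2 := base_pos hq (n + 1)
    rw [Finset.sum_range_succ, ih, partialInt]
    rw [base_succ] at h2 ⊢
    have : (q (n + 1) : ℝ) ≠ 0 := by
      rintro h; simp [h] at h2
    push_cast
    field_simp

/-- These are the right ends of the nested cylinder intervals, so they bound the sum of the series
from above. -/
theorem partialInt_add_one_antitone (hq : IsBasicSequence q)
    (he : ∀ n, e n ≤ (q (n + 1) : ℤ) - 1) :
    Antitone fun n => ((partialInt q e n : ℝ) + 1) / base q n := by
  refine antitone_nat_of_succ_le fun n => ?_
  have h1 := base_pos hq n
  have h2 := base_pos hq (n + 1)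
  rw [div_le_div_iff₀ h2 h1, partialInt, base_succ]
  have : (e n : ℝ) ≤ q (n + 1) - 1 := by exact_mod_cast he n
  push_cast
  nlinarith

theorem summable_digits (hq : IsBasicSequence q)
    (he : ∀ n, 0 ≤ e n ∧ e n ≤ (q (n + 1) : ℤ) - 1) :
    Summable fun n => (e n : ℝ) / base q (n + 1) := by
  refine summable_of_sum_range_le (c := 1) (fun n => ?_) fun n => ?_
  · exact div_nonneg (by exact_mod_cast (he n).1) (base_pos hq _).le
  · rw [sum_digits hq]
    have := partialInt_add_one_antitone hq (fun n => (he n).2) (Nat.zero_le n)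
    have h1 := base_pos hq n
    simp only [partialInt, base_zero] at this
    norm_num at this
    refine le_trans ?_ this
    gcongr
    linarith

theorem hasSum_digits_bounds (hq : IsBasicSequence q)
    (he : ∀ n, 0 ≤ e n ∧ e n ≤ (q (n + 1) : ℤ) - 1) {x : ℝ}
    (hx : HasSum (fun n => (e n : ℝ) / base q (n + 1)) x) (n : ℕ) :
    (partialInt q e n : ℝ) ≤ base q n * x ∧ base q n * x ≤ partialInt q e n + 1 := by
  have h1 := base_pos hq n
  constructor
  · rw [mul_comm, ← div_le_iff₀ h1, ← sum_digits hq]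
    exact sum_le_hasSum _ (fun k _ => div_nonneg (by exact_mod_cast (he k).1)
      (base_pos hq _).le) hx
  · rw [mul_comm, ← le_div_iff₀ h1]
    refine le_of_tendsto hx.tendsto_sum_nat ?_
    filter_upwards [eventually_ge_atTop n] with m hm
    rw [sum_digits hq]
    refine le_trans ?_ (partialInt_add_one_antitone hq (fun n => (he n).2) hm)
    have := base_pos hq m
    dsimp only
    gcongr
    linarith

/-- The tail may fill its cylinder up to the right end. Digits at most q - 2 keep that end below 1,
so the fractional part is still obtained by subtracting `partialInt`. -/
theorem T_mem_Ico (hq : IsBasicSequence q)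
    (he : ∀ n, 0 ≤ e n ∧ e n ≤ (q (n + 1) : ℤ) - 2) {x : ℝ}
    (hx : HasSum (fun n => (e n : ℝ) / base q (n + 1)) x) (n : ℕ) :
    (e n : ℝ) / q (n + 1) ≤ T q n x ∧ T q n x ≤ ((e n : ℝ) + 1) / q (n + 1) := by
  have hq2 : (2 : ℝ) ≤ q (n + 1) := by exact_mod_cast hq (n + 1) (by omega)
  have he' : ∀ n, 0 ≤ e n ∧ e n ≤ (q (n + 1) : ℤ) - 1 := fun n => ⟨(he n).1, by have := (he n).2; omega⟩
  obtain ⟨h1, h2⟩ := hasSum_digits_bounds hq he' hx (n + 1)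
  rw [base_succ, partialInt] at h1 h2
  push_cast at h1 h2
  have h0 : (0 : ℝ) ≤ e n := by exact_mod_cast (he n).1
  have h3 : (e n : ℝ) ≤ q (n + 1) - 2 := by exact_mod_cast (he n).2
  have h4 : (e n : ℝ) / q (n + 1) ≤ base q n * x - partialInt q e n := by
    rw [div_le_iff₀ (by linarith)]; linarith
  have h5 : base q n * x - partialInt q e n ≤ ((e n : ℝ) + 1) / q (n + 1) := by
    rw [le_div_iff₀ (by linarith)]; linarith
  have h6 : ((e n : ℝ) + 1) / q (n + 1) < 1 := by
    rw [div_lt_one (by linarith)]; linarith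
  have h7 : T q n x = base q n * x - partialInt q e n := by
    rw [T, Int.fract_eq_iff]
    refine ⟨le_trans (by positivity) h4, by linarith, partialInt q e n, by ring⟩
  rw [h7]
  exact ⟨h4, h5⟩

/-- Reading the same digits in a larger radix can only enlarge a nonnegative difference of
numerators; the common shift l cancels. -/
theorem partialInt_sub_le {M : ℕ → ℕ} {a a' : ℕ → ℤ} {d d' : ℕ → ℤ}
    (hM : ∀ n, M n ≤ q (n + 1)) (ha0 : a 0 = 0) (ha0' : a' 0 = 0)
    (ha : ∀ n, a (n + 1) = a n * M n + d n) (ha' : ∀ n, a' (n + 1) = a' n * M n + d' n)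
    (hle : ∀ n, a n ≤ a' n) (l : ℕ → ℤ) (n : ℕ) :
    a' n - a n ≤ partialInt q (fun n => l n + d' n) n - partialInt q (fun n => l n + d n) n := by
  induction n with
  | zero => simp [ha0, ha0', partialInt]
  | succ n ih =>
    rw [ha, ha', partialInt, partialInt]
    have h1 : (M n : ℤ) ≤ q (n + 1) := by exact_mod_cast hM n
    have h2 := hle n
    nlinarith

end Series

/-! ### Hausdorff dimension of sets with restricted digits -/

section Dimension

variable {q lo hi : ℕ → ℕ}

/-- The number of admissible digits. -/
def choices (lo hi : ℕ → ℕ) (n : ℕ) : ℕ := hi n - lo n + 1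

/-- The number of admissible blocks of `n` digits. -/
def blocks (lo hi : ℕ → ℕ) (n : ℕ) : ℕ := ∏ i ∈ Finset.range n, choices lo hi i

/-- The digits of `y` in the Cantor series with respect to the numbers of admissible digits. -/
noncomputable def choiceDigit (lo hi : ℕ → ℕ) (y : ℝ) (n : ℕ) : ℤ :=
  ⌊(blocks lo hi (n + 1) : ℝ) * y⌋ - ⌊(blocks lo hi n : ℝ) * y⌋ * choices lo hi n

theorem blocks_pos (lo hi : ℕ → ℕ) (n : ℕ) : 0 < blocks lo hi n :=
  Finset.prod_pos fun _ _ => by simp [choices]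

theorem blocks_succ (lo hi : ℕ → ℕ) (n : ℕ) :
    blocks lo hi (n + 1) = blocks lo hi n * choices lo hi n := Finset.prod_range_succ _ _

/-- The summand `(lo n - hi n : ℕ)` compensates for truncated subtraction in `choices` and vanishes
when lo n ≤ hi n. -/
theorem choiceDigit_bounds (y : ℝ) (n : ℕ) :
    0 ≤ choiceDigit lo hi y n ∧ choiceDigit lo hi y n ≤ hi n - lo n + (lo n - hi n : ℕ) := by
  have hc : (choices lo hi n : ℤ) = hi n - lo n + (lo n - hi n : ℕ) + 1 := by
    unfold choices; omega
  have hc0 : (0 : ℝ) < choices lo hi n := by simp [choices]; positivity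
  have h1 := Int.floor_le ((blocks lo hi n : ℝ) * y)
  have h2 := Int.lt_floor_add_one ((blocks lo hi n : ℝ) * y)
  unfold choiceDigit
  constructor
  · rw [sub_nonneg, Int.le_floor, blocks_succ]
    push_cast
    nlinarith
  · have : ⌊(blocks lo hi (n + 1) : ℝ) * y⌋
        < (⌊(blocks lo hi n : ℝ) * y⌋ + 1) * choices lo hi n := by
      rw [Int.floor_lt, blocks_succ]
      push_cast
      nlinarith
    rw [add_mul, one_mul] at this
    omega

/-- The point whose digits exceed the least admissible ones by the digits of `y`. -/
noncomputable def embed (q lo hi : ℕ → ℕ) (y : ℝ) : ℝ :=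
  ∑' n, (((lo n : ℤ) + choiceDigit lo hi y n : ℤ) : ℝ) / base q (n + 1)

theorem digit_bounds (hlo : ∀ n, lo n ≤ hi n) (hhi : ∀ n, hi n + 2 ≤ q (n + 1)) (y : ℝ) (n : ℕ) :
    ((lo n : ℤ) ≤ lo n + choiceDigit lo hi y n ∧ lo n + choiceDigit lo hi y n ≤ hi n) ∧
    0 ≤ (lo n : ℤ) + choiceDigit lo hi y n ∧
      (lo n : ℤ) + choiceDigit lo hi y n ≤ (q (n + 1) : ℤ) - 2 := by
  have := choiceDigit_bounds (lo := lo) (hi := hi) y n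
  have h1 := hlo n
  have h2 := hhi n
  omega

theorem hasSum_embed (hq : IsBasicSequence q) (hlo : ∀ n, lo n ≤ hi n)
    (hhi : ∀ n, hi n + 2 ≤ q (n + 1)) (y : ℝ) :
    HasSum (fun n => (((lo n : ℤ) + choiceDigit lo hi y n : ℤ) : ℝ) / base q (n + 1))
      (embed q lo hi y) :=
  (summable_digits hq fun n => ⟨(digit_bounds hlo hhi y n).2.1,
    by have := (digit_bounds hlo hhi y n).2.2; omega⟩).hasSum

theorem embed_mem_digitSet (hq : IsBasicSequence q) (hlo : ∀ n, lo n ≤ hi n)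
    (hhi : ∀ n, hi n + 2 ≤ q (n + 1)) (y : ℝ) :
    embed q lo hi y ∈ digitSet q (fun n => lo (n - 1)) (fun n => hi (n - 1)) := by
  have hs := hasSum_embed hq hlo hhi y
  have hb := digit_bounds hlo hhi y
  have hx : embed q lo hi y ∈ Ico (0 : ℝ) 1 := by
    have h1 := hasSum_digits_bounds hq (fun n => ⟨(hb n).2.1, by have := (hb n).2.2; omega⟩) hs 0
    have h2 := hasSum_digits_bounds hq (fun n => ⟨(hb n).2.1, by have := (hb n).2.2; omega⟩) hs 1
    rw [base_zero] at h1
    rw [base_succ, base_zero] at h2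
    simp only [partialInt] at h1 h2
    push_cast at h1 h2
    refine ⟨by linarith [h1.1], ?_⟩
    have h3 : ((lo 0 : ℝ) + choiceDigit lo hi y 0) ≤ q 1 - 2 := by exact_mod_cast (hb 0).2.2
    have h4 : (2 : ℝ) ≤ q 1 := by exact_mod_cast hq 1 le_rfl
    norm_num at h2
    nlinarith [h2.2]
  refine ⟨hx, fun n => if n = 0 then 0 else lo (n - 1) + choiceDigit lo hi y (n - 1),
    ⟨?_, ?_, ?_, ?_⟩, ?_⟩
  · simp [Int.floor_eq_zero_iff.2 hx]
  · intro n hn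
    obtain ⟨n, rfl⟩ : ∃ k, n = k + 1 := ⟨n - 1, by omega⟩
    have := (hb n).2
    simp
    omega
  · refine (Eventually.frequently ?_)
    filter_upwards [eventually_ge_atTop 1] with n hn
    obtain ⟨n, rfl⟩ : ∃ k, n = k + 1 := ⟨n - 1, by omega⟩
    have := (hb n).2
    simp
    omega
  · simpa using hs
  · intro n hn
    obtain ⟨n, rfl⟩ : ∃ k, n = k + 1 := ⟨n - 1, by omega⟩
    have := (hb n).1
    simp
    omega

/-- The Hölder estimate for the inverse of `embed`. Let k + 1 be the first level at which the
integer parts of y and y' differ by at least 2. Level k + 1 bounds y' - y through the distance of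
the images, level k bounds it absolutely, and a geometric mean of the two bounds eliminates the
scale. -/
theorem sub_le_rpow_embed_sub (hq : IsBasicSequence q) (hlo : ∀ n, lo n ≤ hi n)
    (hhi : ∀ n, hi n + 2 ≤ q (n + 1)) {s C : ℝ} (hs0 : 0 < s) (hs1 : s < 1) (hC : 0 < C)
    (h : ∀ n, base q (n + 1) / blocks lo hi (n + 1) ≤ C * base q n ^ (1 - s))
    {y y' : ℝ} (hy : y ∈ Ico (0 : ℝ) 1) (hy' : y' ∈ Ico (0 : ℝ) 1) (hlt : y < y') :
    0 < embed q lo hi y' - embed q lo hi y ∧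
    y' - y ≤ 3 * C * (embed q lo hi y' - embed q lo hi y) ^ s := by
  have hB := base_pos hq
  have hN : ∀ n, (0 : ℝ) < blocks lo hi n := fun n => by exact_mod_cast blocks_pos lo hi n
  have hcq : ∀ n, choices lo hi n ≤ q (n + 1) := fun n => by
    have := hhi n; unfold choices; omega
  set a : ℕ → ℤ := fun n => ⌊(blocks lo hi n : ℝ) * y⌋ with ha
  set a' : ℕ → ℤ := fun n => ⌊(blocks lo hi n : ℝ) * y'⌋ with ha'
  have ha1 : ∀ n, (a n : ℝ) ≤ blocks lo hi n * y := fun n => Int.floor_le _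
  have ha2 : ∀ n, (blocks lo hi n : ℝ) * y < a n + 1 := fun n => Int.lt_floor_add_one _
  have ha1' : ∀ n, (a' n : ℝ) ≤ blocks lo hi n * y' := fun n => Int.floor_le _
  have ha2' : ∀ n, (blocks lo hi n : ℝ) * y' < a' n + 1 := fun n => Int.lt_floor_add_one _
  have hle : ∀ n, a n ≤ a' n := fun n => Int.floor_mono (by have := hN n; nlinarith)
  -- The hypothesis forces the numbers of blocks to infinity, at least like a multiple of base^s.
  -- Once there are more than 3 / (y' - y) blocks, the integer parts are far enough apart.
  have hex : ∃ n, 2 ≤ a' n - a n := by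
    have hlim : Tendsto (fun n => base q (n + 1) ^ s) atTop atTop := by
      refine (tendsto_rpow_atTop hs0).comp ((tendsto_add_atTop_iff_nat 1).2 ?_)
      exact tendsto_atTop_mono (two_pow_le_base hq)
        (tendsto_pow_atTop_atTop_of_one_lt (by norm_num))
    obtain ⟨n, hn⟩ := (hlim.eventually_gt_atTop (C * (3 / (y' - y)))).exists
    refine ⟨n + 1, ?_⟩
    have h1 := h n
    have h2 : base q n ^ (1 - s) ≤ base q (n + 1) ^ (1 - s) := by
      refine Real.rpow_le_rpow (hB n).le ?_ (by linarith)
      rw [base_succ]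
      have : (2 : ℝ) ≤ q (n + 1) := by exact_mod_cast hq (n + 1) (by omega)
      have := hB n
      nlinarith
    have h3 : base q (n + 1) = base q (n + 1) ^ s * base q (n + 1) ^ (1 - s) := by
      rw [← Real.rpow_add (hB _)]; simp
    rw [div_le_iff₀ (hN _)] at h1
    have h5 : 0 < base q (n + 1) ^ (1 - s) := Real.rpow_pos_of_pos (hB _) _
    have h4 : base q (n + 1) ^ s ≤ C * blocks lo hi (n + 1) := by
      refine le_of_mul_le_mul_right ?_ h5
      rw [← h3]
      have := hN (n + 1)
      calc base q (n + 1) ≤ C * base q n ^ (1 - s) * blocks lo hi (n + 1) := h1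
        _ ≤ C * base q (n + 1) ^ (1 - s) * blocks lo hi (n + 1) := by gcongr
        _ = _ := by ring
    have h6 : 3 / (y' - y) < blocks lo hi (n + 1) := lt_of_mul_lt_mul_left (hn.trans_le h4) hC.le
    rw [div_lt_iff₀ (by linarith)] at h6
    have h7 : (1 : ℝ) < a' (n + 1) - a (n + 1) := by
      linarith [ha1 (n + 1), ha2' (n + 1)]
    have : (1 : ℤ) < a' (n + 1) - a (n + 1) := by exact_mod_cast h7
    omega
  classical
  -- At level 0 both integer parts vanish, so the first good level has a predecessor.
  obtain ⟨k, hk⟩ : ∃ k, Nat.find hex = k + 1 := by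
    refine ⟨Nat.find hex - 1, ?_⟩
    have : Nat.find hex ≠ 0 := by
      intro h0
      have := Nat.find_spec hex
      rw [h0] at this
      simp [ha, ha', blocks, Int.floor_eq_zero_iff.2 hy, Int.floor_eq_zero_iff.2 hy'] at this
    omega
  have hk2 : 2 ≤ a' (k + 1) - a (k + 1) := hk ▸ Nat.find_spec hex
  have hk1 : a' k - a k ≤ 1 := by
    have := Nat.find_min hex (m := k) (by omega)
    omega
  have hdiff := partialInt_sub_le (q := q) (M := choices lo hi) (a := a) (a' := a')
    (d := choiceDigit lo hi y) (d' := choiceDigit lo hi y') hcq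
    (by simp [ha, blocks, Int.floor_eq_zero_iff.2 hy])
    (by simp [ha', blocks, Int.floor_eq_zero_iff.2 hy'])
    (fun n => by simp [ha, choiceDigit]) (fun n => by simp [ha', choiceDigit]) hle
    (fun n => lo n) (k + 1)
  have hb1 := (hasSum_digits_bounds hq (fun n => ⟨(digit_bounds hlo hhi y n).2.1,
    by have := (digit_bounds hlo hhi y n).2.2; omega⟩) (hasSum_embed hq hlo hhi y) (k + 1)).2
  have hb2 := (hasSum_digits_bounds hq (fun n => ⟨(digit_bounds hlo hhi y' n).2.1,
    by have := (digit_bounds hlo hhi y' n).2.2; omega⟩) (hasSum_embed hq hlo hhi y') (k + 1)).1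
  set r := embed q lo hi y' - embed q lo hi y with hr
  set g : ℝ := a' (k + 1) - a (k + 1) with hg
  have hg2 : 2 ≤ g := by rw [hg]; exact_mod_cast hk2
  -- The numerators of the two cylinders differ by at least g, which leaves a gap of g - 1 units,
  -- and g - 1 ≥ g/2 since g ≥ 2.
  have hrB : g ≤ 2 * (base q (k + 1) * r) := by
    have hd : g ≤ (partialInt q (fun n => (lo n : ℤ) + choiceDigit lo hi y' n) (k + 1) : ℝ) -
        partialInt q (fun n => (lo n : ℤ) + choiceDigit lo hi y n) (k + 1) := by
      rw [hg]; exact_mod_cast hdiff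
    have : base q (k + 1) * r = base q (k + 1) * embed q lo hi y' -
      base q (k + 1) * embed q lo hi y := by rw [hr]; ring
    linarith
  have hr0 : 0 < r := by
    by_contra hcon
    have := hB (k + 1)
    nlinarith
  refine ⟨hr0, ?_⟩
  have hBk := hB k
  have hBk1 := hB (k + 1)
  have hNk := hN k
  have hNk1 := hN (k + 1)
  have hq2 : (2 : ℝ) ≤ q (k + 1) := by exact_mod_cast hq (k + 1) (by omega)
  -- the two estimates for `y' - y`
  have hX : y' - y ≤ 3 * C * r * base q k ^ (1 - s) := by
    have h1 : (blocks lo hi (k + 1) : ℝ) * (y' - y) ≤ 3 * (base q (k + 1) * r) := by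
      linarith [ha1 (k + 1), ha2' (k + 1)]
    have h2 := h k
    rw [div_le_iff₀ hNk1] at h2
    have h3 : (blocks lo hi (k + 1) : ℝ) * (y' - y) ≤
        (blocks lo hi (k + 1) : ℝ) * (3 * C * r * base q k ^ (1 - s)) := by
      nlinarith
    exact le_of_mul_le_mul_left h3 hNk1
  have hY : y' - y ≤ 3 * C * base q k ^ (-s) := by
    have h1 : (blocks lo hi k : ℝ) * (y' - y) ≤ 2 := by
      have : (a' k - a k : ℝ) ≤ 1 := by exact_mod_cast hk1
      linarith [ha1 k, ha2' k]
    have h2 : base q k / blocks lo hi k ≤ C * base q k ^ (1 - s) := by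
      refine le_trans ?_ (h k)
      rw [div_le_div_iff₀ hNk hNk1, base_succ, blocks_succ]
      have : (choices lo hi k : ℝ) ≤ q (k + 1) := by exact_mod_cast hcq k
      push_cast
      nlinarith [mul_pos hBk hNk]
    have h3 : base q k ^ (1 - s) = base q k * base q k ^ (-s) := by
      rw [sub_eq_add_neg, Real.rpow_add hBk, Real.rpow_one]
    rw [h3, div_le_iff₀ hNk] at h2
    have h4 : 1 ≤ C * base q k ^ (-s) * blocks lo hi k := by
      refine le_of_mul_le_mul_left ?_ hBk
      linarith
    have h5 : (blocks lo hi k : ℝ) * (y' - y) ≤ blocks lo hi k * (3 * C * base q k ^ (-s)) := by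
      linarith
    exact le_of_mul_le_mul_left h5 hNk
  have hyy : 0 < y' - y := by linarith
  have hp : 0 < base q k ^ (1 - s) := Real.rpow_pos_of_pos hBk _
  have hp' : 0 < base q k ^ (-s) := Real.rpow_pos_of_pos hBk _
  -- Weights s and 1 - s are the ones for which the powers of `base q k` cancel: (1-s)s - s(1-s) =
  -- 0.
  calc y' - y = (y' - y) ^ s * (y' - y) ^ (1 - s) := by rw [← Real.rpow_add hyy]; simp
    _ ≤ (3 * C * r * base q k ^ (1 - s)) ^ s * (3 * C * base q k ^ (-s)) ^ (1 - s) := by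
        have := Real.rpow_le_rpow hyy.le hX hs0.le
        have := Real.rpow_le_rpow hyy.le hY (by linarith : 0 ≤ 1 - s)
        gcongr
    _ = (3 * C) ^ s * r ^ s * (base q k ^ (1 - s)) ^ s *
          ((3 * C) ^ (1 - s) * (base q k ^ (-s)) ^ (1 - s)) := by
        rw [Real.mul_rpow (by positivity) hp.le, Real.mul_rpow (by positivity) hr0.le,
          Real.mul_rpow (by positivity) hp'.le]
    _ = ((3 * C) ^ s * (3 * C) ^ (1 - s)) * r ^ s *
          ((base q k ^ (1 - s)) ^ s * (base q k ^ (-s)) ^ (1 - s)) := by ring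
    _ = 3 * C * r ^ s := by
        rw [← Real.rpow_add (by positivity), ← Real.rpow_mul hBk.le, ← Real.rpow_mul hBk.le,
          ← Real.rpow_add hBk]
        have : (1 - s) * s + -s * (1 - s) = 0 := by ring
        rw [this]
        simp

/-- The inverse of `embed` is s-Hölder and maps onto [0,1), which has dimension 1, and an s-Hölder
map multiplies dimension by at most 1/s. -/
theorem le_dimH_digitSet (hq : IsBasicSequence q) (hlo : ∀ n, lo n ≤ hi n)
    (hhi : ∀ n, hi n + 2 ≤ q (n + 1)) {s : NNReal} {C : ℝ} (hs0 : 0 < s) (hs1 : s < 1) (hC : 0 < C)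
    (h : ∀ n, base q (n + 1) / blocks lo hi (n + 1) ≤ C * base q n ^ (1 - s : ℝ)) :
    (s : ENNReal) ≤ dimH (digitSet q (fun n => lo (n - 1)) (fun n => hi (n - 1))) := by
  have key := fun {y y' : ℝ} (hy : y ∈ Ico (0 : ℝ) 1) (hy' : y' ∈ Ico (0 : ℝ) 1) (hlt : y < y') =>
    sub_le_rpow_embed_sub hq hlo hhi (s := s) (C := C) hs0 hs1 hC h hy hy' hlt
  have hinj : InjOn (embed q lo hi) (Ico 0 1) := by
    intro y hy y' hy' heq
    by_contra hne
    rcases lt_or_gt_of_ne hne with hlt | hlt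
    · have := (key hy hy' hlt).1; linarith
    · have := (key hy' hy hlt).1; linarith
  set φ := Function.invFunOn (embed q lo hi) (Ico 0 1) with hφ
  have hφe : ∀ y ∈ Ico (0 : ℝ) 1, φ (embed q lo hi y) = y := fun y hy =>
    hinj.leftInvOn_invFunOn hy
  have hhold : HolderOnWith (3 * C).toNNReal s φ (embed q lo hi '' Ico 0 1) := by
    have hlt : ∀ y ∈ Ico (0 : ℝ) 1, ∀ y' ∈ Ico (0 : ℝ) 1, y < y' →
        edist y y' ≤ ((3 * C).toNNReal : ENNReal) *
          edist (embed q lo hi y) (embed q lo hi y') ^ (s : ℝ) := by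
      intro y hy y' hy' hlt
      obtain ⟨h1, h2⟩ := key hy hy' hlt
      rw [edist_comm, edist_comm (embed q lo hi y), edist_dist, edist_dist, Real.dist_eq,
        Real.dist_eq, abs_of_pos (by linarith), abs_of_pos h1,
        ENNReal.ofReal_rpow_of_pos h1, ← ENNReal.ofReal.eq_1, ← ENNReal.ofReal_mul (by positivity)]
      exact ENNReal.ofReal_le_ofReal h2
    rintro _ ⟨y, hy, rfl⟩ _ ⟨y', hy', rfl⟩
    rw [hφe y hy, hφe y' hy']
    rcases lt_trichotomy y y' with hl | rfl | hl
    · exact hlt y hy y' hy' hl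
    · simp
    · rw [edist_comm, edist_comm (embed q lo hi y)]
      exact hlt y' hy' y hy hl
  have himg : φ '' (embed q lo hi '' Ico 0 1) = Ico 0 1 := by
    rw [image_image]
    ext y
    constructor
    · rintro ⟨z, hz, rfl⟩; simpa only [hφe z hz] using hz
    · exact fun hy => ⟨y, hy, hφe y hy⟩
  have h1 := hhold.dimH_image_le hs0
  rw [himg, Real.dimH_of_nonempty_interior (by simp), Module.finrank_self] at h1
  rw [ENNReal.le_div_iff_mul_le (by left; simpa using hs0.ne') (by simp)] at h1
  refine le_trans (by simpa using h1) (dimH_mono ?_)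
  rintro _ ⟨y, -, rfl⟩
  exact embed_mem_digitSet hq hlo hhi y

/-- Past the threshold the ratio of the products no longer increases, so its finitely many earlier
values bound it. -/
theorem exists_prod_le_of_eventually_le {w g : ℕ → ℝ} (hw : ∀ n, 0 < w n) (hg : ∀ n, 0 < g n)
    (h : ∀ᶠ n in atTop, w n ≤ g n) :
    ∃ C > 0, ∀ n, ∏ i ∈ Finset.range n, w i ≤ C * ∏ i ∈ Finset.range n, g i := by
  obtain ⟨n₀, hn₀⟩ := eventually_atTop.1 h
  have hW : ∀ n, 0 < ∏ i ∈ Finset.range n, w i := fun n => Finset.prod_pos fun i _ => hw i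
  have hG : ∀ n, 0 < ∏ i ∈ Finset.range n, g i := fun n => Finset.prod_pos fun i _ => hg i
  set f : ℕ → ℝ := fun n => (∏ i ∈ Finset.range n, w i) / ∏ i ∈ Finset.range n, g i with hf
  have hf0 : ∀ n, 0 < f n := fun n => div_pos (hW n) (hG n)
  have hsum : ∀ n ≤ n₀, f n ≤ ∑ i ∈ Finset.range (n₀ + 1), f i := fun n hn =>
    Finset.single_le_sum (f := f) (fun i _ => (hf0 i).le) (by simp; omega)
  refine ⟨∑ i ∈ Finset.range (n₀ + 1), f i, Finset.sum_pos (fun i _ => hf0 i) (by simp),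
    fun n => ?_⟩
  rw [← div_le_iff₀ (hG n)]
  rcases le_total n n₀ with hn | hn
  · exact hsum n hn
  · induction n, hn using Nat.le_induction with
    | base => exact hsum n₀ le_rfl
    | succ n hn ih =>
      refine le_trans ?_ ih
      rw [Finset.prod_range_succ, Finset.prod_range_succ, mul_div_mul_comm]
      exact mul_le_of_le_one_right (hf0 n).le ((div_le_one (hg n)).2 (hn₀ n hn))

theorem base_div_blocks (n : ℕ) : base q n / blocks lo hi n =
    ∏ i ∈ Finset.range n, (q (i + 1) : ℝ) / choices lo hi i := by
  induction n with
  | zero => simp [base_zero, blocks]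
  | succ n ih => rw [Finset.prod_range_succ, ← ih, base_succ, blocks_succ]; push_cast; ring

theorem base_eq_prod (n : ℕ) : base q n = ∏ i ∈ Finset.range n, (q (i + 1) : ℝ) := by
  induction n with
  | zero => simp [base_zero]
  | succ n ih => rw [Finset.prod_range_succ, ← ih, base_succ]

/-- The right side involves only the first n terms of Q, and q (n+1) may be enormous compared with
their product. Hence two bounds: the logarithmic one makes the first n factors eventually at most
q^(ε/2) each, and the bound by the index handles the last factor, since n is at most logarithmic in
`base q n`. -/
theorem exists_base_div_blocks_le (hq : IsBasicSequence q) (hlim : InfiniteInLimit q)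
    (h1 : ∀ n, q (n + 1) ≤ (4 * Nat.log 2 (q (n + 1)) + 2) * choices lo hi n)
    (h2 : ∀ n, q (n + 1) ≤ (4 * n + 2) * choices lo hi n) {ε : ℝ} (hε : 0 < ε) :
    ∃ C > 0, ∀ n, base q (n + 1) / blocks lo hi (n + 1) ≤ C * base q n ^ ε := by
  have hM : ∀ n, (0 : ℝ) < choices lo hi n := fun n => by simp [choices]; positivity
  have hqpos : ∀ n, (0 : ℝ) < q (n + 1) := fun n => by
    have := hq (n + 1) (by omega); exact_mod_cast (by omega : 0 < q (n + 1))
  have hev : ∀ᶠ n in atTop, (q (n + 1) : ℝ) / choices lo hi n ≤ (q (n + 1) : ℝ) ^ (ε / 2) := by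
    have hlog : ∀ᶠ x : ℝ in atTop, 4 * (Real.log x / Real.log 2) + 2 ≤ x ^ (ε / 2) := by
      have h3 := (isLittleO_log_rpow_atTop (half_pos hε)).bound (c := Real.log 2 / 8)
        (by have := Real.log_pos one_lt_two; positivity)
      filter_upwards [h3, eventually_ge_atTop 1,
        (tendsto_rpow_atTop (half_pos hε)).eventually_ge_atTop 4] with x hx hx1 hx4
      rw [Real.norm_of_nonneg (Real.log_nonneg hx1),
        Real.norm_of_nonneg (Real.rpow_nonneg (by linarith) _)] at hx
      have hl := Real.log_pos one_lt_two
      have : Real.log x / Real.log 2 ≤ x ^ (ε / 2) / 8 := by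
        rw [div_le_iff₀ hl]; linarith
      linarith
    have ht : Tendsto (fun n => (q (n + 1) : ℝ)) atTop atTop :=
      tendsto_natCast_atTop_atTop.comp ((tendsto_add_atTop_iff_nat 1).2 hlim)
    filter_upwards [ht.eventually hlog] with n hn
    refine le_trans ?_ hn
    rw [div_le_iff₀ (hM n)]
    have h3 : (q (n + 1) : ℝ) ≤ (4 * Nat.log 2 (q (n + 1)) + 2) * choices lo hi n := by
      exact_mod_cast h1 n
    refine h3.trans ?_
    have h4 : (Nat.log 2 (q (n + 1)) : ℝ) ≤ Real.log (q (n + 1)) / Real.log 2 := by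
      have := Real.natLog_le_logb (q (n + 1)) 2
      simpa [Real.logb] using this
    have := hM n
    gcongr
  obtain ⟨C, hC, hCle⟩ := exists_prod_le_of_eventually_le
    (w := fun n => (q (n + 1) : ℝ) / choices lo hi n) (fun n => div_pos (hqpos n) (hM n))
    (fun n => Real.rpow_pos_of_pos (hqpos n) _) hev
  have hl := Real.log_pos one_lt_two
  refine ⟨C * (4 / (ε / 2 * Real.log 2) + 2), by positivity, fun n => ?_⟩
  have hB := base_pos hq n
  have hB1 : 1 ≤ base q n ^ (ε / 2) := Real.one_le_rpow (one_le_base hq n) (by positivity)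
  have hW : base q n / blocks lo hi n ≤ C * base q n ^ (ε / 2) := by
    rw [base_div_blocks, base_eq_prod, ← Real.finsetProd_rpow _ _ (fun i _ => (hqpos i).le)]
    exact hCle n
  have hw : (q (n + 1) : ℝ) / choices lo hi n ≤
      (4 / (ε / 2 * Real.log 2) + 2) * base q n ^ (ε / 2) := by
    have h3 : (q (n + 1) : ℝ) / choices lo hi n ≤ 4 * n + 2 := by
      rw [div_le_iff₀ (hM n)]; exact_mod_cast h2 n
    have h4 : n * Real.log 2 ≤ base q n ^ (ε / 2) / (ε / 2) := by
      rw [← Real.log_pow]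
      exact (Real.log_le_log (by positivity) (two_pow_le_base hq n)).trans
        (Real.log_le_rpow_div hB.le (by positivity))
    have h5 : (n : ℝ) ≤ 1 / (ε / 2 * Real.log 2) * base q n ^ (ε / 2) := by
      rw [← mul_le_mul_iff_left₀ hl]
      refine h4.trans (le_of_eq ?_)
      field_simp
    have h6 : 4 / (ε / 2 * Real.log 2) = 4 * (1 / (ε / 2 * Real.log 2)) := by ring
    rw [h6]
    linarith
  have hx : base q (n + 1) / blocks lo hi (n + 1) =
      base q n / blocks lo hi n * (q (n + 1) / choices lo hi n) := by
    rw [base_succ, blocks_succ]; push_cast; ring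
  have hWpos : 0 < base q n / blocks lo hi n :=
    div_pos hB (by exact_mod_cast blocks_pos lo hi n)
  rw [hx]
  calc _ ≤ C * base q n ^ (ε / 2) * ((4 / (ε / 2 * Real.log 2) + 2) * base q n ^ (ε / 2)) :=
        mul_le_mul hW hw (div_pos (hqpos n) (hM n)).le (by positivity)
    _ = C * (4 / (ε / 2 * Real.log 2) + 2) * (base q n ^ (ε / 2) * base q n ^ (ε / 2)) := by ring
    _ = _ := by rw [← Real.rpow_add hB]; simp

theorem dimH_le_one (s : Set ℝ) : dimH s ≤ 1 :=
  (dimH_mono (subset_univ s)).trans Real.dimH_univ.le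

theorem dimH_digitSet (hq : IsBasicSequence q) (hlim : InfiniteInLimit q)
    (hlo : ∀ n, lo n ≤ hi n) (hhi : ∀ n, hi n + 2 ≤ q (n + 1))
    (h1 : ∀ n, q (n + 1) ≤ (4 * Nat.log 2 (q (n + 1)) + 2) * choices lo hi n)
    (h2 : ∀ n, q (n + 1) ≤ (4 * n + 2) * choices lo hi n) :
    dimH (digitSet q (fun n => lo (n - 1)) (fun n => hi (n - 1))) = 1 := by
  refine le_antisymm (dimH_le_one _) (ENNReal.le_of_forall_nnreal_lt fun s hs => ?_)
  rcases eq_or_lt_of_le (zero_le (a := s)) with rfl | hs0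
  · simp
  have hs1 : s < 1 := by exact_mod_cast hs
  obtain ⟨C, hC, h⟩ := exists_base_div_blocks_le hq hlim h1 h2 (ε := 1 - s)
    (by have : (s : ℝ) < 1 := by exact_mod_cast hs1
        linarith)
  exact le_dimH_digitSet hq hlo hhi hs0 hs1 hC h

end Dimension

end CantorSeries

namespace CantorSeries

/-! ### Eventually increasing polynomials -/

/-- A strictly increasing integer sequence gains at least 1 at each step, so p(n) is at least n
minus a constant. This justifies searching for arguments only up to twice the value. -/
theorem EventuallyIncreasing.exists_le {p : ℤ[X]} (hp : EventuallyIncreasing p) :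
    ∃ N : ℕ, StrictMonoOn (fun n : ℕ => p.eval (n : ℤ)) (Ici N) ∧
      ∀ n ≥ N, 0 ≤ p.eval (n : ℤ) ∧ (n : ℤ) ≤ 2 * p.eval (n : ℤ) := by
  obtain ⟨N, hN⟩ := hp
  have h1 : ∀ k : ℕ, p.eval (N : ℤ) + k ≤ p.eval ((N + k : ℕ) : ℤ) := by
    intro k
    induction k with
    | zero => simp
    | succ k ih =>
      have : p.eval ((N + k : ℕ) : ℤ) < p.eval ((N + (k + 1) : ℕ) : ℤ) :=
        hN (by simp) (by simp) (by omega)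
      push_cast at *
      omega
  set c := (p.eval (N : ℤ)).natAbs with hc
  refine ⟨2 * N + 2 * c, hN.mono fun n hn => by simp at hn ⊢; omega, fun n hn => ?_⟩
  obtain ⟨k, rfl⟩ : ∃ k, n = N + k := ⟨n - N, by omega⟩
  have := h1 k
  push_cast at *
  omega

namespace Oracle

variable {o : Oracle} {p : ℕ → ℤ[X]}

/-- The oracle computes the values of the polynomials `p i`. -/
def Represents (o : Oracle) (p : ℕ → ℤ[X]) : Prop :=
  ∀ i n, (o.pos (i, n) : ℤ) = (p i).eval (n : ℤ) + o.neg (i, n)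

theorem Represents.takes_iff (h : o.Represents p) {i n v : ℕ} :
    o.Takes i n v ↔ (p i).eval (n : ℤ) = v := by
  have := h i n
  unfold Takes
  omega

theorem Represents.hits_iff (h : o.Represents p) {i v : ℕ} :
    o.Hits i v ↔ ∃ n < 2 * v + 1, (p i).eval (n : ℤ) = v := by
  simp only [Hits, ExistsLt, h.takes_iff]

theorem Represents.hits_iff_mem_values (h : o.Represents p) {i : ℕ}
    (hp : EventuallyIncreasing (p i)) :
    ∃ c : ℕ, ∀ v ≥ c, o.Hits i v ↔ (v : ℤ) ∈ values (p i) := by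
  obtain ⟨N, -, hN⟩ := hp.exists_le
  refine ⟨N, fun v hv => ?_⟩
  rw [h.hits_iff]
  constructor
  · rintro ⟨n, -, hn⟩; exact ⟨n, hn⟩
  · rintro ⟨n, hn⟩
    refine ⟨n, ?_, hn⟩
    rcases le_total N n with h1 | h1
    · have := (hN n h1).2
      simp only at hn
      omega
    · omega

/-! ### Counting -/

theorem cnt_eq (o : Oracle) (i v : ℕ) : o.cnt i v = {w | w ≤ v ∧ o.Hits i w}.ncard := by
  classical
  rw [cnt, Finset.sum_boole, Nat.cast_id, ← Set.ncard_coe_finset]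
  congr 1; ext w; simp

theorem cnt₂_eq (o : Oracle) (i j v : ℕ) :
    o.cnt₂ i j v = {w | w ≤ v ∧ o.Hits i w ∧ o.Hits j w}.ncard := by
  classical
  rw [cnt₂, Finset.sum_boole, Nat.cast_id, ← Set.ncard_coe_finset]
  congr 1; ext w; simp

theorem finite_le_and (v : ℕ) (P : ℕ → Prop) : {w | w ≤ v ∧ P w}.Finite :=
  (finite_Iic v).subset fun _ hw => hw.1

theorem cnt_mono (o : Oracle) (i : ℕ) : Monotone (o.cnt i) := fun v w hvw => by
  rw [cnt_eq, cnt_eq]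
  exact ncard_le_ncard (fun x hx => ⟨hx.1.trans hvw, hx.2⟩) (finite_le_and _ _)

theorem cnt₂_comm (o : Oracle) (i j v : ℕ) : o.cnt₂ i j v = o.cnt₂ j i v := by
  rw [cnt₂_eq, cnt₂_eq]
  congr 1; ext w; simp only [mem_ofPred_eq]; tauto

theorem Represents.tendsto_cnt (h : o.Represents p) {i : ℕ} (hp : EventuallyIncreasing (p i)) :
    Tendsto (o.cnt i) atTop atTop := by
  obtain ⟨N, hmono, hN⟩ := hp.exists_le
  refine tendsto_atTop_atTop_of_monotone (o.cnt_mono i) fun K => ?_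
  refine ⟨((p i).eval ((N + K : ℕ) : ℤ)).toNat, ?_⟩
  rw [cnt_eq]
  have hsub : (fun k : ℕ => ((p i).eval ((N + k : ℕ) : ℤ)).toNat) '' (Finset.range K : Set ℕ) ⊆
      {w | w ≤ ((p i).eval ((N + K : ℕ) : ℤ)).toNat ∧ o.Hits i w} := by
    rintro _ ⟨k, hk, rfl⟩
    simp only [Finset.coe_range, mem_Iio] at hk
    have h1 : (p i).eval ((N + k : ℕ) : ℤ) < (p i).eval ((N + K : ℕ) : ℤ) :=
      hmono (by simp) (by simp) (by omega)
    have h2 := hN (N + k) (by omega)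
    dsimp only
    refine ⟨by omega, h.hits_iff.2 ⟨N + k, ?_, ?_⟩⟩ <;> omega
  refine le_trans ?_ (ncard_le_ncard hsub (finite_le_and _ _))
  rw [InjOn.ncard_image, ncard_coe_finset, Finset.card_range]
  intro k hk l hl hkl
  have h1 := hN (N + k) (by omega)
  have h2 := hN (N + l) (by omega)
  have h3 : (p i).eval ((N + k : ℕ) : ℤ) = (p i).eval ((N + l : ℕ) : ℤ) := by
    simp only at hkl; omega
  have := hmono.injOn (by simp : N + k ∈ Ici N) (by simp : N + l ∈ Ici N) h3
  omega

theorem overlap_le_one (p q : ℤ[X]) (s n : ℕ) : overlap p q s n ≤ 1 := by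
  refine div_le_one_of_le₀ ?_ (by positivity)
  have h : values p ∩ values q ∩ Icc (s : ℤ) n ⊆ values q ∩ Icc (s : ℤ) n :=
    fun x hx => ⟨hx.1.2, hx.2⟩
  exact_mod_cast ncard_le_ncard h ((finite_Icc (s : ℤ) n).subset inter_subset_right)

theorem eventually_overlap_lt {p q : ℤ[X]} (h : ¬ Lesssim q p) (s : ℕ) {ε : ℝ} (hε : 0 < ε) :
    ∀ᶠ n in atTop, overlap p q s n < ε := by
  have h1 : limsup (fun n => overlap p q s n) atTop ≤ 0 := by
    by_contra hcon
    exact h ⟨s, not_le.1 hcon⟩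
  refine eventually_lt_of_limsup_lt (h1.trans_lt hε) ?_
  exact isBoundedUnder_of ⟨1, fun n => overlap_le_one p q s n⟩

theorem ncard_values_inter (A : Set ℤ) (s v : ℕ) :
    (A ∩ Icc (s : ℤ) v).ncard = {w : ℕ | w ≤ v ∧ s ≤ w ∧ (w : ℤ) ∈ A}.ncard := by
  rw [← ncard_image_of_injective (f := fun w : ℕ => (w : ℤ)) _ Nat.cast_injective]
  congr 1
  ext z
  constructor
  · rintro ⟨hz, h1, h2⟩
    exact ⟨z.toNat, ⟨by omega, by omega, by rwa [Int.toNat_of_nonneg (by omega)]⟩,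
      Int.toNat_of_nonneg (by omega)⟩
  · rintro ⟨w, ⟨h1, h2, h3⟩, rfl⟩
    exact ⟨h3, by simpa using h2, by simpa using h1⟩

/-- Below s the bounded search `Hits` and membership in `values` may disagree. These at most s
values are absorbed because `cnt` tends to infinity. -/
theorem Represents.cnt₂_le (h : o.Represents p) {i j : ℕ} (hi : EventuallyIncreasing (p i))
    (hj : EventuallyIncreasing (p j)) (hij : ¬ Lesssim (p i) (p j)) {ε : ℝ} (hε : 0 < ε) :
    ∀ᶠ v in atTop, (o.cnt₂ i j v : ℝ) ≤ ε * o.cnt i v := by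
  obtain ⟨ci, hci⟩ := h.hits_iff_mem_values hi
  obtain ⟨cj, hcj⟩ := h.hits_iff_mem_values hj
  set s := max ci cj with hs
  have hcnt : ∀ᶠ v in atTop, (s : ℝ) * 2 / ε ≤ o.cnt i v :=
    (tendsto_natCast_atTop_atTop.comp (h.tendsto_cnt hi)).eventually_ge_atTop _
  filter_upwards [eventually_overlap_lt hij s (half_pos hε), hcnt] with v hv hv2
  rw [overlap, ncard_values_inter, ncard_values_inter] at hv
  set a : ℕ := {w : ℕ | w ≤ v ∧ s ≤ w ∧ (w : ℤ) ∈ values (p j) ∩ values (p i)}.ncard with ha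
  set b : ℕ := {w : ℕ | w ≤ v ∧ s ≤ w ∧ (w : ℤ) ∈ values (p i)}.ncard with hb
  have hba : a ≤ b := ncard_le_ncard (fun w hw => ⟨hw.1, hw.2.1, hw.2.2.2⟩) (finite_le_and _ _)
  have hab : (a : ℝ) ≤ ε / 2 * b := by
    rcases Nat.eq_zero_or_pos b with h0 | h0
    · have : a = 0 := by omega
      simp [this, h0]
    · rw [div_lt_iff₀ (by exact_mod_cast h0)] at hv
      exact hv.le
  have h1 : o.cnt₂ i j v ≤ s + a := by
    rw [cnt₂_eq]
    refine le_trans (ncard_le_ncard (t := (Finset.range s : Set ℕ) ∪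
      {w : ℕ | w ≤ v ∧ s ≤ w ∧ (w : ℤ) ∈ values (p j) ∩ values (p i)}) ?_ ?_) ?_
    · rintro w ⟨hw, hwi, hwj⟩
      rcases lt_or_ge w s with hws | hws
      · left; simpa using hws
      · right
        exact ⟨hw, hws, (hcj w (by omega)).1 hwj, (hci w (by omega)).1 hwi⟩
    · exact (Finset.finite_toSet _).union (finite_le_and _ _)
    · refine (ncard_union_le _ _).trans ?_
      rw [ncard_coe_finset, Finset.card_range]
  have h2 : b ≤ o.cnt i v := by
    rw [cnt_eq]
    exact ncard_le_ncard (fun w hw => ⟨hw.1, (hci w (by have := hw.2.1; omega)).2 hw.2.2⟩)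
      (finite_le_and _ _)
  rw [div_le_iff₀ hε] at hv2
  have h1' : (o.cnt₂ i j v : ℝ) ≤ s + a := by exact_mod_cast h1
  have h2' : (b : ℝ) ≤ o.cnt i v := by exact_mod_cast h2
  nlinarith

/-! ### Ownership -/

/-- `v` is a value of polynomial `i` that is lost to polynomial `j`. -/
def LostTo (o : Oracle) (i j v : ℕ) : Prop := o.Hits i v ∧ o.Hits j v ∧ ¬ o.Beats i j v

/-- The inequality is assumed only where a loss occurs. It is applied at the last loss w up to v:
all losses so far are common values up to w, and `cnt i` is monotone. -/
theorem ncard_lostTo_le {i j w₀ : ℕ} {ε : ℝ} (hε : 0 ≤ ε)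
    (h : ∀ w ≥ w₀, o.LostTo i j w → (o.cnt₂ i j w : ℝ) ≤ ε * o.cnt i w) (v : ℕ) :
    ({w | w ≤ v ∧ o.LostTo i j w}.ncard : ℝ) ≤ w₀ + ε * o.cnt i v := by
  rcases ({w | w ≤ v ∧ o.LostTo i j w ∧ w₀ ≤ w}).eq_empty_or_nonempty with he | hne
  · have : {w | w ≤ v ∧ o.LostTo i j w}.ncard ≤ w₀ := by
      refine (ncard_le_ncard (t := (Finset.range w₀ : Set ℕ)) ?_ (Finset.finite_toSet _)).trans ?_
      · rintro w ⟨hw1, hw2⟩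
        by_contra hcon
        have : w ∈ {w | w ≤ v ∧ o.LostTo i j w ∧ w₀ ≤ w} :=
          ⟨hw1, hw2, by simpa using hcon⟩
        rw [he] at this
        exact this
      · rw [ncard_coe_finset, Finset.card_range]
    have h1 : ({w | w ≤ v ∧ o.LostTo i j w}.ncard : ℝ) ≤ w₀ := by exact_mod_cast this
    have : 0 ≤ ε * o.cnt i v := by positivity
    linarith
  · obtain ⟨w, hw, hmax⟩ := (finite_le_and v _).exists_maximalFor id _ hne
    have h1 : {w | w ≤ v ∧ o.LostTo i j w}.ncard ≤ o.cnt₂ i j w := by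
      rw [cnt₂_eq]
      refine ncard_le_ncard ?_ (finite_le_and _ _)
      rintro x ⟨hx1, hx2⟩
      refine ⟨?_, hx2.1, hx2.2.1⟩
      rcases le_total x w with h3 | h3
      · exact h3
      · exact hmax (j := x) ⟨hx1, hx2, hw.2.2.trans h3⟩ h3
    have h2 := h w hw.2.2 hw.2.1
    have h3 : (o.cnt i w : ℝ) ≤ o.cnt i v := by exact_mod_cast o.cnt_mono i hw.1
    have h4 : ({w | w ≤ v ∧ o.LostTo i j w}.ncard : ℝ) ≤ o.cnt₂ i j w := by exact_mod_cast h1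
    have h5 : ε * o.cnt i w ≤ ε * o.cnt i v := by gcongr
    have : (0 : ℝ) ≤ w₀ := by positivity
    linarith

theorem LostTo.overtakes {i j w : ℕ} (hij : i < j) (h : o.LostTo i j w) : o.Overtakes i j w := by
  by_contra hcon
  exact h.2.2 (.inl ⟨hij, hcon⟩)

theorem LostTo.not_overtakes {i j w : ℕ} (hij : j < i) (h : o.LostTo i j w) :
    ¬ o.Overtakes j i w := fun hcon => h.2.2 (.inr ⟨hij, hcon⟩)

/-- If the common values are negligible only among those of j, then a late loss of i to j still
forces cnt j ≤ cnt i. For i < j this is part of overtaking; for j < i it is the only way in which i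
can fail to overtake j, the condition on common values being met eventually. -/
theorem eventually_cnt₂_le_of_lostTo {i j : ℕ} (hij : j ≠ i)
    (h : (∀ ε > 0, ∀ᶠ v in atTop, (o.cnt₂ i j v : ℝ) ≤ ε * o.cnt i v) ∨
      ∀ ε > 0, ∀ᶠ v in atTop, (o.cnt₂ i j v : ℝ) ≤ ε * o.cnt j v) {ε : ℝ} (hε : 0 < ε) :
    ∀ᶠ w in atTop, o.LostTo i j w → (o.cnt₂ i j w : ℝ) ≤ ε * o.cnt i w := by
  rcases h with h | h
  · filter_upwards [h ε hε] with w hw _ using hw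
  · filter_upwards [h ε hε, h (1 / 2 ^ i) (by positivity)] with w hw hw2 hlost
    have key : o.cnt j w ≤ o.cnt i w := by
      rcases lt_or_gt_of_ne hij with hlt | hlt
      · have h1 := hlost.not_overtakes hlt
        by_contra hcon
        refine h1 ⟨not_le.1 hcon, ?_⟩
        rw [cnt₂_comm]
        rw [div_mul_eq_mul_div, one_mul, le_div_iff₀ (by positivity), mul_comm] at hw2
        exact_mod_cast hw2
      · exact (hlost.overtakes hlt).1.le
    refine hw.trans ?_
    have : (o.cnt j w : ℝ) ≤ o.cnt i w := by exact_mod_cast key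
    gcongr

/-- Losses to the finitely many rivals j ≤ K are each negligible. A rival j > K is later than i, so
it wins only by overtaking, which limits its total gain to 2^(-j) of the values of i at every time;
these gains are summed as a geometric series. -/
theorem ncard_lost_le {i : ℕ} (hcnt : Tendsto (o.cnt i) atTop atTop)
    (h : ∀ j ≠ i, (∀ v, ¬ o.LostTo i j v) ∨
      (∀ ε > 0, ∀ᶠ v in atTop, (o.cnt₂ i j v : ℝ) ≤ ε * o.cnt i v) ∨
      ∀ ε > 0, ∀ᶠ v in atTop, (o.cnt₂ i j v : ℝ) ≤ ε * o.cnt j v) {ε : ℝ} (hε : 0 < ε) :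
    ∀ᶠ v in atTop, ({w | w ≤ v ∧ o.Hits i w ∧ ¬ o.Owns i w}.ncard : ℝ) ≤ ε * o.cnt i v := by
  obtain ⟨J, hJ⟩ : ∃ J : ℕ, (2 : ℝ)⁻¹ ^ J ≤ ε / 4 := by
    obtain ⟨J, hJ⟩ := exists_pow_lt_of_lt_one (by positivity : 0 < ε / 4)
      (by norm_num : (2 : ℝ)⁻¹ < 1)
    exact ⟨J, hJ.le⟩
  set K := max J i with hK
  have hKJ : (2 : ℝ)⁻¹ ^ K ≤ ε / 4 :=
    (pow_le_pow_of_le_one (by norm_num) (by norm_num) (le_max_left _ _)).trans hJ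
  set δ := ε / (4 * (K + 1)) with hδ
  have hδ0 : 0 < δ := by positivity
  have hev : ∀ j, ∃ w₀ : ℕ, j ≠ i → ∀ w ≥ w₀, o.LostTo i j w →
      (o.cnt₂ i j w : ℝ) ≤ δ * o.cnt i w := by
    intro j
    by_cases hj : j = i
    · exact ⟨0, fun h => absurd hj h⟩
    · rcases h j hj with h1 | h1
      · exact ⟨0, fun _ w _ hw => absurd hw (h1 w)⟩
      · obtain ⟨w₀, hw₀⟩ := eventually_atTop.1 (eventually_cnt₂_le_of_lostTo hj h1 hδ0)
        exact ⟨w₀, fun _ => hw₀⟩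
  choose w₀ hw₀ using hev
  set S := ∑ j ∈ Finset.range (K + 1), w₀ j with hS
  have hlarge : ∀ᶠ v in atTop, (S : ℝ) * 4 / ε ≤ o.cnt i v :=
    (tendsto_natCast_atTop_atTop.comp hcnt).eventually_ge_atTop _
  filter_upwards [hlarge] with v hv
  rw [div_le_iff₀ hε] at hv
  have hsub : {w | w ≤ v ∧ o.Hits i w ∧ ¬ o.Owns i w} ⊆
      ⋃ j ∈ (Finset.range (K + 1 + v)).filter (· ≠ i), {w | w ≤ v ∧ o.LostTo i j w} := by
    rintro w ⟨hw, hhit, hown⟩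
    have : ∃ j < w + 1, j ≠ i ∧ o.Hits j w ∧ ¬ o.Beats i j w := by
      by_contra hcon
      push Not at hcon
      refine hown ⟨hhit, fun j hj => ?_⟩
      have := hcon j hj
      tauto
    obtain ⟨j, hj, hji, hjh, hb⟩ := this
    simp only [mem_iUnion, Finset.mem_filter, Finset.mem_range]
    exact ⟨j, ⟨by omega, hji⟩, hw, hhit, hjh, hb⟩
  have h1 : ({w | w ≤ v ∧ o.Hits i w ∧ ¬ o.Owns i w}.ncard : ℝ) ≤
      ∑ j ∈ (Finset.range (K + 1 + v)).filter (· ≠ i),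
        ({w | w ≤ v ∧ o.LostTo i j w}.ncard : ℝ) := by
    have hfin : (⋃ j ∈ (Finset.range (K + 1 + v)).filter (· ≠ i),
        {w | w ≤ v ∧ o.LostTo i j w}).Finite :=
      (finite_Iic v).subset (by simp only [iUnion_subset_iff]; exact fun _ _ _ hw => hw.1)
    exact_mod_cast (ncard_le_ncard hsub hfin).trans (Finset.set_ncard_biUnion_le _ _)
  have h2 : ∑ j ∈ (Finset.range (K + 1 + v)).filter (· ≠ i),
        ({w | w ≤ v ∧ o.LostTo i j w}.ncard : ℝ) ≤
      ∑ j ∈ Finset.range (K + 1 + v),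
        (if j < K + 1 then (w₀ j + δ * o.cnt i v : ℝ) else 2⁻¹ ^ j * o.cnt i v) := by
    rw [Finset.sum_filter]
    refine Finset.sum_le_sum fun j _ => ?_
    split_ifs with hji hjK hjK
    · exact ncard_lostTo_le hδ0.le (hw₀ j hji) v
    -- No threshold is needed here: overtaking contains the inequality for all w, so the estimate is
    -- uniform over infinitely many rivals.
    · have := ncard_lostTo_le (o := o) (i := i) (j := j) (w₀ := 0) (ε := 2⁻¹ ^ j) (by positivity)
        (fun w _ hw => by
          have := (hw.overtakes (by omega)).2
          rw [inv_pow, ← div_eq_inv_mul, le_div_iff₀ (by positivity), mul_comm]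
          exact_mod_cast this) v
      simpa using this
    · positivity
    · positivity
  have h3 : ∑ j ∈ Finset.range (K + 1 + v),
        (if j < K + 1 then (w₀ j + δ * o.cnt i v : ℝ) else 2⁻¹ ^ j * o.cnt i v) ≤
      S + (K + 1) * (δ * o.cnt i v) + ε / 4 * 2 * o.cnt i v := by
    rw [Finset.sum_range_add]
    have e1 : ∑ j ∈ Finset.range (K + 1),
        (if j < K + 1 then (w₀ j + δ * o.cnt i v : ℝ) else 2⁻¹ ^ j * o.cnt i v) =
        S + (K + 1) * (δ * o.cnt i v) := by
      rw [Finset.sum_congr rfl (g := fun j => (w₀ j + δ * o.cnt i v : ℝ))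
        (fun j hj => if_pos (by simpa using hj)), Finset.sum_add_distrib, hS]
      simp
    have e2 : ∑ j ∈ Finset.range v,
        (if K + 1 + j < K + 1 then (w₀ (K + 1 + j) + δ * o.cnt i v : ℝ)
          else 2⁻¹ ^ (K + 1 + j) * o.cnt i v) ≤ ε / 4 * 2 * o.cnt i v := by
      rw [Finset.sum_congr rfl (g := fun j => 2⁻¹ ^ (K + 1) * o.cnt i v * (2⁻¹ : ℝ) ^ j)
        (fun j _ => by rw [if_neg (by omega), pow_add]; ring), ← Finset.mul_sum]
      have hgeo : ∑ j ∈ Finset.range v, (2⁻¹ : ℝ) ^ j ≤ 2 := by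
        have := (summable_geometric_of_lt_one (r := (2 : ℝ)⁻¹) (by norm_num)
          (by norm_num)).sum_le_tsum (Finset.range v) (fun _ _ => by positivity)
        rw [tsum_geometric_of_lt_one (by norm_num) (by norm_num)] at this
        norm_num at this ⊢
        linarith
      have hK1 : (2 : ℝ)⁻¹ ^ (K + 1) ≤ ε / 4 :=
        (pow_le_pow_of_le_one (by norm_num) (by norm_num) (Nat.le_succ _)).trans hKJ
      have hc : (0 : ℝ) ≤ o.cnt i v := by positivity
      calc 2⁻¹ ^ (K + 1) * (o.cnt i v : ℝ) * ∑ j ∈ Finset.range v, (2⁻¹ : ℝ) ^ j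
          ≤ ε / 4 * o.cnt i v * 2 := by gcongr
        _ = _ := by ring
    rw [e1]
    linarith
  have h4 : (K + 1 : ℝ) * (δ * o.cnt i v) = ε / 4 * o.cnt i v := by
    rw [hδ]; field_simp
  linarith

/-- A repetition of polynomial i at a later index has the same counts and never overtakes, as this
requires strictly fewer values. Hence the first index of each polynomial is the one considered. -/
theorem Represents.ncard_lost_le (h : o.Represents p) (hp : ∀ i, EventuallyIncreasing (p i))
    (hsparse : ∀ i j, p i ≠ p j → ¬ Lesssim (p i) (p j) ∨ ¬ Lesssim (p j) (p i)) {i : ℕ}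
    (hi : ∀ j < i, p j ≠ p i) {ε : ℝ} (hε : 0 < ε) :
    ∀ᶠ v in atTop, ({w | w ≤ v ∧ o.Hits i w ∧ ¬ o.Owns i w}.ncard : ℝ) ≤ ε * o.cnt i v := by
  refine Oracle.ncard_lost_le (h.tendsto_cnt (hp i)) (fun j hj => ?_) hε
  by_cases hpij : p j = p i
  · left
    intro v hv
    have hij : i < j := by
      rcases lt_or_gt_of_ne hj with h1 | h1
      · exact absurd hpij (hi j h1)
      · exact h1
    have h1 := (hv.overtakes hij).1
    have h2 : o.cnt j v = o.cnt i v := by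
      rw [cnt_eq, cnt_eq]
      simp only [h.hits_iff, hpij]
    omega
  · right
    rcases hsparse i j (Ne.symm hpij) with h1 | h1
    · left
      exact fun ε hε => h.cnt₂_le (hp i) (hp j) h1 hε
    · right
      intro ε hε
      filter_upwards [h.cnt₂_le (hp j) (hp i) h1 hε] with v hv
      rwa [cnt₂_comm]

/-- `Beats` is asymmetric, so two different indices up to v cannot both own v. -/
theorem owner_eq {i v : ℕ} (hi : i ≤ v) (hown : o.Owns i v) : o.owner v = i := by
  have h1 : v < o.owner v ∨ o.Owns (o.owner v) v := 
    least_spec (p := fun i => v < i ∨ o.Owns i v) ⟨i, .inr hown⟩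
  have h2 : o.owner v ≤ i := least_le (p := fun i => v < i ∨ o.Owns i v) (.inr hown)
  have h3 : o.Owns (o.owner v) v := h1.resolve_left (by omega)
  by_contra hne
  have h4 := hown.2 (o.owner v) (by omega)
  have h5 := h3.2 i (by omega)
  rcases h4 with h4 | h4 | h4
  · exact hne h4
  · exact h4 h3.1
  rcases h5 with h5 | h5 | h5
  · exact hne h5.symm
  · exact h5 hown.1
  rcases h4 with ⟨h4, h6⟩ | ⟨h4, h6⟩ <;> rcases h5 with ⟨h5, h7⟩ | ⟨h5, h7⟩
  · omega
  · exact h6 h7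
  · exact h7 h6
  · omega

/-- Apart from a set of arguments of density zero, the values of polynomial `i` are owned by
`i`. -/
theorem Represents.exists_exceptional (h : o.Represents p) (hp : ∀ i, EventuallyIncreasing (p i))
    (hsparse : ∀ i j, p i ≠ p j → ¬ Lesssim (p i) (p j) ∨ ¬ Lesssim (p j) (p i)) {i : ℕ}
    (hi : ∀ j < i, p j ≠ p i) :
    ∃ Z : Set ℕ, (∀ ε > 0, ∀ᶠ X in atTop, ({n | n < X ∧ n ∈ Z}.ncard : ℝ) ≤ ε * X) ∧
      ∀ n ∉ Z, ∃ v : ℕ, (p i).eval (n : ℤ) = v ∧ n ≤ 2 * v ∧ o.owner v = i ∧ i ≤ v ∧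
        o.time i v = n := by
  obtain ⟨N, hmono, hN⟩ := (hp i).exists_le
  -- beyond `N'` values determine their arguments
  obtain ⟨N', hN'⟩ : ∃ N' ≥ N + 2 * i, ∀ n ≥ N', ∀ k : ℕ,
      (p i).eval (k : ℤ) = (p i).eval (n : ℤ) → k = n := by
    obtain ⟨b, hb⟩ : ∃ b : ℕ, ∀ k < N, (p i).eval (k : ℤ) < b := by
      refine ⟨∑ k ∈ Finset.range N, ((p i).eval (k : ℤ)).natAbs + 1, fun k hk => ?_⟩
      have := Finset.single_le_sum (f := fun k : ℕ => ((p i).eval (k : ℤ)).natAbs)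
        (fun _ _ => Nat.zero_le _) (Finset.mem_range.2 hk)
      omega
    refine ⟨N + 2 * i + 2 * b, by omega, fun n hn k hk => ?_⟩
    rcases lt_or_ge k N with hkN | hkN
    · have := hb k hkN
      have := hN n (by omega)
      omega
    · exact hmono.injOn (mem_Ici.2 hkN) (by simp; omega) hk
  obtain ⟨hNN', hinj⟩ := hN'
  set u : ℕ → ℕ := fun n => ((p i).eval (n : ℤ)).toNat with hu
  have hu' : ∀ n ≥ N', (p i).eval (n : ℤ) = u n := fun n hn => by
    have := (hN n (by omega)).1; simp only [hu]; omega
  refine ⟨{n | n < N' ∨ ¬ o.Owns i (u n)}, fun ε hε => ?_, fun n hn => ?_⟩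
  · have hlost := h.ncard_lost_le hp hsparse hi (by positivity : 0 < ε / 4)
    have htend : Tendsto u atTop atTop := by
      refine tendsto_atTop.2 fun b => ?_
      filter_upwards [eventually_ge_atTop (N' + 2 * b)] with n hn
      have := hN n (by omega)
      have := hu' n (by omega)
      omega
    filter_upwards [htend.eventually hlost, eventually_ge_atTop N', eventually_ge_atTop 1,
      tendsto_natCast_atTop_atTop.eventually_ge_atTop ((N' : ℝ) * 2 / ε)] with X hX hXN hX1 hX2
    rw [div_le_iff₀ hε] at hX2
    -- Every value up to u X is taken at an argument up to X. This turns density among values into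
    -- density among arguments.
    have hcnt : o.cnt i (u X) ≤ X + 1 := by
      rw [cnt_eq]
      refine (ncard_le_ncard (t := u '' (Finset.range (X + 1) : Set ℕ)) ?_
        ((Finset.finite_toSet _).image _)).trans ((ncard_image_le (Finset.finite_toSet _)).trans ?_)
      · rintro w ⟨hw, hhit⟩
        obtain ⟨n, -, hn⟩ := h.hits_iff.1 hhit
        refine ⟨n, ?_, by simp [hu, hn]⟩
        simp only [Finset.coe_range, mem_Iio]
        by_contra hcon
        have h1 : (p i).eval (X : ℤ) < (p i).eval (n : ℤ) :=
          hmono (by simp; omega) (by simp; omega) (by omega)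
        rw [hn, hu' X hXN] at h1
        omega
      · rw [ncard_coe_finset, Finset.card_range]
    have hle : {n | n < X ∧ (n < N' ∨ ¬ o.Owns i (u n))}.ncard ≤
        N' + {w | w ≤ u X ∧ o.Hits i w ∧ ¬ o.Owns i w}.ncard := by
      have hsub : {n | n < X ∧ (n < N' ∨ ¬ o.Owns i (u n))} ⊆
          (Finset.range N' : Set ℕ) ∪ {n | n < X ∧ N' ≤ n ∧ ¬ o.Owns i (u n)} := by
        rintro n ⟨h1, h2⟩
        rcases lt_or_ge n N' with h3 | h3
        · left; simpa using h3
        · right; exact ⟨h1, h3, h2.resolve_left (by omega)⟩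
      have hfin : {n | n < X ∧ N' ≤ n ∧ ¬ o.Owns i (u n)}.Finite :=
        (finite_Iio X).subset fun _ hn => hn.1
      refine (ncard_le_ncard hsub ((Finset.finite_toSet _).union hfin)).trans
        ((ncard_union_le _ _).trans ?_)
      rw [ncard_coe_finset, Finset.card_range]
      refine Nat.add_le_add_left (ncard_le_ncard_of_injOn u ?_ ?_ (finite_le_and _ _)) _
      · rintro n ⟨h1, h2, h3⟩
        have h4 : (p i).eval (n : ℤ) < (p i).eval (X : ℤ) :=
          hmono (by simp; omega) (by simp; omega) (by omega)
        have h5 := hu' n h2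
        have h6 := hu' X hXN
        have h7 := (hN n (by omega)).2
        exact ⟨by omega, h.hits_iff.2 ⟨n, by omega, h5⟩, h3⟩
      · rintro n ⟨-, h2, -⟩ k ⟨-, h3, -⟩ hnk
        exact hinj k h3 n (by rw [hu' n h2, hu' k h3, hnk])
    have h1 : ({n | n < X ∧ (n < N' ∨ ¬ o.Owns i (u n))}.ncard : ℝ) ≤
        N' + ({w | w ≤ u X ∧ o.Hits i w ∧ ¬ o.Owns i w}.ncard : ℝ) := by exact_mod_cast hle
    have h2 : (o.cnt i (u X) : ℝ) ≤ X + 1 := by exact_mod_cast hcnt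
    have h3 : (1 : ℝ) ≤ X := by exact_mod_cast hX1
    refine h1.trans ?_
    have h4 : ε / 4 * o.cnt i (u X) ≤ ε / 4 * (2 * X) := by gcongr; linarith
    linarith
  · simp only [mem_ofPred_eq, not_or, not_lt, not_not] at hn
    have h1 := hu' n hn.1
    have h2 := hN n (by omega)
    have h3 : i ≤ u n := by omega
    refine ⟨u n, h1, by omega, owner_eq h3 hn.2, h3, ?_⟩
    have h4 : 2 * u n < o.time i (u n) ∨ o.Takes i (o.time i (u n)) (u n) :=
      least_spec (p := fun k => 2 * u n < k ∨ o.Takes i k (u n)) ⟨n, .inr (h.takes_iff.2 h1)⟩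
    have h5 : o.time i (u n) ≤ n :=
      least_le (p := fun k => 2 * u n < k ∨ o.Takes i k (u n)) (.inr (h.takes_iff.2 h1))
    have h6 := h.takes_iff.1 (h4.resolve_left (by omega))
    exact hinj n hn.1 _ (by rw [h6, h1])

end Oracle

end CantorSeries

namespace CantorSeries

/-! ### Existence of patterns -/

theorem sum_range_mul_eq {β : Type*} [AddCommMonoid β] (f : ℕ → β) (a b : ℕ) :
    ∑ n ∈ Finset.range (a * b), f n =
      ∑ j ∈ Finset.range b, ∑ i ∈ Finset.range a, f (a * j + i) := by
  induction b with
  | zero => simp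
  | succ b ih => rw [Nat.mul_succ, Finset.sum_range_add, ih, Finset.sum_range_succ]

theorem sum_range_mul_ite_mod {m d r : ℕ} (hr : r < m) (f : ℕ → ℝ) :
    ∑ n ∈ Finset.range (m * d), (if n % m = r then f n else 0) =
      ∑ i ∈ Finset.range d, f (m * i + r) := by
  rw [sum_range_mul_eq]
  refine Finset.sum_congr rfl fun i _ => ?_
  rw [Finset.sum_eq_single_of_mem r (by simpa using hr)]
  · simp [Nat.mod_eq_of_lt hr]
  · intro t ht htr
    rw [Finset.mem_range] at ht
    simp [Nat.mod_eq_of_lt ht, htr]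

theorem le_card_levels {L : ℕ} (hL : 0 < L) {y : ℝ} (hy : y ≤ 1) :
    L * y - 1 ≤ ∑ l ∈ Finset.range L, if ((l : ℝ) + 1 / 2) / L < y then (1 : ℝ) else 0 := by
  have hL' : (0 : ℝ) < L := by exact_mod_cast hL
  rcases lt_or_ge y 0 with h0 | h0
  · have : 0 ≤ ∑ l ∈ Finset.range L, if ((l : ℝ) + 1 / 2) / L < y then (1 : ℝ) else 0 :=
      Finset.sum_nonneg fun _ _ => by positivity
    nlinarith
  have hle : ⌊L * y⌋₊ ≤ L := by
    rw [← Nat.cast_le (α := ℝ)]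
    exact (Nat.floor_le (by positivity)).trans (by nlinarith)
  have h1 : ∑ l ∈ Finset.range ⌊L * y⌋₊, (1 : ℝ) ≤
      ∑ l ∈ Finset.range L, if ((l : ℝ) + 1 / 2) / L < y then (1 : ℝ) else 0 := by
    rw [Finset.sum_congr rfl (g := fun l : ℕ => if ((l : ℝ) + 1 / 2) / L < y then (1 : ℝ) else 0)]
    · exact Finset.sum_le_sum_of_subset_of_nonneg (by simpa using hle)
        fun _ _ _ => by positivity
    · intro l hl
      rw [Finset.mem_range] at hl
      rw [if_pos]
      rw [div_lt_iff₀ hL', mul_comm]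
      have h2 : (l : ℝ) + 1 ≤ ⌊L * y⌋₊ := by exact_mod_cast hl
      have h3 := Nat.floor_le (by positivity : 0 ≤ L * y)
      linarith
  simp only [Finset.sum_const, Finset.card_range, nsmul_eq_mul, mul_one] at h1
  have := Nat.lt_floor_add_one (L * y)
  linarith

/-- The midpoints (l + 1/2)/L are symmetric under u ↦ 1 - u. -/
theorem le_card_levels_compl {L : ℕ} (hL : 0 < L) {y : ℝ} (hy : 0 ≤ y) :
    L * (1 - y) - 1 ≤ ∑ l ∈ Finset.range L, if y ≤ ((l : ℝ) + 1 / 2) / L then (1 : ℝ) else 0 := by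
  have hL' : (0 : ℝ) < L := by exact_mod_cast hL
  have h := le_card_levels hL (y := 1 - y) (by linarith)
  refine h.trans ?_
  rw [← Finset.sum_range_reflect]
  refine Finset.sum_le_sum fun l hl => ?_
  rw [Finset.mem_range] at hl
  have hcast : ((L - 1 - l : ℕ) : ℝ) = L - 1 - l := by
    rw [Nat.sub_sub, Nat.cast_sub (by omega)]; push_cast; ring
  rw [hcast]
  split_ifs with h1 h2
  · exact le_rfl
  · exfalso
    rw [div_lt_iff₀ hL'] at h1
    rw [not_le, div_lt_iff₀ hL'] at h2
    linarith
  · norm_num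
  · exact le_rfl

theorem IsAdf.mem_Icc {f : ℝ → ℝ} (hf : IsAdf f) {x : ℝ} (hx : x ∈ Icc (0 : ℝ) 1) :
    f x ∈ Icc (0 : ℝ) 1 := by
  constructor
  · rw [← hf.2.1]; exact hf.1 (by simp) hx hx.1
  · rw [← hf.2.2]; exact hf.1 hx (by simp) hx.2

/-- A finite substitute for the u-quantile that avoids S: by monotonicity the points with f ≤ u lie
to the left of those with f > u. Adding 0 and 1 to S puts x in the open interval. -/
theorem IsAdf.exists_separating {f : ℝ → ℝ} (hf : IsAdf f) (S : Finset ℝ)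
    (hS : ∀ s ∈ S, s ∈ Icc (0 : ℝ) 1) {u : ℝ} (hu : u ∈ Ico (0 : ℝ) 1) :
    ∃ x ∈ Ioo (0 : ℝ) 1, ∀ s ∈ S, (f s ≤ u → s < x) ∧ (u < f s → x < s) := by
  classical
  set S' := insert 0 (insert 1 S) with hS'
  have hmem : ∀ s ∈ S', s ∈ Icc (0 : ℝ) 1 := by
    intro s hs
    simp only [hS', Finset.mem_insert] at hs
    rcases hs with rfl | rfl | hs
    · simp
    · simp
    · exact hS s hs
  obtain ⟨x, hx1, hx2⟩ := Order.exists_between_finsets (lo := S'.filter (fun s => f s ≤ u))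
    (hi := S'.filter (fun s => u < f s)) (by
      intro a ha b hb
      rw [Finset.mem_filter] at ha hb
      by_contra hcon
      have := hf.1 (hmem b hb.1) (hmem a ha.1) (not_lt.1 hcon)
      linarith [ha.2, hb.2])
  simp only [Finset.mem_filter] at hx1 hx2
  refine ⟨x, ⟨hx1 0 ⟨by simp [hS'], by rw [hf.2.1]; exact hu.1⟩,
    hx2 1 ⟨by simp [hS'], by rw [hf.2.2]; exact hu.2⟩⟩, fun s hs => ?_⟩
  have hs' : s ∈ S' := by simp [hS', hs]
  exact ⟨fun h => hx1 s ⟨hs', h⟩, fun h => hx2 s ⟨hs', h⟩⟩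

/-- A periodic sequence of points, with period divisible by `1, …, k`, whose distribution along
each residue class is that of a given linear family, up to an error `1 / L`. -/
theorem IsLinearFamily.exists_points {g : ℕ → ℕ → ℝ → ℝ} (hg : IsLinearFamily g) (k : ℕ) {L : ℕ}
    (hL : 0 < L) (S : Finset ℝ) (hS : ∀ s ∈ S, s ∈ Icc (0 : ℝ) 1) :
    ∃ D > 0, (∀ m, 1 ≤ m → m ≤ k → m ∣ D) ∧ ∃ x : ℕ → ℝ, (∀ n, x n ∈ Ioo (0 : ℝ) 1 ∧ x n ∉ S) ∧
      ∀ m r, r < m → m ≤ k → ∀ s ∈ S,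
        (g m r s - 1 / L) * D ≤
          m * ∑ n ∈ Finset.range D, (if n % m = r ∧ x n < s then (1 : ℝ) else 0) ∧
        (1 - g m r s - 1 / L) * D ≤
          m * ∑ n ∈ Finset.range D, (if n % m = r ∧ s < x n then (1 : ℝ) else 0) := by
  have hL' : (0 : ℝ) < L := by exact_mod_cast hL
  set M := k.factorial with hM
  have hM0 : 0 < M := Nat.factorial_pos k
  -- Position M l + t receives the quantile of g M t at level (l + 1/2)/L, so each residue class
  -- modulo M = k! runs once through all L levels.
  set u : ℕ → ℝ := fun n => (((n / M % L : ℕ) : ℝ) + 1 / 2) / L with hu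
  have hu01 : ∀ n, u n ∈ Ico (0 : ℝ) 1 := by
    intro n
    have : ((n / M % L : ℕ) : ℝ) + 1 ≤ L := by exact_mod_cast Nat.mod_lt _ hL
    refine ⟨by positivity, ?_⟩
    rw [hu, div_lt_one hL']
    linarith
  have hx := fun n => (hg.isAdf M (n % M) (Nat.mod_lt _ hM0)).exists_separating S hS (hu01 n)
  choose x hx01 hxS using hx
  have hblock : ∀ l < L, ∀ t < M, u (M * l + t) = ((l : ℝ) + 1 / 2) / L ∧ (M * l + t) % M = t := by
    intro l hl t ht
    constructor
    · simp only [hu]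
      rw [Nat.mul_add_div hM0, Nat.div_eq_of_lt ht, add_zero, Nat.mod_eq_of_lt hl]
    · rw [Nat.mul_add_mod, Nat.mod_eq_of_lt ht]
  refine ⟨M * L, by positivity, fun m h1 h2 => (Nat.dvd_factorial h1 h2).mul_right L, x,
    fun n => ⟨hx01 n, fun hn => ?_⟩, fun m r hr hm s hs => ?_⟩
  · rcases le_or_gt (g M (n % M) (x n)) (u n) with h | h
    · exact lt_irrefl _ ((hxS n _ hn).1 h)
    · exact lt_irrefl _ ((hxS n _ hn).2 h)
  obtain ⟨d, hd⟩ : m ∣ M := Nat.dvd_factorial (by omega) hm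
  have hd0 : 0 < d := Nat.pos_of_ne_zero (by rintro rfl; omega)
  -- The class r modulo m is the union of the d classes m i + r modulo M; linearity averages their
  -- distributions.
  have hlin : ∑ i ∈ Finset.range d, g M (m * i + r) s = d * g m r s := by
    rw [hg.linear m r d hr hd0 s (hS s hs), hd]
    field_simp
  have hmod : ∀ l t, (M * l + t) % m = t % m := by
    intro l t
    rw [hd, mul_assoc, Nat.mul_add_mod]
  have hadf : ∀ i ∈ Finset.range d, g M (m * i + r) s ∈ Icc (0 : ℝ) 1 := by
    intro i hi
    rw [Finset.mem_range] at hi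
    refine (hg.isAdf M _ ?_).mem_Icc (hS s hs)
    calc m * i + r < m * (i + 1) := by rw [mul_add]; omega
      _ ≤ M := hd ▸ Nat.mul_le_mul_left m hi
  have hcount : ∀ (R : ℕ → Prop) (Q : ℕ → ℕ → Prop) [DecidablePred R] [∀ t, DecidablePred (Q t)],
      (∀ l < L, ∀ t < M, Q t l → R (M * l + t)) →
      ∑ i ∈ Finset.range d, ∑ l ∈ Finset.range L, (if Q (m * i + r) l then (1 : ℝ) else 0) ≤
      ∑ n ∈ Finset.range (M * L), (if n % m = r ∧ R n then (1 : ℝ) else 0) := by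
    intro R Q _ _ hQR
    rw [sum_range_mul_eq, ← sum_range_mul_ite_mod hr (d := d)
      (fun t => ∑ l ∈ Finset.range L, (if Q t l then (1 : ℝ) else 0)), ← hd, Finset.sum_comm]
    refine Finset.sum_le_sum fun t ht => ?_
    rw [Finset.mem_range] at ht
    split_ifs with htr
    · refine Finset.sum_le_sum fun l hl => ?_
      rw [Finset.mem_range] at hl
      rw [hmod]
      split_ifs with h1 h2 h2
      · exact le_rfl
      · exact absurd ⟨htr, hQR l hl t ht h1⟩ h2
      · norm_num
      · exact le_rfl
    · exact Finset.sum_nonneg fun _ _ => by positivity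
  have hMd : (M : ℝ) = m * d := by exact_mod_cast hd
  have hm0 : (0 : ℝ) ≤ m := by positivity
  classical
  constructor
  · have h1 := hcount (fun n => x n < s) (fun t l => ((l : ℝ) + 1 / 2) / L < g M t s) (by
      intro l hl t ht h
      have := hblock l hl t ht
      refine (hxS (M * l + t) s hs).2 ?_
      rw [this.1, this.2]
      exact h)
    have h2 : d * (L * g m r s - 1) ≤ ∑ i ∈ Finset.range d, ∑ l ∈ Finset.range L,
        (if ((l : ℝ) + 1 / 2) / L < g M (m * i + r) s then (1 : ℝ) else 0) := by
      refine le_trans (le_of_eq ?_) (Finset.sum_le_sum fun i hi =>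
        le_card_levels hL (hadf i hi).2)
      rw [Finset.sum_sub_distrib, ← Finset.mul_sum, hlin]
      simp; ring
    calc (g m r s - 1 / L) * ((M * L : ℕ) : ℝ) = m * (d * (L * g m r s - 1)) := by
          push_cast; rw [hMd]; field_simp
      _ ≤ _ := mul_le_mul_of_nonneg_left (h2.trans h1) hm0
  · have h1 := hcount (fun n => s < x n) (fun t l => g M t s ≤ ((l : ℝ) + 1 / 2) / L) (by
      intro l hl t ht h
      have := hblock l hl t ht
      refine (hxS (M * l + t) s hs).1 ?_
      rw [this.1, this.2]
      exact h)
    have h2 : d * (L * (1 - g m r s) - 1) ≤ ∑ i ∈ Finset.range d, ∑ l ∈ Finset.range L,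
        (if g M (m * i + r) s ≤ ((l : ℝ) + 1 / 2) / L then (1 : ℝ) else 0) := by
      refine le_trans (le_of_eq ?_) (Finset.sum_le_sum fun i hi =>
        le_card_levels_compl hL (hadf i hi).1)
      rw [Finset.sum_sub_distrib, ← Finset.mul_sum, Finset.sum_sub_distrib, hlin]
      simp; ring
    calc (1 - g m r s - 1 / L) * ((M * L : ℕ) : ℝ) = m * (d * (L * (1 - g m r s) - 1)) := by
          push_cast; rw [hMd]; field_simp
      _ ≤ _ := mul_le_mul_of_nonneg_left (h2.trans h1) hm0

namespace Oracle

variable {o : Oracle}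

/-- The oracle approximates the points `s σ i m r j` and the values of `f σ i m r` there. -/
structure Approximates (o : Oracle) (f : ℕ → ℕ → ℕ → ℕ → ℝ → ℝ)
    (s : ℕ → ℕ → ℕ → ℕ → ℕ → ℝ) : Prop where
  mem : ∀ σ i m r j, s σ i m r j ∈ Icc (0 : ℝ) 1
  pt : ∀ σ i m r j, r < m → ∀ k : ℕ, 1 ≤ k →
    (o.pt ((σ, i, m, r, j), k) : ℝ) - 1 < k * s σ i m r j ∧
      k * s σ i m r j < o.pt ((σ, i, m, r, j), k) + 1
  val : ∀ σ i m r j, r < m → ∀ k : ℕ, 1 ≤ k →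
    (o.val ((σ, i, m, r, j), k) : ℝ) - 1 < k * f σ i m r (s σ i m r j) ∧
      k * f σ i m r (s σ i m r j) < o.val ((σ, i, m, r, j), k) + 1

variable {f : ℕ → ℕ → ℕ → ℕ → ℝ → ℝ} {s : ℕ → ℕ → ℕ → ℕ → ℕ → ℝ}

/-- Rounding the separated points to a fine enough grid leaves every comparison with a control point
unchanged, so the counts in the integer test are at least those of the points themselves. -/
theorem Approximates.exists_isPattern (h : o.Approximates f s)
    (hf : ∀ σ < 2, ∀ i, IsLinearFamily (f σ i)) (k i : ℕ) : ∃ c, o.IsPattern k i c := by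
  classical
  rcases Nat.eq_zero_or_pos k with rfl | hk
  · refine ⟨(4, [0]), by simp [IsPattern, ForallLt]⟩
  have hk' : (0 : ℝ) < k := by exact_mod_cast hk
  set σ := k % 2 with hσ
  set S : Finset ℝ := ((Finset.range (k + 1) ×ˢ Finset.range (k + 1)) ×ˢ Finset.range k).image
    (fun t : (ℕ × ℕ) × ℕ => s σ i t.1.1 t.1.2 t.2) with hS
  have hSmem : ∀ m r j, r < m → m ≤ k → j < k → s σ i m r j ∈ S := by
    intro m r j hr hm hj
    rw [hS, Finset.mem_image]
    exact ⟨((m, r), j), by simp; omega, rfl⟩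
  obtain ⟨D, hD, hdvd, x, hx, hcount⟩ :=
    (hf σ (Nat.mod_lt _ (by norm_num)) i).exists_points k hk S (by
      intro t ht
      rw [hS, Finset.mem_image] at ht
      obtain ⟨t, -, rfl⟩ := ht
      exact h.mem _ _ _ _ _)
  obtain ⟨δ, hδ, hgap⟩ : ∃ δ > 0, ∀ n < D, ∀ t ∈ S, δ ≤ |x n - t| := by
    rcases (Finset.range D ×ˢ S).eq_empty_or_nonempty with he | hne
    · refine ⟨1, one_pos, fun n hn t ht => ?_⟩
      have : (n, t) ∈ Finset.range D ×ˢ S := by simp [hn, ht]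
      rw [he] at this
      simp at this
    · obtain ⟨z, hz, hmin⟩ := Finset.exists_min_image _ (fun z : ℕ × ℝ => |x z.1 - z.2|) hne
      refine ⟨|x z.1 - z.2|, abs_pos.2 (sub_ne_zero.2 fun heq => ?_), fun n hn t ht =>
        hmin (n, t) (by simp [hn, ht])⟩
      rw [Finset.mem_product] at hz
      exact (hx z.1).2 (heq ▸ hz.2)
  obtain ⟨h₁, hh₁⟩ := exists_nat_gt (4 / δ)
  -- At this resolution every gap is at least four units, enough for the floor of N x_n, the error
  -- of `pt` and the offsets in the left and right counts.
  set N := h₁ + 4 with hN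
  have hN0 : (0 : ℝ) < N := by positivity
  have hNδ : 4 ≤ N * δ := by
    rw [div_lt_iff₀ hδ] at hh₁
    rw [hN]; push_cast
    nlinarith
  set l : List ℕ := (List.range D).map fun n => ⌊N * x n⌋₊ with hl
  have hlen : l.length = D := by simp [hl]
  have hget : ∀ n < D, l.getD n 0 = ⌊N * x n⌋₊ := by
    intro n hn
    simp [hl, List.getD, hn]
  have hfl : ∀ n, (⌊N * x n⌋₊ : ℝ) ≤ N * x n ∧ N * x n < ⌊N * x n⌋₊ + 1 := fun n =>
    ⟨Nat.floor_le (by have := (hx n).1.1; positivity), Nat.lt_floor_add_one _⟩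
  refine ⟨(N, l), by omega, by rw [hlen]; exact hD, fun n hn => ?_, fun m hm => ⟨?_, ?_⟩⟩
  · dsimp only at hn ⊢
    rw [hlen] at hn
    rw [hget n hn, Nat.floor_lt (by have := (hx n).1.1; positivity)]
    have := (hx n).1.2
    nlinarith
  · dsimp only
    rw [hlen]
    exact Nat.mod_eq_zero_of_dvd (hdvd (m + 1) (by omega) (by omega))
  · intro r hr j hj
    dsimp only
    rw [leftCount, rightCount, hlen]
    set t := s σ i (m + 1) r j with ht
    obtain ⟨hc1, hc2⟩ := hcount (m + 1) r hr (by omega) t (hSmem _ _ _ hr (by omega) hj)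
    obtain ⟨hv1, hv2⟩ := h.val σ i (m + 1) r j hr k hk
    obtain ⟨hp1, hp2⟩ := h.pt σ i (m + 1) r j hr N (by omega)
    set y := f σ i (m + 1) r t with hy
    set Y := o.val ((σ, i, m + 1, r, j), k) with hY
    set V := o.pt ((σ, i, m + 1, r, j), N) with hV
    have hD' : (0 : ℝ) < D := by exact_mod_cast hD
    have hleft : ∑ n ∈ Finset.range D, (if n % (m + 1) = r ∧ x n < t then (1 : ℝ) else 0) ≤
        ∑ n ∈ Finset.range D, (if n % (m + 1) = r ∧ l.getD n 0 + 2 ≤ V then (1 : ℝ) else 0) := by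
      refine Finset.sum_le_sum fun n hn => ?_
      rw [Finset.mem_range] at hn
      split_ifs with h1 h2
      · exact le_rfl
      · refine absurd ⟨h1.1, ?_⟩ h2
        rw [hget n hn]
        have h3 := hgap n hn t (hSmem _ _ _ hr (by omega) hj)
        rw [abs_of_neg (by linarith [h1.2])] at h3
        have h4 := hfl n
        have h5 : N * x n + 4 ≤ N * t := by nlinarith
        have h6 : (⌊N * x n⌋₊ : ℝ) + 2 < V := by linarith
        exact_mod_cast h6.le
      · norm_num
      · exact le_rfl
    have hright : ∑ n ∈ Finset.range D, (if n % (m + 1) = r ∧ t < x n then (1 : ℝ) else 0) ≤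
        ∑ n ∈ Finset.range D, (if n % (m + 1) = r ∧ V + 1 ≤ l.getD n 0 then (1 : ℝ) else 0) := by
      refine Finset.sum_le_sum fun n hn => ?_
      rw [Finset.mem_range] at hn
      split_ifs with h1 h2
      · exact le_rfl
      · refine absurd ⟨h1.1, ?_⟩ h2
        rw [hget n hn]
        have h3 := hgap n hn t (hSmem _ _ _ hr (by omega) hj)
        rw [abs_of_pos (by linarith [h1.2])] at h3
        have h4 := hfl n
        have h5 : N * t + 4 ≤ N * x n := by nlinarith
        have h6 : (V : ℝ) + 1 < ⌊N * x n⌋₊ := by linarith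
        exact_mod_cast h6.le
      · norm_num
      · exact le_rfl
    have hm0 : (0 : ℝ) ≤ ((m + 1 : ℕ) : ℝ) := by positivity
    have e1 := mul_le_mul_of_nonneg_left (hc1.trans (mul_le_mul_of_nonneg_left hleft hm0)) hk'.le
    have e2 := mul_le_mul_of_nonneg_left (hc2.trans (mul_le_mul_of_nonneg_left hright hm0)) hk'.le
    have e3 : (k : ℝ) * ((y - 1 / k) * D) = (k * y - 1) * D := by field_simp
    have e4 : (k : ℝ) * ((1 - y - 1 / k) * D) = (k - k * y - 1) * D := by field_simp
    rw [e3] at e1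
    rw [e4] at e2
    rw [← Nat.cast_le (α := ℝ), ← Nat.cast_le (α := ℝ)]
    push_cast at e1 e2 ⊢
    constructor
    · nlinarith
    · nlinarith

theorem pattern_spec {k i : ℕ} (h : ∃ c, o.IsPattern k i c) : o.IsPattern k i (o.pattern k i) := by
  obtain ⟨c, hc⟩ := h
  exact least_spec (p := fun z => o.IsPattern k i (Denumerable.ofNat (ℕ × List ℕ) z))
    ⟨Encodable.encode c, by rwa [Denumerable.ofNat_encode]⟩

end Oracle

end CantorSeries

namespace CantorSeries

/-! ### Counting along blocks of a pattern -/

theorem count_eq_ncard (P : ℕ → Prop) [DecidablePred P] (X : ℕ) : Nat.count P X = {n | n < X ∧ P n}.ncard := by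
  rw [Nat.count_eq_card_filter_range, ← Set.ncard_coe_finset]
  congr 1; ext n; simp

theorem count_le_count_add {U B Z : ℕ → Prop} [DecidablePred U] [DecidablePred B]
    [DecidablePred Z] (h : ∀ n, U n → B n ∨ Z n) (X : ℕ) :
    Nat.count U X ≤ Nat.count B X + Nat.count Z X := by
  induction X with
  | zero => simp
  | succ X ih =>
    rw [Nat.count_succ, Nat.count_succ, Nat.count_succ]
    have := h X
    split_ifs <;> first | omega | tauto

/-- Each full period contributes at least θ D, from whatever position it starts; the incomplete one
costs at most D because θ ≤ 1. -/
theorem le_count_of_periodic {U G : ℕ → Prop} [DecidablePred U] [DecidablePred G] {D : ℕ} (hD : 0 < D) {θ : ℝ} (h1 : θ ≤ 1)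
    (hθ : θ * D ≤ Nat.count G D) (hper : Function.Periodic G D) {X Y : ℕ} (hXY : X ≤ Y)
    (hsub : ∀ n, X ≤ n → n < Y → G n → U n) :
    θ * ((Y : ℝ) - X) - D ≤ (Nat.count U Y : ℝ) - Nat.count U X := by
  obtain ⟨l, rfl⟩ := Nat.exists_eq_add_of_le hXY
  induction l using Nat.strong_induction_on generalizing X with
  | _ l ih =>
    rcases lt_or_ge l D with hl | hl
    · have h2 : (Nat.count U X : ℝ) ≤ Nat.count U (X + l) := by
        exact_mod_cast Nat.count_monotone U (by omega : X ≤ X + l)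
      have h3 : (l : ℝ) ≤ D := by exact_mod_cast hl.le
      have h4 : (0 : ℝ) ≤ l := by positivity
      push_cast
      nlinarith
    · obtain ⟨l', rfl⟩ := Nat.exists_eq_add_of_le hl
      have h2 := ih l' (by omega) (X := X + D) (by omega)
        (fun n hn hn' => hsub n (by omega) (by omega))
      have h3 : Nat.count G D + Nat.count U X ≤ Nat.count U (X + D) := by
        rw [← Nat.filter_Ico_card_eq_of_periodic X D G hper, Nat.count_eq_card_filter_range,
          Nat.count_eq_card_filter_range, ← Finset.card_union_of_disjoint]
        · refine Finset.card_le_card fun n hn => ?_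
          simp only [Finset.mem_union, Finset.mem_filter, Finset.mem_Ico, Finset.mem_range] at hn ⊢
          rcases hn with hn | hn
          · exact ⟨hn.1.2, hsub n hn.1.1 (by omega) hn.2⟩
          · exact ⟨by omega, hn.2⟩
        · rw [Finset.disjoint_left]
          intro n hn hn'
          simp only [Finset.mem_filter, Finset.mem_Ico, Finset.mem_range] at hn hn'
          omega
      have h4 : (Nat.count G D : ℝ) + Nat.count U X ≤ Nat.count U (X + D) := by exact_mod_cast h3
      rw [Nat.add_assoc] at h2
      push_cast at h2 ⊢
      linarith

namespace Oracle

variable {o : Oracle}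

theorem exists_start_le (X : ℕ) : ∃ k, o.start k ≤ X ∧ X < o.start (k + 1) := by
  have h1 : X < o.start (o.stage X + 1) :=
    least_spec (p := fun k => X < o.start (k + 1)) ⟨X, lt_start_succ X⟩
  refine ⟨o.stage X, ?_, h1⟩
  rcases Nat.eq_zero_or_pos (o.stage X) with h0 | h0
  · rw [h0]; exact Nat.zero_le _
  · have := not_of_lt_least (p := fun k => X < o.start (k + 1)) (n := o.stage X - 1)
      (by unfold stage at *; omega)
    rw [Nat.sub_add_cancel h0] at this
    omega

theorem stage_eq {n k : ℕ} (h1 : o.start k ≤ n) (h2 : n < o.start (k + 1)) : o.stage n = k := by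
  have h3 : n < o.start (o.stage n + 1) :=
    least_spec (p := fun k => n < o.start (k + 1)) ⟨n, lt_start_succ n⟩
  have h4 : o.stage n ≤ k := least_le (p := fun k => n < o.start (k + 1)) h2
  have h5 := o.start_strictMono.lt_iff_lt.1 (h1.trans_lt h3)
  omega

/-- A lower bound valid in all late stages passes to all large X. The exceptional set Z is first
counted in favour of B and then removed, at a cost of ε X / 2. -/
theorem eventually_le_count {B Z : ℕ → Prop} [DecidablePred B] [DecidablePred Z] {θ : ℝ} (hθ : θ ≤ 1)
    (hZ : ∀ ε > 0, ∀ᶠ X in atTop, (Nat.count Z X : ℝ) ≤ ε * X)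
    (hB : ∀ᶠ k in atTop, ∀ Y, o.start k ≤ Y → Y ≤ o.start (k + 1) →
      θ * ((Y : ℝ) - o.start k) - o.cost k ≤
        (Nat.count (fun n => B n ∨ Z n) Y : ℝ) - Nat.count (fun n => B n ∨ Z n) (o.start k))
    {ε : ℝ} (hε : 0 < ε) : ∀ᶠ X in atTop, (θ - ε) * X ≤ Nat.count B X := by
  obtain ⟨k₀, hk₀⟩ := eventually_atTop.1 hB
  obtain ⟨k₁, hk₁⟩ := exists_nat_gt (2 / ε)
  filter_upwards [hZ (ε / 2) (by positivity), eventually_ge_atTop (o.start (k₀ + k₁ + 1))]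
    with X hX1 hX2
  obtain ⟨k, hk1, hk2⟩ := o.exists_start_le X
  have hk : k₀ + k₁ + 1 ≤ k := by
    have := o.start_strictMono.lt_iff_lt.1 (hX2.trans_lt hk2)
    omega
  -- The full stage j and the begun stage j + 1 are counted, everything before is dropped. The drop
  -- and both costs are at most X/(j+1) by the recursion for `start`.
  obtain ⟨j, rfl⟩ : ∃ j, k = j + 1 := ⟨k - 1, by omega⟩
  have e1 := hk₀ j (by omega) (o.start (j + 1)) (o.start_lt_start_succ j).le le_rfl
  have e2 := hk₀ (j + 1) (by omega) X hk1 hk2.le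
  have e3 : (Nat.count (fun n => B n ∨ Z n) X : ℝ) ≤ Nat.count B X + Nat.count Z X := by
    exact_mod_cast count_le_count_add (fun n hn => hn) X
  have e4 : (j + 1 : ℝ) * (o.start j + o.cost j + o.cost (j + 1)) ≤ X := by
    have : (j + 1) * (o.start j + o.cost j + o.cost (j + 1) + 1) ≤ X := by
      rw [← start_succ]; exact hk1
    have : (j + 1) * (o.start j + o.cost j + o.cost (j + 1)) ≤ X :=
      le_trans (Nat.mul_le_mul_left _ (Nat.le_succ _)) this
    exact_mod_cast this
  have hj : 2 / ε ≤ (j : ℝ) + 1 := by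
    have : (k₁ : ℝ) ≤ j := by exact_mod_cast (by omega : k₁ ≤ j)
    linarith
  rw [div_le_iff₀ hε] at hj
  set c : ℝ := o.start j + o.cost j + o.cost (j + 1) with hc
  have hc0 : 0 ≤ c := by positivity
  have e5 : c ≤ ε / 2 * X := by nlinarith
  have e6 : θ * o.start j ≤ o.start j := by
    have : (0 : ℝ) ≤ o.start j := by positivity
    nlinarith
  have e7 : (0 : ℝ) ≤ Nat.count (fun n => B n ∨ Z n) (o.start j) := by positivity
  nlinarith

/-- When a stage ends it outweighs all that precedes it, so a bound in infinitely many stages shows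
at their ends. -/
theorem frequently_le_count {B Z : ℕ → Prop} [DecidablePred B] [DecidablePred Z] {θ : ℝ} (hθ : θ ≤ 1)
    (hZ : ∀ ε > 0, ∀ᶠ X in atTop, (Nat.count Z X : ℝ) ≤ ε * X)
    (hB : ∃ᶠ k in atTop, ∀ Y, o.start k ≤ Y → Y ≤ o.start (k + 1) →
      θ * ((Y : ℝ) - o.start k) - o.cost k ≤
        (Nat.count (fun n => B n ∨ Z n) Y : ℝ) - Nat.count (fun n => B n ∨ Z n) (o.start k))
    {ε : ℝ} (hε : 0 < ε) : ∃ᶠ X in atTop, (θ - ε) * X ≤ Nat.count B X := by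
  rw [frequently_atTop] at hB ⊢
  intro N
  obtain ⟨N₁, hN₁⟩ := eventually_atTop.1 (hZ (ε / 2) (by positivity))
  obtain ⟨k₁, hk₁⟩ := exists_nat_gt (2 / ε)
  obtain ⟨j, hj, hBj⟩ := hB (N + N₁ + k₁)
  have hlt : j < o.start (j + 1) := o.lt_start_succ j
  refine ⟨o.start (j + 1), by omega, ?_⟩
  set X := o.start (j + 1) with hX
  have e1 := hBj X (o.start_lt_start_succ j).le le_rfl
  have e2 := hN₁ X (by omega)
  have e3 : (Nat.count (fun n => B n ∨ Z n) X : ℝ) ≤ Nat.count B X + Nat.count Z X := by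
    exact_mod_cast count_le_count_add (fun n hn => hn) X
  have e4 : (j + 1 : ℝ) * (o.start j + o.cost j) ≤ X := by
    have : (j + 1) * (o.start j + o.cost j) ≤ X := by
      rw [hX, start_succ]
      exact Nat.mul_le_mul_left _ (by omega)
    exact_mod_cast this
  have hj : 2 / ε ≤ (j : ℝ) + 1 := by
    have : (k₁ : ℝ) ≤ j := by exact_mod_cast (by omega : k₁ ≤ j)
    linarith
  rw [div_le_iff₀ hε] at hj
  set c : ℝ := o.start j + o.cost j with hc
  have hc0 : 0 ≤ c := by positivity
  have e5 : c ≤ ε / 2 * X := by nlinarith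
  have e6 : θ * o.start j ≤ o.start j := by
    have : (0 : ℝ) ≤ o.start j := by positivity
    nlinarith
  have e7 : (0 : ℝ) ≤ Nat.count (fun n => B n ∨ Z n) (o.start j) := by positivity
  nlinarith

/-! ### The density of patterns -/

/-- The `n`-th interval of the periodic sequence given by a pattern has left end
`entry c n / c.1`. -/
def entry (c : ℕ × List ℕ) (n : ℕ) : ℕ := c.2.getD (n % c.2.length) 0

variable {f : ℕ → ℕ → ℕ → ℕ → ℝ → ℝ} {s : ℕ → ℕ → ℕ → ℕ → ℕ → ℝ}

theorem periodic_mod_entry {c : ℕ × List ℕ} {m r : ℕ} (h : m ∣ c.2.length) (Q : ℕ → Prop) :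
    Function.Periodic (fun n => n % m = r ∧ Q (entry c n)) c.2.length := by
  intro n
  obtain ⟨d, hd⟩ := h
  have h1 : (n + c.2.length) % m = n % m := by rw [hd, Nat.add_mul_mod_self_left]
  simp [entry, h1]

/-- Of the error 3/k, the tolerance of the test contributes 2/k and the approximation of the value
1/k. The offset 2 in `leftCount` covers the width of the interval and the error of the point. -/
theorem IsPattern.le_count_left (h : o.Approximates f s) {k i m r j : ℕ} {c : ℕ × List ℕ}
    (hc : o.IsPattern k i c) (hr : r < m) (hm : m ≤ k) (hj : j < k) :
    (f (k % 2) i m r (s (k % 2) i m r j) - 3 / k) * c.2.length ≤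
      m * Nat.count (fun n => n % m = r ∧ ((entry c n : ℝ) + 1) / c.1 < s (k % 2) i m r j)
        c.2.length := by
  obtain ⟨m, rfl⟩ : ∃ t, m = t + 1 := ⟨m - 1, by omega⟩
  obtain ⟨h4, h0, -, hall⟩ := hc
  have hk : (0 : ℝ) < k := by exact_mod_cast (by omega : 0 < k)
  have hc1 : (0 : ℝ) < c.1 := by exact_mod_cast (by omega : 0 < c.1)
  have hle := ((hall m (by omega)).2 r hr j hj).1
  have hv := (h.val (k % 2) i (m + 1) r j hr k (by omega)).2
  have hp := (h.pt (k % 2) i (m + 1) r j hr c.1 (by omega)).1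
  set V := o.pt ((k % 2, i, m + 1, r, j), c.1)
  set t := s (k % 2) i (m + 1) r j
  have hcnt : leftCount c (m + 1) r V ≤
      Nat.count (fun n => n % (m + 1) = r ∧ ((entry c n : ℝ) + 1) / c.1 < t) c.2.length := by
    rw [leftCount, Finset.sum_boole, Nat.count_eq_card_filter_range, Nat.cast_id]
    refine Finset.card_le_card fun n hn => ?_
    rw [Finset.mem_filter, Finset.mem_range] at hn ⊢
    refine ⟨hn.1, hn.2.1, ?_⟩
    rw [entry, Nat.mod_eq_of_lt hn.1, div_lt_iff₀ hc1]
    have : ((c.2.getD n 0 : ℕ) : ℝ) + 2 ≤ V := by exact_mod_cast hn.2.2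
    linarith
  have hle' : (o.val ((k % 2, i, m + 1, r, j), k) : ℝ) * c.2.length ≤
      k * (m + 1) * leftCount c (m + 1) r V + 2 * c.2.length := by exact_mod_cast hle
  have hcnt' : (leftCount c (m + 1) r V : ℝ) ≤
      Nat.count (fun n => n % (m + 1) = r ∧ ((entry c n : ℝ) + 1) / c.1 < t) c.2.length := by
    exact_mod_cast hcnt
  have hkm : (0 : ℝ) ≤ k * (m + 1) := by positivity
  have hD : (0 : ℝ) ≤ c.2.length := by positivity
  refine le_of_mul_le_mul_left ?_ hk
  have e : (k : ℝ) * ((f (k % 2) i (m + 1) r t - 3 / k) * c.2.length) =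
    (k * f (k % 2) i (m + 1) r t - 3) * c.2.length := by field_simp
  rw [e]
  push_cast
  have := mul_le_mul_of_nonneg_left hcnt' hkm
  nlinarith

theorem IsPattern.le_count_right (h : o.Approximates f s) {k i m r j : ℕ} {c : ℕ × List ℕ}
    (hc : o.IsPattern k i c) (hr : r < m) (hm : m ≤ k) (hj : j < k) :
    (1 - f (k % 2) i m r (s (k % 2) i m r j) - 3 / k) * c.2.length ≤
      m * Nat.count (fun n => n % m = r ∧ s (k % 2) i m r j ≤ (entry c n : ℝ) / c.1)
        c.2.length := by
  obtain ⟨m, rfl⟩ : ∃ t, m = t + 1 := ⟨m - 1, by omega⟩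
  obtain ⟨h4, h0, -, hall⟩ := hc
  have hk : (0 : ℝ) < k := by exact_mod_cast (by omega : 0 < k)
  have hc1 : (0 : ℝ) < c.1 := by exact_mod_cast (by omega : 0 < c.1)
  have hle := ((hall m (by omega)).2 r hr j hj).2
  have hv := (h.val (k % 2) i (m + 1) r j hr k (by omega)).1
  have hp := (h.pt (k % 2) i (m + 1) r j hr c.1 (by omega)).2
  set V := o.pt ((k % 2, i, m + 1, r, j), c.1)
  set t := s (k % 2) i (m + 1) r j
  have hcnt : rightCount c (m + 1) r V ≤
      Nat.count (fun n => n % (m + 1) = r ∧ t ≤ (entry c n : ℝ) / c.1) c.2.length := by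
    rw [rightCount, Finset.sum_boole, Nat.count_eq_card_filter_range, Nat.cast_id]
    refine Finset.card_le_card fun n hn => ?_
    rw [Finset.mem_filter, Finset.mem_range] at hn ⊢
    refine ⟨hn.1, hn.2.1, ?_⟩
    rw [entry, Nat.mod_eq_of_lt hn.1, le_div_iff₀ hc1]
    have : (V : ℝ) + 1 ≤ (c.2.getD n 0 : ℕ) := by exact_mod_cast hn.2.2
    linarith
  have hle' : (k : ℝ) * c.2.length ≤ k * (m + 1) * rightCount c (m + 1) r V +
      (o.val ((k % 2, i, m + 1, r, j), k) + 2) * c.2.length := by exact_mod_cast hle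
  have hcnt' : (rightCount c (m + 1) r V : ℝ) ≤
      Nat.count (fun n => n % (m + 1) = r ∧ t ≤ (entry c n : ℝ) / c.1) c.2.length := by
    exact_mod_cast hcnt
  have hkm : (0 : ℝ) ≤ k * (m + 1) := by positivity
  have hD : (0 : ℝ) ≤ c.2.length := by positivity
  refine le_of_mul_le_mul_left ?_ hk
  have e : (k : ℝ) * ((1 - f (k % 2) i (m + 1) r t - 3 / k) * c.2.length) =
    (k - k * f (k % 2) i (m + 1) r t - 3) * c.2.length := by field_simp
  rw [e]
  push_cast
  have := mul_le_mul_of_nonneg_left hcnt' hkm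
  nlinarith

/-- The points `s σ i m r j` are dense enough to determine `f σ i m r`. -/
def Determines (s : ℕ → ℕ → ℕ → ℕ → ℕ → ℝ) (f : ℕ → ℕ → ℕ → ℕ → ℝ → ℝ) : Prop :=
  ∀ σ < 2, ∀ i m r, r < m → ∀ γ ∈ Icc (0 : ℝ) 1, ∀ ε > 0,
    (∃ j, s σ i m r j ≤ γ ∧ f σ i m r γ - ε ≤ f σ i m r (s σ i m r j)) ∧
    ∃ j, γ ≤ s σ i m r j ∧ f σ i m r (s σ i m r j) ≤ f σ i m r γ + ε

theorem eventually_le_count_left (h : o.Approximates f s) (hs : Determines s f)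
    (hex : ∀ k i, ∃ c, o.IsPattern k i c) (i : ℕ) {m r σ : ℕ} (hr : r < m) (hσ : σ < 2) {γ : ℝ}
    (hγ : γ ∈ Icc (0 : ℝ) 1) {ε : ℝ} (hε : 0 < ε) :
    ∀ᶠ k in atTop, k % 2 = σ →
      (f σ i m r γ - ε) / m * (o.pattern k i).2.length ≤
        Nat.count (fun n => n % m = r ∧
          ((entry (o.pattern k i) n : ℝ) + 1) / (o.pattern k i).1 < γ)
          (o.pattern k i).2.length := by
  obtain ⟨j, hj1, hj2⟩ := (hs σ hσ i m r hr γ hγ (ε / 2) (by positivity)).1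
  have hm : (0 : ℝ) < m := by exact_mod_cast (by omega : 0 < m)
  filter_upwards [eventually_ge_atTop m, eventually_gt_atTop j,
    tendsto_natCast_atTop_atTop.eventually_ge_atTop (6 / ε)] with k hk1 hk2 hk3 hkσ
  have hk : (0 : ℝ) < k := by exact_mod_cast (by omega : 0 < k)
  have hpat := (pattern_spec (hex k i)).le_count_left h hr hk1 hk2
  rw [hkσ] at hpat
  set c := o.pattern k i
  have h3 : 3 / (k : ℝ) ≤ ε / 2 := by
    rw [div_le_iff₀ hε] at hk3
    rw [div_le_iff₀ hk]; linarith
  have hD : (0 : ℝ) ≤ c.2.length := by positivity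
  have hmono : Nat.count (fun n => n % m = r ∧ ((entry c n : ℝ) + 1) / c.1 < s σ i m r j)
      c.2.length ≤
      Nat.count (fun n => n % m = r ∧ ((entry c n : ℝ) + 1) / c.1 < γ) c.2.length :=
    Nat.count_mono_left fun n _ hn => ⟨hn.1, hn.2.trans_le hj1⟩
  have hmono' : (Nat.count (fun n => n % m = r ∧ ((entry c n : ℝ) + 1) / c.1 < s σ i m r j)
      c.2.length : ℝ) ≤
      Nat.count (fun n => n % m = r ∧ ((entry c n : ℝ) + 1) / c.1 < γ) c.2.length := by
    exact_mod_cast hmono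
  rw [div_mul_eq_mul_div, div_le_iff₀ hm, mul_comm _ (m : ℝ)]
  have := mul_le_mul_of_nonneg_left hmono' hm.le
  nlinarith

theorem eventually_le_count_right (h : o.Approximates f s) (hs : Determines s f)
    (hex : ∀ k i, ∃ c, o.IsPattern k i c) (i : ℕ) {m r σ : ℕ} (hr : r < m) (hσ : σ < 2) {γ : ℝ}
    (hγ : γ ∈ Icc (0 : ℝ) 1) {ε : ℝ} (hε : 0 < ε) :
    ∀ᶠ k in atTop, k % 2 = σ →
      (1 - f σ i m r γ - ε) / m * (o.pattern k i).2.length ≤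
        Nat.count (fun n => n % m = r ∧
          γ ≤ (entry (o.pattern k i) n : ℝ) / (o.pattern k i).1)
          (o.pattern k i).2.length := by
  obtain ⟨j, hj1, hj2⟩ := (hs σ hσ i m r hr γ hγ (ε / 2) (by positivity)).2
  have hm : (0 : ℝ) < m := by exact_mod_cast (by omega : 0 < m)
  filter_upwards [eventually_ge_atTop m, eventually_gt_atTop j,
    tendsto_natCast_atTop_atTop.eventually_ge_atTop (6 / ε)] with k hk1 hk2 hk3 hkσ
  have hk : (0 : ℝ) < k := by exact_mod_cast (by omega : 0 < k)
  have hpat := (pattern_spec (hex k i)).le_count_right h hr hk1 hk2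
  rw [hkσ] at hpat
  set c := o.pattern k i
  have h3 : 3 / (k : ℝ) ≤ ε / 2 := by
    rw [div_le_iff₀ hε] at hk3
    rw [div_le_iff₀ hk]; linarith
  have hD : (0 : ℝ) ≤ c.2.length := by positivity
  have hmono : Nat.count (fun n => n % m = r ∧ s σ i m r j ≤ (entry c n : ℝ) / c.1)
      c.2.length ≤
      Nat.count (fun n => n % m = r ∧ γ ≤ (entry c n : ℝ) / c.1) c.2.length :=
    Nat.count_mono_left fun n _ hn => ⟨hn.1, hj1.trans hn.2⟩
  have hmono' : (Nat.count (fun n => n % m = r ∧ s σ i m r j ≤ (entry c n : ℝ) / c.1)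
      c.2.length : ℝ) ≤
      Nat.count (fun n => n % m = r ∧ γ ≤ (entry c n : ℝ) / c.1) c.2.length := by
    exact_mod_cast hmono
  rw [div_mul_eq_mul_div, div_le_iff₀ hm, mul_comm _ (m : ℝ)]
  have := mul_le_mul_of_nonneg_left hmono' hm.le
  nlinarith

end Oracle

end CantorSeries

namespace CantorSeries

/-! ### From counts to distribution functions -/

theorem count_mod_mul {m r : ℕ} (hr : r < m) (P : ℕ → Prop) [DecidablePred P] (N : ℕ) :
    (Nat.count (fun n => n % m = r ∧ P n) (m * N) : ℝ) = Nat.count (fun n => P (m * n + r)) N := by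
  have h := sum_range_mul_ite_mod (d := N) hr (fun n => if P n then (1 : ℝ) else 0)
  rw [Nat.count_eq_card_filter_range, Nat.count_eq_card_filter_range,
    ← Finset.sum_boole, ← Finset.sum_boole, ← h]
  refine Finset.sum_congr rfl fun n _ => ?_
  by_cases h1 : n % m = r <;> simp [h1]

theorem eventually_le_count_comp {m r : ℕ} (hr : r < m) {P : ℕ → Prop} [DecidablePred P] {t : ℝ}
    (h : ∀ ε > 0, ∀ᶠ X in atTop,
      ((t - ε) / m - ε) * X ≤ (Nat.count (fun n => n % m = r ∧ P n) X : ℝ))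
    {ε : ℝ} (hε : 0 < ε) :
    ∀ᶠ N in atTop, (t - ε) * N ≤ (Nat.count (fun n => P (m * n + r)) N : ℝ) := by
  have hm : (0 : ℝ) < m := by exact_mod_cast (by omega : 0 < m)
  have htend : Tendsto (fun N => m * N) atTop atTop :=
    tendsto_id.const_mul_atTop' (by omega)
  -- With X = m N the two errors add up to (1 + m) ε' N, whence the choice ε' = ε/(m+1).
  filter_upwards [htend.eventually (h (ε / (m + 1)) (by positivity))] with N hN
  rw [count_mod_mul hr] at hN
  refine le_trans (le_of_eq ?_) hN
  push_cast
  field_simp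
  ring

/-- Here X need not be a multiple of m. It is rounded up to one, which changes X/m by at most 1. -/
theorem frequently_le_count_comp {m r : ℕ} (hr : r < m) {P : ℕ → Prop} [DecidablePred P] {t : ℝ} (ht : t ≤ 1)
    (h : ∀ ε > 0, ∃ᶠ X in atTop,
      ((t - ε) / m - ε) * X ≤ (Nat.count (fun n => n % m = r ∧ P n) X : ℝ))
    {ε : ℝ} (hε : 0 < ε) :
    ∃ᶠ N in atTop, (t - ε) * N ≤ (Nat.count (fun n => P (m * n + r)) N : ℝ) := by
  have hm : (0 : ℝ) < m := by exact_mod_cast (by omega : 0 < m)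
  rw [frequently_atTop]
  intro N₀
  obtain ⟨N₁, hN₁⟩ := exists_nat_gt (2 / ε)
  obtain ⟨X, hX, hle⟩ := frequently_atTop.1 (h (ε / 2 / (m + 1)) (by positivity)) (m * (N₀ + N₁))
  have hN : N₀ + N₁ ≤ X / m := by
    rw [Nat.le_div_iff_mul_le (by omega), mul_comm]; exact hX
  refine ⟨X / m + 1, by omega, ?_⟩
  rw [← count_mod_mul hr]
  have h1 : X < m * (X / m + 1) := by
    have := Nat.lt_mul_div_succ X (by omega : 0 < m); simpa using this
  have h2 : m * (X / m) ≤ X := Nat.mul_div_le X m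
  have h3 : (Nat.count (fun n => n % m = r ∧ P n) X : ℝ) ≤
      Nat.count (fun n => n % m = r ∧ P n) (m * (X / m + 1)) := by
    exact_mod_cast Nat.count_monotone _ h1.le
  set N : ℝ := ((X / m + 1 : ℕ) : ℝ) with hNdef
  have h1' : (X : ℝ) ≤ m * N := by rw [hNdef]; exact_mod_cast h1.le
  have h2' : (m : ℝ) * (N - 1) ≤ X := by
    rw [hNdef]; push_cast; rw [add_sub_cancel_right]; exact_mod_cast h2
  have h4 : 2 / ε ≤ N := by
    refine hN₁.le.trans ?_
    rw [hNdef]; exact_mod_cast (by omega : N₁ ≤ X / m + 1)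
  rw [div_le_iff₀ hε] at h4
  refine le_trans ?_ (hle.trans h3)
  have e : ((t - ε / 2 / (m + 1)) / m - ε / 2 / (m + 1)) * X = (t - ε / 2) * (X / m) := by
    field_simp
    ring
  rw [e]
  have h5 : (X : ℝ) / m ≤ N := by rw [div_le_iff₀ hm, mul_comm]; exact h1'
  have h6 : N - 1 ≤ (X : ℝ) / m := by rw [le_div_iff₀ hm, mul_comm]; exact h2'
  rcases le_total 0 (t - ε / 2) with h7 | h7
  · nlinarith
  · nlinarith

theorem limsup_eq_of_forall_pos {u : ℕ → ℝ} {a : ℝ} (hu0 : ∀ n, 0 ≤ u n) (hu1 : ∀ n, u n ≤ 1)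
    (h1 : ∀ ε > 0, ∀ᶠ n in atTop, u n ≤ a + ε) (h2 : ∀ ε > 0, ∃ᶠ n in atTop, a - ε ≤ u n) :
    limsup u atTop = a := by
  have hb : IsBoundedUnder (· ≤ ·) atTop u := isBoundedUnder_of ⟨1, hu1⟩
  have hc : IsCoboundedUnder (· ≤ ·) atTop u :=
    (isBoundedUnder_of ⟨0, hu0⟩ : IsBoundedUnder (· ≥ ·) atTop u).isCoboundedUnder_le
  refine le_antisymm (le_of_forall_pos_le_add fun ε hε => limsup_le_of_le hc (h1 ε hε)) ?_
  refine le_of_forall_pos_le_add fun ε hε => ?_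
  have := le_limsup_of_frequently_le (h2 ε hε) hb
  linarith

theorem liminf_eq_of_forall_pos {u : ℕ → ℝ} {a : ℝ} (hu0 : ∀ n, 0 ≤ u n) (hu1 : ∀ n, u n ≤ 1)
    (h1 : ∀ ε > 0, ∀ᶠ n in atTop, a - ε ≤ u n) (h2 : ∀ ε > 0, ∃ᶠ n in atTop, u n ≤ a + ε) :
    liminf u atTop = a := by
  have hb : IsBoundedUnder (· ≥ ·) atTop u := isBoundedUnder_of ⟨0, hu0⟩
  have hc : IsCoboundedUnder (· ≥ ·) atTop u :=
    (isBoundedUnder_of ⟨1, hu1⟩ : IsBoundedUnder (· ≤ ·) atTop u).isCoboundedUnder_ge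
  refine le_antisymm (le_of_forall_pos_le_add fun ε hε => liminf_le_of_frequently_le (h2 ε hε) hb)
    ?_
  refine le_of_forall_pos_le_add fun ε hε => ?_
  have := le_liminf_of_le hc (h1 ε hε)
  linarith

theorem freq_nonneg (ω : ℕ → ℝ) (γ : ℝ) (n : ℕ) : 0 ≤ freq ω γ n := by unfold freq; positivity

theorem natCast_mul_freq {ω : ℕ → ℝ} (hω : ∀ n, 0 ≤ ω n) (γ : ℝ) (n : ℕ) :
    n * freq ω γ n = Nat.count (fun i => ω i < γ) n := by
  rcases Nat.eq_zero_or_pos n with rfl | hn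
  · simp
  · have : (n : ℝ) ≠ 0 := by positivity
    rw [freq, mul_div_cancel₀ _ this, count_eq_ncard]
    congr 3; ext i; simp [hω i]

theorem natCast_mul_one_sub_freq {ω : ℕ → ℝ} (hω : ∀ n, 0 ≤ ω n) (γ : ℝ) (n : ℕ) :
    n * (1 - freq ω γ n) = Nat.count (fun i => γ ≤ ω i) n := by
  have h : Nat.count (fun i => ω i < γ) n + Nat.count (fun i => γ ≤ ω i) n = n := by
    induction n with
    | zero => simp
    | succ n ih =>
      rw [Nat.count_succ, Nat.count_succ]
      rcases lt_or_ge (ω n) γ with h1 | h1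
      · rw [if_pos h1, if_neg (not_le.2 h1)]; omega
      · rw [if_neg (not_lt.2 h1), if_pos h1]; omega
  have h' : (Nat.count (fun i => ω i < γ) n : ℝ) + Nat.count (fun i => γ ≤ ω i) n = n := by
    exact_mod_cast h
  rw [mul_sub, natCast_mul_freq hω]
  linarith

theorem freq_le_one {ω : ℕ → ℝ} (hω : ∀ n, 0 ≤ ω n) (γ : ℝ) (n : ℕ) : freq ω γ n ≤ 1 := by
  rcases Nat.eq_zero_or_pos n with rfl | hn
  · simp [freq]
  · have h1 : (0 : ℝ) < n := by exact_mod_cast hn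
    have h2 := natCast_mul_one_sub_freq hω γ n
    have h3 : (0 : ℝ) ≤ n * (1 - freq ω γ n) := by rw [h2]; positivity
    have := nonneg_of_mul_nonneg_right h3 h1
    linarith

namespace Oracle

variable {o : Oracle}

/-! ### The digit bounds -/

theorem four_mul_le_two_pow {h : ℕ} (hh : 4 ≤ h) : 4 * h ≤ 2 ^ h := by
  induction h, hh using Nat.le_induction with
  | base => norm_num
  | succ h _ ih => rw [pow_succ]; omega

theorem target_lt (hex : ∀ k i, ∃ c, o.IsPattern k i c) (v : ℕ) : o.target v < (o.current v).1 := by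
  obtain ⟨-, h0, hlt, -⟩ := pattern_spec (hex (o.stage (o.time (o.owner v) v)) (o.owner v))
  exact hlt _ (Nat.mod_lt _ h0)

theorem four_le_current (hex : ∀ k i, ∃ c, o.IsPattern k i c) (v : ℕ) : 4 ≤ (o.current v).1 :=
  (pattern_spec (hex _ _)).1

theorem Restricted.bounds (hex : ∀ k i, ∃ c, o.IsPattern k i c) {v : ℕ} (h : o.Restricted v) :
    o.target v * o.q (v + 1) / (o.current v).1 + o.q (v + 1) / (o.current v).1 ≤ o.hi v + 2 ∧
    o.hi v + 2 = (o.target v + 1) * o.q (v + 1) / (o.current v).1 ∧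
    o.hi v + 2 ≤ o.q (v + 1) ∧ o.lo v = o.target v * o.q (v + 1) / (o.current v).1 + 1 ∧
    4 ≤ o.q (v + 1) / (o.current v).1 := by
  have h4 := four_le_current hex v
  have hlt := target_lt hex v
  have hq : 4 * (o.current v).1 ≤ o.q (v + 1) := (four_mul_le_two_pow h4).trans h.2.1
  have e1 : 4 ≤ o.q (v + 1) / (o.current v).1 := by
    rw [Nat.le_div_iff_mul_le (by omega)]; exact hq
  have e2 : o.target v * o.q (v + 1) / (o.current v).1 + o.q (v + 1) / (o.current v).1 ≤
      (o.target v + 1) * o.q (v + 1) / (o.current v).1 := by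
    rw [add_mul, one_mul]; exact Nat.div_add_div_le_add_div
  have e3 : (o.target v + 1) * o.q (v + 1) / (o.current v).1 ≤ o.q (v + 1) := by
    rw [Nat.div_le_iff_le_mul_add_pred (by omega)]
    have : (o.target v + 1) * o.q (v + 1) ≤ (o.current v).1 * o.q (v + 1) :=
      Nat.mul_le_mul_right _ (by omega)
    omega
  have hhi : o.hi v = (o.target v + 1) * o.q (v + 1) / (o.current v).1 - 2 := by
    rw [hi, if_pos h]
  have hlo : o.lo v = o.target v * o.q (v + 1) / (o.current v).1 + 1 := by
    rw [lo, if_pos h]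
  refine ⟨?_, ?_, ?_, hlo, e1⟩ <;> omega

theorem lo_le_hi (hex : ∀ k i, ∃ c, o.IsPattern k i c) (v : ℕ) : o.lo v ≤ o.hi v := by
  by_cases h : o.Restricted v
  · have := h.bounds hex
    omega
  · rw [lo, if_neg h]; exact Nat.zero_le _

theorem hi_add_two_le (hq : IsBasicSequence o.q) (hex : ∀ k i, ∃ c, o.IsPattern k i c) (v : ℕ) :
    o.hi v + 2 ≤ o.q (v + 1) := by
  by_cases h : o.Restricted v
  · exact (h.bounds hex).2.2.1
  · have := hq (v + 1) (by omega)
    rw [hi, if_neg h]; omega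

/-- At least ⌊q/h⌋ - 2 digits remain. As ⌊q/h⌋ ≥ 4, trimming the ends of the block costs only a
constant factor. -/
theorem Restricted.le_mul_choices (hex : ∀ k i, ∃ c, o.IsPattern k i c) {v : ℕ}
    (h : o.Restricted v) : o.q (v + 1) ≤ 4 * (o.current v).1 * choices o.lo o.hi v := by
  obtain ⟨h1, h2, h3, h4, h5⟩ := h.bounds hex
  have hc : o.q (v + 1) / (o.current v).1 + 1 ≤ 4 * choices o.lo o.hi v := by
    unfold choices; omega
  have h6 := Nat.lt_mul_div_succ (o.q (v + 1)) (by have := four_le_current hex v; omega :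
    0 < (o.current v).1)
  calc o.q (v + 1) ≤ (o.current v).1 * (o.q (v + 1) / (o.current v).1 + 1) := h6.le
    _ ≤ (o.current v).1 * (4 * choices o.lo o.hi v) := Nat.mul_le_mul_left _ hc
    _ = _ := by ring

theorem le_two_mul_choices_of_not_restricted (hq : IsBasicSequence o.q) {v : ℕ}
    (h : ¬ o.Restricted v) : o.q (v + 1) ≤ 2 * choices o.lo o.hi v := by
  have := hq (v + 1) (by omega)
  rw [choices, lo, hi, if_neg h, if_neg h]
  omega

theorem le_log_mul_choices (hq : IsBasicSequence o.q) (hex : ∀ k i, ∃ c, o.IsPattern k i c)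
    (v : ℕ) : o.q (v + 1) ≤ (4 * Nat.log 2 (o.q (v + 1)) + 2) * choices o.lo o.hi v := by
  by_cases h : o.Restricted v
  · refine (h.le_mul_choices hex).trans (Nat.mul_le_mul_right _ ?_)
    have : (o.current v).1 ≤ Nat.log 2 (o.q (v + 1)) := Nat.le_log_of_pow_le (by norm_num) h.2.1
    omega
  · exact (le_two_mul_choices_of_not_restricted hq h).trans (Nat.mul_le_mul_right _ (by omega))

theorem le_index_mul_choices (hq : IsBasicSequence o.q) (hex : ∀ k i, ∃ c, o.IsPattern k i c)
    (v : ℕ) : o.q (v + 1) ≤ (4 * v + 2) * choices o.lo o.hi v := by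
  by_cases h : o.Restricted v
  · refine (h.le_mul_choices hex).trans (Nat.mul_le_mul_right _ ?_)
    have := h.2.2
    omega
  · exact (le_two_mul_choices_of_not_restricted hq h).trans (Nat.mul_le_mul_right _ (by omega))

/-- The set of the points whose digits satisfy the computed bounds. -/
def points (o : Oracle) : Set ℝ := digitSet o.q (fun n => o.lo (n - 1)) fun n => o.hi (n - 1)

theorem dimH_points (hq : IsBasicSequence o.q) (hlim : InfiniteInLimit o.q)
    (hex : ∀ k i, ∃ c, o.IsPattern k i c) : dimH o.points = 1 :=
  dimH_digitSet hq hlim (lo_le_hi hex) (hi_add_two_le hq hex) (le_log_mul_choices hq hex)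
    (le_index_mul_choices hq hex)

/-- The block of digits is rounded inwards, so the whole cylinder of each admissible digit lies in
the target interval. -/
theorem exists_T_bounds (hq : IsBasicSequence o.q) (hex : ∀ k i, ∃ c, o.IsPattern k i c) {x : ℝ}
    (hx : x ∈ o.points) {v : ℕ} (h : o.Restricted v) :
    (o.target v : ℝ) / (o.current v).1 ≤ T o.q v x ∧
      T o.q v x ≤ ((o.target v : ℝ) + 1) / (o.current v).1 := by
  obtain ⟨hx01, E, hE, hb⟩ := hx
  have hb' : ∀ n, (o.lo n : ℤ) ≤ E (n + 1) ∧ E (n + 1) ≤ o.hi n := fun n => by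
    simpa using hb (n + 1) (by omega)
  have hsum : HasSum (fun n => (E (n + 1) : ℝ) / base o.q (n + 1)) x := by
    have := hE.hasSum
    rwa [hE.zero, Int.floor_eq_zero_iff.2 hx01, Int.cast_zero, sub_zero] at this
  obtain ⟨h1, h2⟩ := T_mem_Ico (e := fun n => E (n + 1)) hq (fun n => by
    have := hb' n
    have := hi_add_two_le hq hex n
    constructor <;> omega) hsum v
  obtain ⟨-, e2, -, e4, e5⟩ := h.bounds hex
  obtain ⟨h3, h4⟩ := hb' v
  have hq0 : (0 : ℝ) < o.q (v + 1) := by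
    have := hq (v + 1) (by omega); exact_mod_cast (by omega : 0 < o.q (v + 1))
  have hc0 : (0 : ℝ) < (o.current v).1 := by
    have := four_le_current hex v; exact_mod_cast (by omega : 0 < (o.current v).1)
  constructor
  · refine le_trans ?_ h1
    rw [div_le_div_iff₀ hc0 hq0]
    have h5 : o.target v * o.q (v + 1) < (o.current v).1 * o.lo v := by
      rw [e4]; exact Nat.lt_mul_div_succ _ (by exact_mod_cast hc0)
    have h6 : ((o.lo v : ℤ) : ℝ) ≤ E (v + 1) := by exact_mod_cast h3
    have h7 : (o.target v : ℝ) * o.q (v + 1) ≤ (o.current v).1 * o.lo v := by exact_mod_cast h5.le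
    push_cast at h6
    nlinarith
  · refine h2.trans ?_
    rw [div_le_div_iff₀ hq0 hc0]
    have h5 : (o.hi v + 2) * (o.current v).1 ≤ (o.target v + 1) * o.q (v + 1) := by
      rw [e2]; exact Nat.div_mul_le_self _ _
    have h6 : (E (v + 1) : ℝ) ≤ ((o.hi v : ℤ) : ℝ) := by exact_mod_cast h4
    have h7 : ((o.hi v : ℝ) + 2) * (o.current v).1 ≤ (o.target v + 1) * o.q (v + 1) := by
      exact_mod_cast h5
    push_cast at h6
    nlinarith

/-! ### The distribution of the orbits -/

variable {p : ℕ → ℤ[X]} {f : ℕ → ℕ → ℕ → ℕ → ℝ → ℝ} {s : ℕ → ℕ → ℕ → ℕ → ℕ → ℝ}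

theorem le_cost {k i : ℕ} (h : i ≤ k) :
    (o.pattern k i).2.length + (o.pattern k i).1 + o.growth (2 ^ (o.pattern k i).1) ≤ o.cost k :=
  Finset.single_le_sum (f := fun i => (o.pattern k i).2.length + (o.pattern k i).1 +
    o.growth (2 ^ (o.pattern k i).1)) (fun _ _ => Nat.zero_le _) (by simp; omega)

/-- `x` follows the patterns for the polynomial `i`, except at arguments in `Z`. -/
def Follows (o : Oracle) (ω : ℕ → ℝ) (i : ℕ) (Z : ℕ → Prop) : Prop :=
  ∀ᶠ k in atTop, ∀ n, o.start k ≤ n → n < o.start (k + 1) → ¬ Z n →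
    (entry (o.pattern k i) n : ℝ) / (o.pattern k i).1 ≤ ω n ∧
      ω n ≤ ((entry (o.pattern k i) n : ℝ) + 1) / (o.pattern k i).1

-- At arguments outside Z the value belongs to i, and in late stages it exceeds the cost of the
-- stage. Then the restriction is in force with the pattern of that stage.
open Classical in
theorem exists_follows (hq : IsBasicSequence o.q) (hgrowth : ∀ N j, o.growth N ≤ j → N ≤ o.q j)
    (hex : ∀ k i, ∃ c, o.IsPattern k i c) (h : o.Represents p)
    (hp : ∀ i, EventuallyIncreasing (p i))
    (hsparse : ∀ i j, p i ≠ p j → ¬ Lesssim (p i) (p j) ∨ ¬ Lesssim (p j) (p i)) {i : ℕ}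
    (hi : ∀ j < i, p j ≠ p i) {x : ℝ} (hx : x ∈ o.points) :
    ∃ Z : ℕ → Prop, (∀ ε > 0, ∀ᶠ X in atTop, (Nat.count Z X : ℝ) ≤ ε * X) ∧
      o.Follows (fun n => T o.q ((p i).eval (n : ℤ)).toNat x) i Z := by
  obtain ⟨Z, hZ, hown⟩ := h.exists_exceptional hp hsparse hi
  refine ⟨(· ∈ Z), fun ε hε => ?_, ?_⟩
  · filter_upwards [hZ ε hε] with X hX
    rwa [count_eq_ncard]
  · filter_upwards [eventually_ge_atTop (i + 2)] with k hk n h1 h2 hn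
    obtain ⟨v, hv, hnv, howner, hiv, htime⟩ := hown n hn
    have hcur : o.current v = o.pattern k i := by
      rw [current, howner, htime, stage_eq h1 h2]
    have htar : o.target v = entry (o.pattern k i) n := by
      rw [target, entry, hcur, howner, htime]
    -- The value v is at least n/2, and the factor in the recursion for `start` is at least 2
    -- because k ≥ 2.
    have hcost : o.cost k ≤ v := by
      obtain ⟨j, rfl⟩ : ∃ j, k = j + 1 := ⟨k - 1, by omega⟩
      have h3 : 2 * o.cost (j + 1) ≤ o.start (j + 1) := by
        rw [start_succ]
        exact Nat.mul_le_mul (by omega) (by omega)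
      omega
    have hle := le_cost (o := o) (by omega : i ≤ k)
    have hres : o.Restricted v := by
      refine ⟨by omega, ?_, ?_⟩
      · rw [hcur]; exact hgrowth _ _ (by omega)
      · rw [hcur]; omega
    have := exists_T_bounds hq hex hx hres
    rw [hcur, htar] at this
    simpa [hv] using this

/-- The slack t ≤ f allows the lower function to be used in stages of both parities. -/
theorem Follows.block_left (h : o.Approximates f s) (hs : Determines s f)
    (hf : ∀ σ < 2, ∀ i, IsLinearFamily (f σ i))
    (hex : ∀ k i, ∃ c, o.IsPattern k i c) {ω : ℕ → ℝ} {i : ℕ} {Z : ℕ → Prop}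
    [DecidablePred Z] (hω : o.Follows ω i Z) {m r σ : ℕ} (hr : r < m) (hσ : σ < 2) {γ : ℝ}
    (hγ : γ ∈ Icc (0 : ℝ) 1) {ε : ℝ} (hε : 0 < ε) {t : ℝ} (ht : t ≤ f σ i m r γ) :
    ∀ᶠ k in atTop, k % 2 = σ → ∀ Y, o.start k ≤ Y → Y ≤ o.start (k + 1) →
      (t - ε) / m * ((Y : ℝ) - o.start k) - o.cost k ≤
        (Nat.count (fun n => (n % m = r ∧ ω n < γ) ∨ Z n) Y : ℝ) -
          Nat.count (fun n => (n % m = r ∧ ω n < γ) ∨ Z n) (o.start k) := by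
  have hm : (1 : ℝ) ≤ m := by exact_mod_cast (by omega : 1 ≤ m)
  filter_upwards [hω, eventually_le_count_left h hs hex i hr hσ hγ hε, eventually_ge_atTop m,
    eventually_ge_atTop i] with k hk1 hk2 hk3 hki hkσ Y hY1 hY2
  have hpat := pattern_spec (hex k i)
  have hdvd : m ∣ (o.pattern k i).2.length := by
    have := (hpat.2.2.2 (m - 1) (by omega)).1
    rw [Nat.sub_add_cancel (by omega)] at this
    exact Nat.dvd_of_mod_eq_zero this
  have hfle : f σ i m r γ ≤ 1 := (((hf σ hσ i).isAdf m r hr).mem_Icc hγ).2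
  have h1 := le_count_of_periodic (U := fun n => (n % m = r ∧ ω n < γ) ∨ Z n) hpat.2.1
    (by rw [div_le_one (by linarith)]; linarith) (hk2 hkσ)
    (periodic_mod_entry hdvd fun a => ((a : ℝ) + 1) / (o.pattern k i).1 < γ) hY1
    (fun n hn1 hn2 hn => by
      by_cases hz : Z n
      · exact .inr hz
      · exact .inl ⟨hn.1, (hk1 n hn1 (by omega) hz).2.trans_lt hn.2⟩)
  refine le_trans ?_ h1
  have h2 : ((o.pattern k i).2.length : ℝ) ≤ o.cost k := by
    exact_mod_cast (by have := le_cost (o := o) hki; omega :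
      (o.pattern k i).2.length ≤ o.cost k)
  have h3 : (0 : ℝ) ≤ (Y : ℝ) - o.start k := by
    rw [sub_nonneg]; exact_mod_cast hY1
  gcongr

theorem Follows.block_right (h : o.Approximates f s) (hs : Determines s f)
    (hf : ∀ σ < 2, ∀ i, IsLinearFamily (f σ i))
    (hex : ∀ k i, ∃ c, o.IsPattern k i c) {ω : ℕ → ℝ} {i : ℕ} {Z : ℕ → Prop}
    [DecidablePred Z] (hω : o.Follows ω i Z) {m r σ : ℕ} (hr : r < m) (hσ : σ < 2) {γ : ℝ}
    (hγ : γ ∈ Icc (0 : ℝ) 1) {ε : ℝ} (hε : 0 < ε) {t : ℝ} (ht : t ≤ 1 - f σ i m r γ) :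
    ∀ᶠ k in atTop, k % 2 = σ → ∀ Y, o.start k ≤ Y → Y ≤ o.start (k + 1) →
      (t - ε) / m * ((Y : ℝ) - o.start k) - o.cost k ≤
        (Nat.count (fun n => (n % m = r ∧ γ ≤ ω n) ∨ Z n) Y : ℝ) -
          Nat.count (fun n => (n % m = r ∧ γ ≤ ω n) ∨ Z n) (o.start k) := by
  have hm : (1 : ℝ) ≤ m := by exact_mod_cast (by omega : 1 ≤ m)
  filter_upwards [hω, eventually_le_count_right h hs hex i hr hσ hγ hε, eventually_ge_atTop m,
    eventually_ge_atTop i] with k hk1 hk2 hk3 hki hkσ Y hY1 hY2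
  have hpat := pattern_spec (hex k i)
  have hdvd : m ∣ (o.pattern k i).2.length := by
    have := (hpat.2.2.2 (m - 1) (by omega)).1
    rw [Nat.sub_add_cancel (by omega)] at this
    exact Nat.dvd_of_mod_eq_zero this
  have hfle : 0 ≤ f σ i m r γ := (((hf σ hσ i).isAdf m r hr).mem_Icc hγ).1
  have h1 := le_count_of_periodic (U := fun n => (n % m = r ∧ γ ≤ ω n) ∨ Z n) hpat.2.1
    (by rw [div_le_one (by linarith)]; linarith) (hk2 hkσ)
    (periodic_mod_entry hdvd fun a => γ ≤ (a : ℝ) / (o.pattern k i).1) hY1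
    (fun n hn1 hn2 hn => by
      by_cases hz : Z n
      · exact .inr hz
      · exact .inl ⟨hn.1, hn.2.trans (hk1 n hn1 (by omega) hz).1⟩)
  refine le_trans ?_ h1
  have h2 : ((o.pattern k i).2.length : ℝ) ≤ o.cost k := by
    exact_mod_cast (by have := le_cost (o := o) hki; omega :
      (o.pattern k i).2.length ≤ o.cost k)
  have h3 : (0 : ℝ) ≤ (Y : ℝ) - o.start k := by
    rw [sub_nonneg]; exact_mod_cast hY1
  gcongr

theorem frequently_mod_two_eq {σ : ℕ} (hσ : σ < 2) : ∃ᶠ k in atTop, k % 2 = σ :=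
  frequently_atTop.2 fun N => ⟨2 * N + σ, by omega, by omega⟩

theorem div_sub_le_one {m : ℕ} (hm : 0 < m) {t ε : ℝ} (ht : t ≤ 1) (hε : 0 < ε) :
    (t - ε) / m ≤ 1 := by
  have : (1 : ℝ) ≤ m := by exact_mod_cast hm
  rw [div_le_one (by linarith)]; linarith

/-- Stages of both parities put at least the share f 1 below γ and at least 1 - f 0 at or above γ,
which bounds all frequencies. The ends of even stages come close to f 0 and the ends of odd stages
to f 1. -/
theorem Follows.hasUpperAdf_hasLowerAdf (h : o.Approximates f s) (hs : Determines s f)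
    (hf : ∀ σ < 2, ∀ i, IsLinearFamily (f σ i))
    (hle : ∀ i m r, r < m → ∀ γ ∈ Icc (0 : ℝ) 1, f 1 i m r γ ≤ f 0 i m r γ)
    (hex : ∀ k i, ∃ c, o.IsPattern k i c) {ω : ℕ → ℝ} (hω0 : ∀ n, 0 ≤ ω n) {i : ℕ} {Z : ℕ → Prop}
    [DecidablePred Z] (hZ : ∀ ε > 0, ∀ᶠ X in atTop, (Nat.count Z X : ℝ) ≤ ε * X)
    (hω : o.Follows ω i Z) {m r : ℕ} (hr : r < m) :
    HasUpperAdf (fun n => ω (m * n + r)) (f 0 i m r) ∧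
      HasLowerAdf (fun n => ω (m * n + r)) (f 1 i m r) := by
  have hω0' : ∀ n, 0 ≤ (fun n => ω (m * n + r)) n := fun n => hω0 _
  have hm : 0 < m := by omega
  have hlow : ∀ γ ∈ Icc (0 : ℝ) 1, ∀ ε > 0, ∀ᶠ N in atTop,
      f 1 i m r γ - ε ≤ freq (fun n => ω (m * n + r)) γ N := by
    intro γ hγ ε hε
    have h1 := eventually_le_count_comp hr (P := fun n => ω n < γ) (t := f 1 i m r γ)
      (fun ε hε => by
        refine eventually_le_count (o := o) (Z := Z)
          (div_sub_le_one hm (((hf 1 (by norm_num) i).isAdf m r hr).mem_Icc hγ).2 hε) hZ ?_ hε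
        filter_upwards [hω.block_left h hs hf hex hr (σ := 0) (by norm_num) hγ hε (hle i m r hr γ hγ),
          hω.block_left h hs hf hex hr (σ := 1) (by norm_num) hγ hε le_rfl] with k h0 h1
        rcases Nat.mod_two_eq_zero_or_one k with hk | hk
        · exact h0 hk
        · exact h1 hk) hε
    filter_upwards [h1, eventually_gt_atTop 0] with N hN hN0
    have hN0' : (0 : ℝ) < N := by exact_mod_cast hN0
    rw [← natCast_mul_freq hω0', mul_comm] at hN
    exact le_of_mul_le_mul_left hN hN0'
  have hup : ∀ γ ∈ Icc (0 : ℝ) 1, ∀ ε > 0, ∀ᶠ N in atTop,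
      freq (fun n => ω (m * n + r)) γ N ≤ f 0 i m r γ + ε := by
    intro γ hγ ε hε
    have h1 := eventually_le_count_comp hr (P := fun n => γ ≤ ω n) (t := 1 - f 0 i m r γ)
      (fun ε hε => by
        refine eventually_le_count (o := o) (Z := Z) (div_sub_le_one hm (by
          have := (((hf 0 (by norm_num) i).isAdf m r hr).mem_Icc hγ).1
          linarith) hε) hZ ?_ hε
        filter_upwards [hω.block_right h hs hf hex hr (σ := 0) (by norm_num) hγ hε le_rfl,
          hω.block_right h hs hf hex hr (σ := 1) (t := 1 - f 0 i m r γ) (by norm_num) hγ hε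
            (by linarith [hle i m r hr γ hγ])] with k h0 h1
        rcases Nat.mod_two_eq_zero_or_one k with hk | hk
        · exact h0 hk
        · exact h1 hk) hε
    filter_upwards [h1, eventually_gt_atTop 0] with N hN hN0
    have hN0' : (0 : ℝ) < N := by exact_mod_cast hN0
    rw [← natCast_mul_one_sub_freq hω0', mul_comm] at hN
    have := le_of_mul_le_mul_left hN hN0'
    linarith
  have hfup : ∀ γ ∈ Icc (0 : ℝ) 1, ∀ ε > 0, ∃ᶠ N in atTop,
      f 0 i m r γ - ε ≤ freq (fun n => ω (m * n + r)) γ N := by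
    intro γ hγ ε hε
    have hf1 := (((hf 0 (by norm_num) i).isAdf m r hr).mem_Icc hγ).2
    have h1 := frequently_le_count_comp hr (P := fun n => ω n < γ) (t := f 0 i m r γ) hf1
      (fun ε hε => by
        refine frequently_le_count (o := o) (Z := Z) (div_sub_le_one hm hf1 hε) hZ ?_ hε
        refine ((frequently_mod_two_eq (σ := 0) (by norm_num)).and_eventually
          (hω.block_left h hs hf hex hr (σ := 0) (by norm_num) hγ hε le_rfl)).mono
          fun k hk => ?_
        exact hk.2 hk.1) hε
    refine (h1.and_eventually (eventually_gt_atTop 0)).mono fun N hN => ?_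
    obtain ⟨hN, hN0⟩ := hN
    have hN0' : (0 : ℝ) < N := by exact_mod_cast hN0
    rw [← natCast_mul_freq hω0', mul_comm] at hN
    exact le_of_mul_le_mul_left hN hN0'
  have hflow : ∀ γ ∈ Icc (0 : ℝ) 1, ∀ ε > 0, ∃ᶠ N in atTop,
      freq (fun n => ω (m * n + r)) γ N ≤ f 1 i m r γ + ε := by
    intro γ hγ ε hε
    have hf1 : 1 - f 1 i m r γ ≤ 1 := by
      have := (((hf 1 (by norm_num) i).isAdf m r hr).mem_Icc hγ).1
      linarith
    have h1 := frequently_le_count_comp hr (P := fun n => γ ≤ ω n) (t := 1 - f 1 i m r γ) hf1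
      (fun ε hε => by
        refine frequently_le_count (o := o) (Z := Z) (div_sub_le_one hm hf1 hε) hZ ?_ hε
        refine ((frequently_mod_two_eq (σ := 1) (by norm_num)).and_eventually
          (hω.block_right h hs hf hex hr (σ := 1) (by norm_num) hγ hε le_rfl)).mono
          fun k hk => ?_
        exact hk.2 hk.1) hε
    refine (h1.and_eventually (eventually_gt_atTop 0)).mono fun N hN => ?_
    obtain ⟨hN, hN0⟩ := hN
    have hN0' : (0 : ℝ) < N := by exact_mod_cast hN0
    rw [← natCast_mul_one_sub_freq hω0', mul_comm] at hN
    have := le_of_mul_le_mul_left hN hN0'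
    linarith
  exact ⟨fun γ hγ => limsup_eq_of_forall_pos (freq_nonneg _ γ) (freq_le_one hω0' γ)
      (hup γ hγ) (hfup γ hγ),
    fun γ hγ => liminf_eq_of_forall_pos (freq_nonneg _ γ) (freq_le_one hω0' γ)
      (hlow γ hγ) (hflow γ hγ)⟩

theorem T_nonneg (q : ℕ → ℕ) (n : ℕ) (x : ℝ) : 0 ≤ T q n x := Int.fract_nonneg _

theorem points_subset_Phi (hq : IsBasicSequence o.q)
    (hgrowth : ∀ N j, o.growth N ≤ j → N ≤ o.q j) (hrep : o.Represents p)
    (hp : ∀ i, EventuallyIncreasing (p i))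
    (hsparse : ∀ i j, p i ≠ p j → ¬ Lesssim (p i) (p j) ∨ ¬ Lesssim (p j) (p i))
    {F : ℕ → ℤ[X] → ℕ → ℕ → ℝ → ℝ} (hF : ∀ σ < 2, ∀ i, IsLinearFamily (F σ (p i)))
    (hle : ∀ i m r, r < m → ∀ γ ∈ Icc (0 : ℝ) 1, F 1 (p i) m r γ ≤ F 0 (p i) m r γ)
    (h : o.Approximates (fun σ i => F σ (p i)) s) (hs : Determines s fun σ i => F σ (p i)) :
    o.points ⊆ Phi o.q (range p) (F 0) (F 1) := by
  classical
  intro x hx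
  have hex := h.exists_isPattern hF
  refine ⟨hx.1, ?_⟩
  rintro _ ⟨i₀, rfl⟩ m r hr
  -- Only the first index of a repeated polynomial is sure to own its values.
  obtain ⟨i, hi, hmin⟩ : ∃ i, p i = p i₀ ∧ ∀ j < i, p j ≠ p i := by
    have hne : ∃ i, p i = p i₀ := ⟨i₀, rfl⟩
    refine ⟨Nat.find hne, Nat.find_spec hne, fun j hj => ?_⟩
    rw [Nat.find_spec hne]
    exact Nat.find_min hne hj
  rw [← hi]
  obtain ⟨Z, hZ, hfol⟩ := exists_follows hq hgrowth hex hrep hp hsparse hmin hx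
  exact hfol.hasUpperAdf_hasLowerAdf h hs hF hle hex (fun n => T_nonneg _ _ _) hZ hr

end Oracle

end CantorSeries

namespace CantorSeries

/-! ### The data of a family of distribution functions -/

theorem eval_polyOfList (l : List ℤ) (x : ℤ) :
    (polyOfList l).eval x = ∑ k ∈ Finset.range l.length, l.getD k 0 * x ^ k := by
  induction l with
  | nil => simp [polyOfList]
  | cons a l ih =>
    have h : polyOfList (a :: l) = C a + X * polyOfList l := rfl
    rw [h, eval_add, eval_mul, eval_C, eval_X, ih, List.length_cons, Finset.sum_range_succ',
      Finset.mul_sum]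
    simp only [List.getD_cons_succ, List.getD_cons_zero, pow_zero, mul_one, pow_succ]
    rw [add_comm]
    congr 1
    exact Finset.sum_congr rfl fun k _ => by ring

@[fun_prop]
theorem computable_toNat_neg {α : Type*} [Primcodable α] {f : α → ℤ} (hf : Computable f) :
    Computable fun a => (-f a).toNat := by
  have h : Computable fun z : ℤ => (-z).toNat := by
    have h1 : Computable fun n : ℕ => if n % 2 < 1 then 0 else n / 2 + 1 := by fun_prop
    refine (h1.comp (Computable.encode (α := ℤ))).of_eq fun z => ?_
    cases z with
    | ofNat n =>
      have : Encodable.encode (Int.ofNat n) = 2 * n := rfl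
      rw [this]; simp
    | negSucc n =>
      have : Encodable.encode (Int.negSucc n) = 2 * n + 1 := rfl
      rw [this, if_neg (by omega), Int.neg_negSucc]
      simp; omega
  exact h.comp hf

/-- `F` approximates the reals `x s`, for `s` in `S`. -/
def ApproximatedBy {σ : Type} (S : Set σ) (x : σ → ℝ) (F : σ × ℕ → ℤ) : Prop :=
  ∀ s ∈ S, ∀ k : ℕ, 1 ≤ k → ((F (s, k) : ℝ) - 1) / k < x s ∧ x s < ((F (s, k) : ℝ) + 1) / k

theorem exists_approximatedBy {σ : Type} (S : Set σ) (x : σ → ℝ) : ∃ F, ApproximatedBy S x F := by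
  refine ⟨fun s => ⌊s.2 * x s.1⌋, fun s _ k hk => ?_⟩
  have hk' : (0 : ℝ) < k := by exact_mod_cast hk
  rw [div_lt_iff₀ hk', lt_div_iff₀ hk', mul_comm (x s)]
  have h1 := Int.floor_le ((k : ℝ) * x s)
  have h2 := Int.lt_floor_add_one ((k : ℝ) * x s)
  constructor <;> linarith

/-- For x ≥ 0 the approximating integer exceeds -1, so passing to natural numbers loses nothing. -/
theorem ApproximatedBy.toNat {σ : Type} {S : Set σ} {x : σ → ℝ} {F : σ × ℕ → ℤ}
    (h : ApproximatedBy S x F) {s : σ} (hs : s ∈ S) (hx : 0 ≤ x s) {k : ℕ} (hk : 1 ≤ k) :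
    ((F (s, k)).toNat : ℝ) - 1 < k * x s ∧ k * x s < (F (s, k)).toNat + 1 := by
  have hk' : (0 : ℝ) < k := by exact_mod_cast hk
  obtain ⟨h1, h2⟩ := h s hs k hk
  rw [div_lt_iff₀ hk'] at h1
  rw [lt_div_iff₀ hk'] at h2
  have h3 : (-1 : ℝ) < F (s, k) := by nlinarith [mul_nonneg hx hk'.le]
  have h4 : (-1 : ℤ) < F (s, k) := by exact_mod_cast h3
  have h5 : ((F (s, k)).toNat : ℝ) = F (s, k) := by
    have : ((F (s, k)).toNat : ℤ) = F (s, k) := Int.toNat_of_nonneg (by omega)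
    exact_mod_cast this
  rw [h5, mul_comm (k : ℝ)]
  exact ⟨h1, h2⟩

/-- Integer approximations to a family of distribution functions at the rational points and at a
sequence of points, and to these points. -/
structure FamilyData where
  rat : (ℕ × ℕ × ℕ × ℕ × ℕ) × ℕ → ℤ
  pt : (ℕ × ℕ × ℕ × ℕ) × ℕ → ℤ
  val : (ℕ × ℕ × ℕ × ℕ) × ℕ → ℤ

structure FamilyData.IsComputable (d : FamilyData) : Prop where
  rat : Computable d.rat
  pt : Computable d.pt
  val : Computable d.val

attribute [fun_prop] FamilyData.IsComputable.rat FamilyData.IsComputable.pt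
  FamilyData.IsComputable.val

/-- The data `d` approximate the family `f` at the rational points and at the points `t`, which
comprise the discontinuities. -/
structure FamilyData.Approximates (d : FamilyData) (p : ℕ → ℤ[X]) (f : ℤ[X] → ℕ → ℕ → ℝ → ℝ)
    (t : ℕ × ℕ × ℕ × ℕ → ℝ) : Prop where
  mem : ∀ s, t s ∈ Icc (0 : ℝ) 1
  rat : ApproximatedBy
    {s : ℕ × ℕ × ℕ × ℕ × ℕ | s.2.2.1 < s.2.1 ∧ 1 ≤ s.2.2.2.2 ∧ s.2.2.2.1 ≤ s.2.2.2.2}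
    (fun s => f (p s.1) s.2.1 s.2.2.1 ((s.2.2.2.1 : ℝ) / (s.2.2.2.2 : ℝ))) d.rat
  pt : ApproximatedBy {s | s.2.2.1 < s.2.1} t d.pt
  val : ApproximatedBy {s | s.2.2.1 < s.2.1} (fun s => f (p s.1) s.2.1 s.2.2.1 (t s)) d.val
  discontinuities : ∀ i m r : ℕ, r < m → ∀ x ∈ Icc (0 : ℝ) 1,
    ¬ ContinuousWithinAt (f (p i) m r) (Icc 0 1) x → ∃ n, t (i, m, r, n) = x

theorem ExplicitFamilies.exists_familyData {c : ℕ → List ℤ} {f : ℤ[X] → ℕ → ℕ → ℝ → ℝ}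
    (h : ExplicitFamilies c f) :
    ∃ d t, FamilyData.IsComputable d ∧ d.Approximates (fun i => polyOfList (c i)) f t := by
  obtain ⟨V, hV, hV'⟩ := h.values_rat
  obtain ⟨t, ht, ⟨U, hU, hU'⟩, ⟨W, hW, hW'⟩, hd⟩ := h.discontinuities
  exact ⟨⟨V, U, W⟩, t, ⟨hV, hU, hW⟩, ⟨ht, hV', hU', hW', hd⟩⟩

/-- A monotone function has countably many discontinuities, so they can always be listed; the point
0 is added to make the list non-empty. -/
theorem exists_familyData {p : ℕ → ℤ[X]} {f : ℤ[X] → ℕ → ℕ → ℝ → ℝ}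
    (hf : ∀ i, IsLinearFamily (f (p i))) : ∃ d t, FamilyData.Approximates d p f t := by
  have ht : ∀ s : ℕ × ℕ × ℕ, ∃ u : ℕ → ℝ, (∀ n, u n ∈ Icc (0 : ℝ) 1) ∧
      (s.2.2 < s.2.1 → ∀ x ∈ Icc (0 : ℝ) 1,
        ¬ ContinuousWithinAt (f (p s.1) s.2.1 s.2.2) (Icc 0 1) x → ∃ n, u n = x) := by
    rintro ⟨i, m, r⟩
    by_cases hr : r < m
    · set D := {x | x ∈ Icc (0 : ℝ) 1 ∧ ¬ ContinuousWithinAt (f (p i) m r) (Icc 0 1) x} with hD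
      have hc : (insert 0 D).Countable :=
        Set.Countable.insert 0 ((hf i).isAdf m r hr).1.countable_not_continuousWithinAt
      obtain ⟨u, hu⟩ := hc.exists_eq_range (insert_nonempty 0 D)
      refine ⟨u, fun n => ?_, fun _ x hx hx' => ?_⟩
      · have : u n ∈ insert 0 D := hu ▸ mem_range_self n
        rcases this with h | h
        · rw [h]; simp
        · exact h.1
      · have : x ∈ insert 0 D := mem_insert_of_mem _ ⟨hx, hx'⟩
        rwa [hu] at this
    · exact ⟨fun _ => 0, fun _ => by simp, fun h => absurd h hr⟩
  choose u hu1 hu2 using ht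
  obtain ⟨V, hV⟩ := exists_approximatedBy
    {s : ℕ × ℕ × ℕ × ℕ × ℕ | s.2.2.1 < s.2.1 ∧ 1 ≤ s.2.2.2.2 ∧ s.2.2.2.1 ≤ s.2.2.2.2}
    (fun s => f (p s.1) s.2.1 s.2.2.1 ((s.2.2.2.1 : ℝ) / (s.2.2.2.2 : ℝ)))
  obtain ⟨U, hU⟩ := exists_approximatedBy {s : ℕ × ℕ × ℕ × ℕ | s.2.2.1 < s.2.1}
    (fun s => u (s.1, s.2.1, s.2.2.1) s.2.2.2)
  obtain ⟨W, hW⟩ := exists_approximatedBy {s : ℕ × ℕ × ℕ × ℕ | s.2.2.1 < s.2.1}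
    (fun s => f (p s.1) s.2.1 s.2.2.1 (u (s.1, s.2.1, s.2.2.1) s.2.2.2))
  exact ⟨⟨V, U, W⟩, fun s => u (s.1, s.2.1, s.2.2.1) s.2.2.2,
    ⟨fun s => hu1 _ _, hV, hU, hW, fun i m r hr x hx hx' => hu2 (i, m, r) hr x hx hx'⟩⟩

/-! ### The oracle -/

/-- The numerator of the `j`-th rational number in `[0, 1]`. -/
def ratNum (j : ℕ) : ℕ := j.unpair.1 % (j.unpair.2 + 2)

/-- The denominator of the `j`-th rational number in `[0, 1]`. -/
def ratDen (j : ℕ) : ℕ := j.unpair.2 + 1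

theorem ratNum_le (j : ℕ) : ratNum j ≤ ratDen j := by
  have := Nat.mod_lt j.unpair.1 (by omega : 0 < j.unpair.2 + 2)
  unfold ratNum ratDen; omega

theorem one_le_ratDen (j : ℕ) : 1 ≤ ratDen j := by unfold ratDen; omega

theorem exists_ratNum_div_ratDen {x : ℚ} (hx0 : 0 ≤ x) (hx1 : x ≤ 1) :
    ∃ j, (ratNum j : ℝ) / ratDen j = x := by
  refine ⟨Nat.pair x.num.toNat (x.den - 1), ?_⟩
  have h1 : x.den - 1 + 1 = x.den := by have := x.den_pos; omega
  have h2 : 0 ≤ x.num := Rat.num_nonneg.2 hx0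
  have h3 : x.num ≤ x.den := Rat.num_le_denom_iff.2 hx1
  rw [ratNum, ratDen, Nat.unpair_pair]
  dsimp only
  rw [Nat.mod_eq_of_lt (by omega), h1]
  have h4 : ((x.num.toNat : ℕ) : ℝ) = x.num := by
    have : ((x.num.toNat : ℕ) : ℤ) = x.num := Int.toNat_of_nonneg h2
    exact_mod_cast this
  rw [h4]
  exact_mod_cast Rat.num_div_den x

@[fun_prop]
theorem computable_ratNum {α : Type*} [Primcodable α] {f : α → ℕ} (hf : Computable f) :
    Computable fun a => ratNum (f a) := by
  have h : Computable fun a => (f a).unpair := Computable.unpair.comp hf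
  unfold ratNum; fun_prop

@[fun_prop]
theorem computable_ratDen {α : Type*} [Primcodable α] {f : α → ℕ} (hf : Computable f) :
    Computable fun a => ratDen (f a) := by
  have h : Computable fun a => (f a).unpair := Computable.unpair.comp hf
  unfold ratDen; fun_prop

/-- Approximations to the points at which the family is controlled: the rational points, with even
index, and the points of the data, with odd index. -/
def FamilyData.ptNat (d : FamilyData) (i m r j k : ℕ) : ℕ :=
  if j % 2 = 0 then k * ratNum (j / 2) / ratDen (j / 2) else (d.pt ((i, m, r, j / 2), k)).toNat

/-- Approximations to the values at the points at which the family is controlled. -/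
def FamilyData.valNat (d : FamilyData) (i m r j k : ℕ) : ℕ :=
  if j % 2 = 0 then (d.rat ((i, m, r, ratNum (j / 2), ratDen (j / 2)), k)).toNat
  else (d.val ((i, m, r, j / 2), k)).toNat

/-- The points at which the family is controlled. -/
noncomputable def controlPoint (t : ℕ × ℕ × ℕ × ℕ → ℝ) (i m r j : ℕ) : ℝ :=
  if j % 2 = 0 then (ratNum (j / 2) : ℝ) / ratDen (j / 2) else t (i, m, r, j / 2)

section Family

variable {d : FamilyData} {p : ℕ → ℤ[X]} {f : ℤ[X] → ℕ → ℕ → ℝ → ℝ} {t : ℕ × ℕ × ℕ × ℕ → ℝ}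

theorem FamilyData.Approximates.controlPoint_mem (h : d.Approximates p f t) (i m r j : ℕ) :
    controlPoint t i m r j ∈ Icc (0 : ℝ) 1 := by
  unfold controlPoint
  split_ifs
  · refine ⟨by positivity, div_le_one_of_le₀ ?_ (by positivity)⟩
    exact_mod_cast ratNum_le _
  · exact h.mem _

theorem FamilyData.Approximates.ptNat_bounds (h : d.Approximates p f t) {i m r j k : ℕ}
    (hr : r < m) (hk : 1 ≤ k) :
    (d.ptNat i m r j k : ℝ) - 1 < k * controlPoint t i m r j ∧
      k * controlPoint t i m r j < d.ptNat i m r j k + 1 := by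
  unfold ptNat controlPoint
  split_ifs
  · have h1 : (0 : ℝ) < ratDen (j / 2) := by exact_mod_cast one_le_ratDen _
    have h2 := Nat.div_mul_le_self (k * ratNum (j / 2)) (ratDen (j / 2))
    have h3 := Nat.lt_mul_div_succ (k * ratNum (j / 2)) (one_le_ratDen (j / 2))
    have h2' : ((k * ratNum (j / 2) / ratDen (j / 2) : ℕ) : ℝ) * ratDen (j / 2) ≤
      k * ratNum (j / 2) := by exact_mod_cast h2
    have h3' : (k * ratNum (j / 2) : ℝ) < ratDen (j / 2) *
      ((k * ratNum (j / 2) / ratDen (j / 2) : ℕ) + 1) := by exact_mod_cast h3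
    rw [← mul_div_assoc, lt_div_iff₀ h1, div_lt_iff₀ h1]
    constructor <;> nlinarith
  · exact h.pt.toNat (s := (i, m, r, j / 2)) hr (h.mem _).1 hk

theorem FamilyData.Approximates.valNat_bounds (h : d.Approximates p f t)
    (hf : ∀ i, IsLinearFamily (f (p i))) {i m r j k : ℕ} (hr : r < m) (hk : 1 ≤ k) :
    (d.valNat i m r j k : ℝ) - 1 < k * f (p i) m r (controlPoint t i m r j) ∧
      k * f (p i) m r (controlPoint t i m r j) < d.valNat i m r j k + 1 := by
  have h0 := (((hf i).isAdf m r hr).mem_Icc (h.controlPoint_mem i m r j)).1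
  unfold valNat controlPoint at *
  split_ifs with hj
  · rw [if_pos hj] at h0
    exact h.rat.toNat (s := (i, m, r, ratNum (j / 2), ratDen (j / 2)))
      ⟨hr, one_le_ratDen _, ratNum_le _⟩ h0 hk
  · rw [if_neg hj] at h0
    exact h.val.toNat (s := (i, m, r, j / 2)) hr h0 hk

/-- Where f is continuous, nearby rationals on either side serve; a discontinuity is itself a
control point. -/
theorem FamilyData.Approximates.exists_controlPoint (h : d.Approximates p f t) {i m r : ℕ}
    (hr : r < m) {γ : ℝ} (hγ : γ ∈ Icc (0 : ℝ) 1) {ε : ℝ} (hε : 0 < ε) :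
    (∃ j, controlPoint t i m r j ≤ γ ∧ f (p i) m r γ - ε ≤ f (p i) m r (controlPoint t i m r j)) ∧
    ∃ j, γ ≤ controlPoint t i m r j ∧
      f (p i) m r (controlPoint t i m r j) ≤ f (p i) m r γ + ε := by
  by_cases hc : ContinuousWithinAt (f (p i) m r) (Icc 0 1) γ
  · obtain ⟨δ, hδ, hclose⟩ := Metric.continuousWithinAt_iff.1 hc ε hε
    have hrat : ∀ x : ℚ, (x : ℝ) ∈ Icc (0 : ℝ) 1 → |(x : ℝ) - γ| < δ →
        ∃ j, controlPoint t i m r j = x ∧ |f (p i) m r x - f (p i) m r γ| < ε := by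
      intro x hx hxγ
      obtain ⟨j, hj⟩ := exists_ratNum_div_ratDen (x := x) (by exact_mod_cast hx.1)
        (by exact_mod_cast hx.2)
      refine ⟨2 * j, ?_, by simpa [Real.dist_eq] using hclose hx (by rwa [Real.dist_eq])⟩
      rw [controlPoint, if_pos (by omega), Nat.mul_div_cancel_left _ (by norm_num), hj]
    constructor
    · obtain ⟨x, hx, hx1, hx2⟩ : ∃ x : ℚ, (x : ℝ) ∈ Icc (0 : ℝ) 1 ∧ |(x : ℝ) - γ| < δ ∧
          (x : ℝ) ≤ γ := by
        rcases eq_or_lt_of_le hγ.1 with h0 | h0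
        · exact ⟨0, by simp, by simpa [← h0] using hδ, by simp [← h0]⟩
        · obtain ⟨x, hx1, hx2⟩ := exists_rat_btwn (max_lt h0 (by linarith : γ - δ < γ))
          rw [max_lt_iff] at hx1
          exact ⟨x, ⟨hx1.1.le, hx2.le.trans hγ.2⟩, by rw [abs_lt]; constructor <;> linarith,
            hx2.le⟩
      obtain ⟨j, hj, hj'⟩ := hrat x hx hx1
      rw [abs_lt] at hj'
      exact ⟨j, by rw [hj]; exact hx2, by rw [hj]; linarith⟩
    · obtain ⟨x, hx, hx1, hx2⟩ : ∃ x : ℚ, (x : ℝ) ∈ Icc (0 : ℝ) 1 ∧ |(x : ℝ) - γ| < δ ∧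
          γ ≤ (x : ℝ) := by
        rcases eq_or_lt_of_le hγ.2 with h0 | h0
        · exact ⟨1, by simp, by simpa [h0] using hδ, by simp [h0]⟩
        · obtain ⟨x, hx1, hx2⟩ := exists_rat_btwn (lt_min h0 (by linarith : γ < γ + δ))
          rw [lt_min_iff] at hx2
          exact ⟨x, ⟨hγ.1.trans hx1.le, hx2.1.le⟩, by rw [abs_lt]; constructor <;> linarith,
            hx1.le⟩
      obtain ⟨j, hj, hj'⟩ := hrat x hx hx1
      rw [abs_lt] at hj'
      exact ⟨j, by rw [hj]; exact hx2, by rw [hj]; linarith⟩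
  · obtain ⟨n, hn⟩ := h.discontinuities i m r hr γ hγ hc
    have hj : controlPoint t i m r (2 * n + 1) = γ := by
      rw [controlPoint, if_neg (by omega), show (2 * n + 1) / 2 = n by omega, hn]
    exact ⟨⟨2 * n + 1, hj.le, by rw [hj]; linarith⟩, ⟨2 * n + 1, hj.ge, by rw [hj]; linarith⟩⟩

end Family

/-- The least index from which on the basic sequence is at least `n`. -/
noncomputable def growthModulus (q : ℕ → ℕ) (n : ℕ) : ℕ :=
  sInf {i : ℕ | 1 ≤ i ∧ ∀ j, i ≤ j → n ≤ q j}

theorem le_of_growthModulus_le {q : ℕ → ℕ} (hlim : InfiniteInLimit q) (n j : ℕ)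
    (h : growthModulus q n ≤ j) : n ≤ q j := by
  have hne : {i : ℕ | 1 ≤ i ∧ ∀ j, i ≤ j → n ≤ q j}.Nonempty := by
    obtain ⟨a, ha⟩ := eventually_atTop.1 (tendsto_atTop.1 hlim n)
    exact ⟨a + 1, by omega, fun j hj => ha j (by omega)⟩
  exact (Nat.sInf_mem hne).2 j h

/-- The oracle for given families of upper and lower distribution functions. -/
noncomputable def mkOracle (q : ℕ → ℕ) (pos neg : ℕ × ℕ → ℕ) (d d' : FamilyData) : Oracle where
  q := q
  growth := growthModulus q
  pos := pos
  neg := neg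
  pt s := if s.1.1 = 0 then d.ptNat s.1.2.1 s.1.2.2.1 s.1.2.2.2.1 s.1.2.2.2.2 s.2
    else d'.ptNat s.1.2.1 s.1.2.2.1 s.1.2.2.2.1 s.1.2.2.2.2 s.2
  val s := if s.1.1 = 0 then d.valNat s.1.2.1 s.1.2.2.1 s.1.2.2.2.1 s.1.2.2.2.2 s.2
    else d'.valNat s.1.2.1 s.1.2.2.1 s.1.2.2.2.1 s.1.2.2.2.2 s.2

theorem isComputable_mkOracle {q : ℕ → ℕ} {pos neg : ℕ × ℕ → ℕ} {d d' : FamilyData}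
    (hq : Computable q) (hg : Computable (growthModulus q)) (hpos : Computable pos)
    (hneg : Computable neg) (hd : d.IsComputable) (hd' : d'.IsComputable) :
    (mkOracle q pos neg d d').IsComputable where
  q := hq
  growth := hg
  pos := hpos
  neg := hneg
  pt := by unfold mkOracle FamilyData.ptNat; fun_prop (disch := assumption)
  val := by unfold mkOracle FamilyData.valNat; fun_prop (disch := assumption)

/-! ### The oracle of the given families and its properties -/

section Oracle

variable {q : ℕ → ℕ} {P : Set ℤ[X]} {upper lower : ℤ[X] → ℕ → ℕ → ℝ → ℝ} {p : ℕ → ℤ[X]}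
  {pos neg : ℕ × ℕ → ℕ} {d d' : FamilyData} {t t' : ℕ × ℕ × ℕ × ℕ → ℝ}

theorem approximates_mkOracle (hupper : ∀ i, IsLinearFamily (upper (p i)))
    (hlower : ∀ i, IsLinearFamily (lower (p i))) (hd : d.Approximates p upper t)
    (hd' : d'.Approximates p lower t') :
    (mkOracle q pos neg d d').Approximates
      (fun σ i => (if σ = 0 then upper else lower) (p i))
      (fun σ => controlPoint (if σ = 0 then t else t')) where
  mem σ i m r j := by
    split_ifs
    · exact hd.controlPoint_mem i m r j
    · exact hd'.controlPoint_mem i m r j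
  pt σ i m r j hr k hk := by
    by_cases hσ : σ = 0
    · simpa [mkOracle, hσ] using hd.ptNat_bounds hr hk
    · simpa [mkOracle, hσ] using hd'.ptNat_bounds hr hk
  val σ i m r j hr k hk := by
    by_cases hσ : σ = 0
    · simpa [mkOracle, hσ] using hd.valNat_bounds hupper hr hk
    · simpa [mkOracle, hσ] using hd'.valNat_bounds hlower hr hk

theorem determines_controlPoint (hd : d.Approximates p upper t)
    (hd' : d'.Approximates p lower t') :
    Oracle.Determines (fun σ => controlPoint (if σ = 0 then t else t'))
      (fun σ i => (if σ = 0 then upper else lower) (p i)) := by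
  intro σ _ i m r hr γ hγ ε hε
  by_cases hσ : σ = 0
  · simpa [hσ] using hd.exists_controlPoint hr hγ hε
  · simpa [hσ] using hd'.exists_controlPoint hr hγ hε

theorem mkOracle_spec (hq : IsBasicSequence q) (hlim : InfiniteInLimit q)
    (hp : ∀ i, EventuallyIncreasing (p i)) (hsparse : SparselyIntersecting (range p))
    (hupper : ∀ i, IsLinearFamily (upper (p i))) (hlower : ∀ i, IsLinearFamily (lower (p i)))
    (hle : ∀ i m r, r < m → ∀ x ∈ Icc (0 : ℝ) 1, lower (p i) m r x ≤ upper (p i) m r x)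
    (hpos : ∀ i n, (pos (i, n) : ℤ) = (p i).eval (n : ℤ) + neg (i, n))
    (hd : d.Approximates p upper t) (hd' : d'.Approximates p lower t') :
    (∀ k i, ∃ c, (mkOracle q pos neg d d').IsPattern k i c) ∧
    (mkOracle q pos neg d d').points ⊆ Phi q (range p) upper lower ∧
    dimH (mkOracle q pos neg d d').points = 1 := by
  have happ := approximates_mkOracle (q := q) (pos := pos) (neg := neg) hupper hlower hd hd'
  have hF : ∀ σ < 2, ∀ i, IsLinearFamily ((if σ = 0 then upper else lower) (p i)) := by
    intro σ _ i
    split_ifs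
    · exact hupper i
    · exact hlower i
  have hex := happ.exists_isPattern hF
  refine ⟨hex, ?_, Oracle.dimH_points hq hlim hex⟩
  exact Oracle.points_subset_Phi (o := mkOracle q pos neg d d') (p := p)
    (F := fun σ => if σ = 0 then upper else lower) hq (le_of_growthModulus_le hlim) hpos hp
    (fun i j hij => hsparse _ (mem_range_self i) _ (mem_range_self j) hij) hF
    (by simpa using hle) happ (determines_controlPoint hd hd')

end Oracle

theorem Phi_empty (q : ℕ → ℕ) (upper lower : ℤ[X] → ℕ → ℕ → ℝ → ℝ) :
    Phi q ∅ upper lower = Ico 0 1 := by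
  ext; simp [Phi]

end CantorSeries

/-! ### The main theorem -/

theorem mainTheorem1
    (q : ℕ → ℕ) (hq : CantorSeries.IsBasicSequence q) (hlim : CantorSeries.InfiniteInLimit q)
    (P : Set (Polynomial ℤ)) (hP : ∀ p ∈ P, CantorSeries.EventuallyIncreasing p)
    (hsparse : CantorSeries.SparselyIntersecting P)
    (upper lower : Polynomial ℤ → ℕ → ℕ → ℝ → ℝ)
    (hupper : ∀ p ∈ P, CantorSeries.IsLinearFamily (upper p))
    (hlower : ∀ p ∈ P, CantorSeries.IsLinearFamily (lower p))
    (hle : ∀ p ∈ P, ∀ m r : ℕ, r < m → ∀ x ∈ Set.Icc (0 : ℝ) 1, lower p m r x ≤ upper p m r x) :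
    dimH (CantorSeries.Phi q P upper lower) = 1 ∧
    ∀ c : ℕ → List ℤ,
      Computable q → CantorSeries.ComputablyGrowing q →
      CantorSeries.ComputablyEnumerates c P → CantorSeries.ExplicitlySparse c →
      CantorSeries.ExplicitFamilies c upper → CantorSeries.ExplicitFamilies c lower →
      ∃ α β : ℕ → ℕ, Computable α ∧ Computable β ∧
        CantorSeries.digitSet q α β ⊆ CantorSeries.Phi q P upper lower ∧
        dimH (CantorSeries.digitSet q α β) = 1 := by
  constructor
  · rcases P.eq_empty_or_nonempty with rfl | hne
    -- An empty P cannot be enumerated by ℕ, but then Φ is all of [0,1).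
    · rw [CantorSeries.Phi_empty, Real.dimH_of_nonempty_interior (by simp), Module.finrank_self]
      simp
    · have : Countable ℤ[X] := Cardinal.mk_le_aleph0_iff.1 (by simp)
      obtain ⟨p, rfl⟩ := (Set.to_countable P).exists_eq_range hne
      have hup := fun i => hupper (p i) (mem_range_self i)
      have hlow := fun i => hlower (p i) (mem_range_self i)
      -- Nothing has to be computable here, so the construction runs on arbitrary approximations.
      obtain ⟨d, t, hd⟩ := CantorSeries.exists_familyData hup
      obtain ⟨d', t', hd'⟩ := CantorSeries.exists_familyData hlow
      obtain ⟨-, hsub, hdim⟩ := CantorSeries.mkOracle_spec hq hlim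
        (fun i => hP _ (mem_range_self i)) hsparse hup hlow (fun i => hle _ (mem_range_self i))
        (pos := fun s => ((p s.1).eval (s.2 : ℤ)).toNat)
        (neg := fun s => (-(p s.1).eval (s.2 : ℤ)).toNat) (fun i n => by dsimp only; omega) hd hd'
      exact le_antisymm (CantorSeries.dimH_le_one _) (hdim ▸ dimH_mono hsub)
  · rintro c hqc ⟨-, hg⟩ ⟨hc, rfl⟩ - hEu hEl
    obtain ⟨d, t, hdc, hd⟩ := hEu.exists_familyData
    obtain ⟨d', t', hdc', hd'⟩ := hEl.exists_familyData
    -- Splitting each coefficient into positive and negative parts expresses the polynomial as a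
    -- difference of two sums of natural numbers, both visibly computable.
    set pos : ℕ × ℕ → ℕ := fun s =>
      ∑ k ∈ Finset.range (c s.1).length, ((c s.1).getD k 0).toNat * s.2 ^ k with hpos
    set neg : ℕ × ℕ → ℕ := fun s =>
      ∑ k ∈ Finset.range (c s.1).length, (-(c s.1).getD k 0).toNat * s.2 ^ k with hneg
    obtain ⟨hex, hsub, hdim⟩ := CantorSeries.mkOracle_spec hq hlim
      (fun i => hP _ (mem_range_self i)) hsparse (fun i => hupper _ (mem_range_self i))
      (fun i => hlower _ (mem_range_self i)) (fun i => hle _ (mem_range_self i))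
      (pos := pos) (neg := neg) (fun i n => by
        rw [CantorSeries.eval_polyOfList, hpos, hneg]
        push_cast
        rw [← Finset.sum_add_distrib]
        refine Finset.sum_congr rfl fun k _ => ?_
        rw [← add_mul]
        congr 1
        omega) hd hd'
    have ho : (CantorSeries.mkOracle q pos neg d d').IsComputable :=
      CantorSeries.isComputable_mkOracle hqc hg (by fun_prop) (by fun_prop) hdc hdc'
    exact ⟨_, _, (CantorSeries.Oracle.computable_lo ho hex).comp (by fun_prop),
      (CantorSeries.Oracle.computable_hi ho hex).comp (by fun_prop), hsub, hdim⟩
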